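/- **Setting.** Let $\alpha\ge 2$, $s\ge 1$, $m\ge 1$ be integers, $b$ a prime, $1\le q\le\infty$, and let $\gamma=(\gamma_{u})_{u\subseteq\{1,\dots,s\}}$ be nonnegative real weights. Write $\{1{:}d\}=\{1,\dots,d\}$. *Function space.* For $u\subseteq\{1{:}s\}$, $v\subseteq u$ and $\tau\in\{1{:}\alpha\}^{u\setminus v}$ let $(\alpha_v,\tau_{u\setminus v},0)\in\mathbb N_0^s$ be the multi-index with $j$-th entry $\alpha$ for $j\in v$, $\tau_j$ for $j\in u\setminus v$, and $0$ for $j\notin u$. For continuous $F:[0,1]^s\to\mathbb R$ having integrable weak mixed partial derivatives $\partial^\nu F$ for all $\nu\in\{0,\dots,\alpha\}^s$ (in the sense of integration by parts against $C_c^\infty((0,1)^s)$) put $$\|F\|_{s,\alpha,\gamma,q,\infty}=\max_{u\subseteq\{1:s\}}\gamma_u^{-1}\Bigl(\sum_{v\subseteq u}\ \sum_{\tau\in\{1:\alpha\}^{u\setminus v}}\int_{[0,1]^{|v|}}\Bigl|\int_{[0,1]^{s-|v|}}(\partial^{(\alpha_v,\tau_{u\setminus v},0)}F)(y)\,dy_{\{1:s\}\setminus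 v}\Bigr|^q dy_v\Bigr)^{1/q},$$ with the usual modification (maximum over $v,\tau$ of essential suprema) if $q=\infty$, and with $0^{-1}=\infty$, $\infty\cdot 0=0$. Let $\mathcal W$ be the set of such $F$ with finite norm. *Interlaced polynomial lattice rules.* Let $P\in\mathbb Z_b[x]$ be irreducible of degree $m$, and let $G_{b,m}$ be the set of nonzero polynomials over $\mathbb Z_b$ of degree less than $m$. To $k=\sum_{i\ge 0}\kappa_i b^i\in\mathbb N_0$ (base-$b$ expansion) associate $\mathrm{tr}_m(k)(x)=\sum_{i<m}\kappa_i x^i$. For a formal Laurent series over $\mathbb Z_b$ put $v_m(\sum_\ell t_\ell x^{-\ell})=\sum_{\ell=1}^m t_\ell b^{-\ell}$. For $g\in G_{b,m}^{\alpha s}$ and $0\le n<b^m$, let $z_n\in[0,1)^{\alpha s}$ have components $v_m(\mathrm{tr}_m(n)\,g_i/P)$, $i=1,\dots,\alpha s$. Let $\mathscr D_\alpha(x_1,\dots,x_\alpha)=\sum_{a\ge1}\sum_{j=1}^\alpha \xi_{j,a}b^{-j-(a-1)\alpha}$, where $\xi_{j,a}$ is the $a$-th base-$b$ digit of $x_j\in[0,1)$.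 The interlaced polynomial lattice rule of order $\alpha$ given by $P$ and $g$ is the equal-weight rule with the $b^m$ points $y_n\in[0,1)^s$ whose $j$-th component is $\mathscr D_\alpha(z_{n,(j-1)\alpha+1},\dots,z_{n,j\alpha})$. *Constants.* $$C_{\alpha,b}=\max\Bigl(\tfrac{2}{(2\sin\frac{\pi}{b})^{\alpha}},\max_{1\le z\le\alpha-1}\tfrac{1}{(2\sin\frac{\pi}{b})^z}\Bigr)\Bigl(1+\tfrac1b+\tfrac1{b(b+1)}\Bigr)^{\alpha-2}\Bigl(3+\tfrac2b+\tfrac{2b+1}{b-1}\Bigr),$$ $$\rho_{\alpha,b}(\lambda)=\bigl(C_{\alpha,b}\,b^{\alpha(\alpha-1)/2}\bigr)^{\lambda}\Bigl(\bigl(1+\tfrac{b-1}{b^{\alpha\lambda}-b}\bigr)^{\alpha}-1\Bigr).$$ *Component-by-component (CBC) construction.* For $w\subseteq\{1{:}\alpha s\}$ let $u(w)=\{\lceil j/\alpha\rceil:j\in w\}$ and $\widetilde\gamma_w=C_{\alpha,b}^{|u(w)|}\gamma_{u(w)}b^{\alpha(\alpha-1)|u(w)|/2}$. Let $\mu_1(k)$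 be the number of base-$b$ digits of $k\ge1$. For $1\le d\le\alpha s$ put $$E_d(g_1,\dots,g_d)=\sum_{\emptyset\ne w\subseteq\{1:d\}}\widetilde\gamma_w\sum_{\ell}b^{-\alpha\sum_{j\in w}\mu_1(\ell_j)},$$ where $\ell$ ranges over the positive integer vectors $(\ell_j)_{j\in w}$ with $\sum_{j\in w}\mathrm{tr}_m(\ell_j)\,g_j\equiv 0\pmod P$. A vector $g\in G_{b,m}^{\alpha s}$ is *CBC-constructed* if $g_1=1$ and, for each $d=2,\dots,\alpha s$, $g_d$ minimizes $E_d(g_1,\dots,g_{d-1},\cdot)$ over $G_{b,m}$. **Theorem.** There is an irreducible $P\in\mathbb Z_b[x]$ of degree $m$. For every such $P$ there is a CBC-constructed vector $g$, and for every such $P$ and every CBC-constructed $g$, the points $y_0,\dots,y_{b^m-1}$ of the interlaced polynomial lattice rule of order $\alpha$ given by $P$ and $g$ satisfy $$\Bigl|\frac1{b^m}\sum_{n=0}^{b^m-1}F(y_n)-\int_{[0,1]^s}F(y)\,dy\Bigr|\le\Bigl(\frac{2}{b^m-1}\sum_{\emptyset\ne u\subseteq\{1:s\}}\gamma_u^{\lambda}\,[\rho_{\alpha,b}(\lambda)]^{|u|}\Bigr)^{1/\lambda}\|F\|_{s,\alpha,\gamma,q,\infty}$$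 for all $\lambda\in(1/\alpha,1]$ and all $F\in\mathcal W$. -/

import Mathlib

open MeasureTheory Polynomial
open scoped NNReal ENNReal

noncomputable section

namespace IPL

/-! ### Function spaces on the unit cube -/

/-- The closed unit cube `[0,1]^s`. -/
def cube (s : ℕ) : Set (Fin s → ℝ) := Set.Icc 0 1

/-- The open unit cube `(0,1)^s`. -/
def openCube (s : ℕ) : Set (Fin s → ℝ) := Set.univ.pi fun _ => Set.Ioo (0 : ℝ) 1

/-- The classical partial derivative in the `j`-th coordinate direction. -/
def partialDeriv {s : ℕ} (j : Fin s) (f : (Fin s → ℝ) → ℝ) : (Fin s → ℝ) → ℝ :=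
  fun x => fderiv ℝ f x (Pi.single j 1)

/-- The classical mixed partial derivative `∂^ν f`, used below for smooth test functions only. -/
def mixedPartial {s : ℕ} (ν : Fin s → ℕ) (f : (Fin s → ℝ) → ℝ) : (Fin s → ℝ) → ℝ :=
  (List.finRange s).foldr (fun j g => (partialDeriv j)^[ν j] g) f

/-- `G` is a weak mixed partial derivative `∂^ν F` of `F` on the unit cube: it is integrable and
satisfies the integration by parts formula against all smooth functions with compact support in
the open cube. -/
structure IsWeakDeriv {s : ℕ} (ν : Fin s → ℕ) (F G : (Fin s → ℝ) → ℝ) : Prop where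
  integrableOn : IntegrableOn G (cube s)
  integral_eq : ∀ φ : (Fin s → ℝ) → ℝ, ContDiff ℝ (⊤ : ℕ∞) φ → HasCompactSupport φ →
    tsupport φ ⊆ openCube s →
    ∫ y in cube s, F y * mixedPartial ν φ y = (-1) ^ (∑ j, ν j) * ∫ y in cube s, G y * φ y

open Classical in
/-- The weak mixed partial derivative `∂^ν F`, unique up to null sets (and `0` if there is
none). -/
def weakDeriv {s : ℕ} (ν : Fin s → ℕ) (F : (Fin s → ℝ) → ℝ) : (Fin s → ℝ) → ℝ :=
  if h : ∃ G, IsWeakDeriv ν F G then h.choose else 0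

/-- The `ℓ^p` norm of a finite family in `[0,∞]`, for `1 ≤ p ≤ ∞`. -/
def lpSum {ι : Type*} (p : ℝ≥0∞) (S : Finset ι) (a : ι → ℝ≥0∞) : ℝ≥0∞ :=
  if p = ∞ then S.sup a else (∑ i ∈ S, a i ^ p.toReal) ^ (1 / p.toReal)

/-- The orders of differentiation `(α_v, τ_{u∖v}, 0)`: the order is `α` in the directions of `v`,
is any `τ_j ∈ {1,…,α}` for `j ∈ u ∖ v`, and is `0` outside of `u`. -/
def mixedOrders {s : ℕ} (α : ℕ) (u v : Finset (Fin s)) : Finset (Fin s → ℕ) :=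
  Fintype.piFinset fun j => if j ∈ v then {α} else if j ∈ u then Finset.Icc 1 α else {0}

/-- The higher order unanchored Sobolev norm `‖F‖_{s,α,γ,q,r}`, with values in `[0,∞]`. The inner
integral is over the coordinates outside `v`, so it depends on the coordinates of `y` in `v` only;
the variables over which nothing depends are integrated over `[0,1]` as well, which changes nothing.
For `γ_u = 0` one has `γ_u⁻¹ = ∞`, with `∞ * 0 = 0`. -/
def sobolevENorm {s : ℕ} (α : ℕ) (γ : Finset (Fin s) → ℝ≥0) (q r : ℝ≥0∞)
    (F : (Fin s → ℝ) → ℝ) : ℝ≥0∞ :=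
  lpSum r (Finset.univ : Finset (Finset (Fin s))) fun u =>
    (γ u : ℝ≥0∞)⁻¹ *
      lpSum q (u.powerset.sigma fun v => mixedOrders α u v) fun p =>
        eLpNorm (fun y => ∫ z in cube s, weakDeriv p.2 F (p.1.piecewise y z)) q
          (volume.restrict (cube s))

/-- Membership in the space `W_{s,α,γ,q,r}`: continuous functions on the cube with weak
mixed partial derivatives of order up to `α` in each variable and with finite norm. -/
structure MemSobolev {s : ℕ} (α : ℕ) (γ : Finset (Fin s) → ℝ≥0) (q r : ℝ≥0∞)
    (F : (Fin s → ℝ) → ℝ) : Prop where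
  continuousOn : ContinuousOn F (cube s)
  exists_weakDeriv : ∀ ν : Fin s → ℕ, (∀ j, ν j ≤ α) → ∃ G, IsWeakDeriv ν F G
  norm_lt_top : sobolevENorm α γ q r F < ∞

/-! ### Polynomial lattice point sets and interlacing -/

/-- `P` is an admissible modulus: an irreducible polynomial over `ℤ_b` of degree `m`. -/
def IsModulus (b m : ℕ) (P : (ZMod b)[X]) : Prop := Irreducible P ∧ P.natDegree = m

/-- The set `G_{b,m}` of nonzero polynomials over `ℤ_b` of degree less than `m`. -/
def polySet (b m : ℕ) : Set (ZMod b)[X] := {p | p ≠ 0 ∧ p.degree < m}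

/-- The polynomial `κ_0 + κ_1 x + ⋯ + κ_{m-1} x^{m-1}` made of the first `m` digits of
`k = κ_0 + κ_1 b + κ_2 b² + ⋯`. -/
def truncPoly (b m k : ℕ) : (ZMod b)[X] :=
  ∑ i ∈ Finset.range m, C ((k / b ^ i % b : ℕ) : ZMod b) * X ^ i

/-- The embedding of `ℤ_b[x]` in the field of formal Laurent series in `x⁻¹`, that is, in Mathlib's
Laurent series in a variable that plays the role of `x⁻¹`. -/
def toLaurentInv (b : ℕ) (p : (ZMod b)[X]) : LaurentSeries (ZMod b) :=
  p.eval₂ HahnSeries.C (HahnSeries.single (-1 : ℤ) 1)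

/-- The map `v_m`: `∑ t_ℓ x^{-ℓ} ↦ ∑_{1 ≤ ℓ ≤ m} t_ℓ b^{-ℓ}`. -/
def vmap (b m : ℕ) (L : LaurentSeries (ZMod b)) : ℝ :=
  ∑ l ∈ Finset.Icc 1 m, ((L.coeff (l : ℤ)).val : ℝ) / (b : ℝ) ^ l

/-- The `n`-th point of the polynomial lattice with modulus `P` and generating vector `g`. -/
def latticePoint (b m : ℕ) [Fact b.Prime] {d : ℕ} (P : (ZMod b)[X]) (g : Fin d → (ZMod b)[X])
    (n : ℕ) : Fin d → ℝ :=
  fun j => vmap b m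
    (toLaurentInv b (truncPoly b m n) * toLaurentInv b (g j) / toLaurentInv b P)

/-- The `a`-th digit (`a ≥ 1`) of `x ∈ [0,1)` in base `b`. -/
def digit (b : ℕ) (x : ℝ) (a : ℕ) : ℕ := ⌊(b : ℝ) ^ a * x⌋₊ % b

/-- The digit interlacing function with interlacing factor `α`; the indices `a` and `j` are
shifted to start from zero. -/
def interlace (b α : ℕ) (x : Fin α → ℝ) : ℝ :=
  ∑' a : ℕ, ∑ j : Fin α, (digit b (x j) (a + 1) : ℝ) / (b : ℝ) ^ ((j : ℕ) + 1 + a * α)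

/-- The `n`-th point of the interlaced polynomial lattice rule of order `α` in `s` dimensions:
the `j`-th coordinate interlaces the `j`-th block of `α` coordinates of the polynomial lattice
point. -/
def interlacedPoint (b m α : ℕ) [Fact b.Prime] {s : ℕ} (P : (ZMod b)[X])
    (g : Fin (s * α) → (ZMod b)[X]) (n : ℕ) : Fin s → ℝ :=
  fun j => interlace b α fun i => latticePoint b m P g n (finProdFinEquiv (j, i))

/-! ### The constants and the component-by-component construction -/

/-- The constant `C_{α,b}`, for `α ≥ 2`. -/
def constC (α b : ℕ) : ℝ :=
  max (2 / (2 * Real.sin (Real.pi / b)) ^ α)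
      (⨆ z : Finset.Icc 1 (α - 1), 1 / (2 * Real.sin (Real.pi / b)) ^ (z : ℕ)) *
    (1 + 1 / (b : ℝ) + 1 / ((b : ℝ) * (b + 1))) ^ (α - 2) *
    (3 + 2 / (b : ℝ) + (2 * b + 1) / ((b : ℝ) - 1))

/-- The constant `ρ_{α,b}(λ)`. -/
def rho (α b : ℕ) (lam : ℝ) : ℝ :=
  (constC α b * (b : ℝ) ^ (α * (α - 1) / 2)) ^ lam *
    ((1 + ((b : ℝ) - 1) / ((b : ℝ) ^ ((α : ℝ) * lam) - b)) ^ α - 1)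

/-- `μ_1(k)`: the number of digits of `k` in base `b`, with `μ_1(0) = 0`. -/
def mu1 (b k : ℕ) : ℕ := (b.digits k).length

/-- The set `u(v)` of the blocks of length `α` that meet `v`. -/
def blocks {s α : ℕ} (v : Finset (Fin (s * α))) : Finset (Fin s) := v.image Fin.divNat

/-- The weight `C_{α,b}^{|u(v)|} γ_{u(v)} b^{α(α-1)|u(v)|/2}`. -/
def cbcWeight (b : ℕ) {s α : ℕ} (γ : Finset (Fin s) → ℝ≥0) (v : Finset (Fin (s * α))) : ℝ :=
  constC α b ^ (blocks v).card * γ (blocks v) * (b : ℝ) ^ (α * (α - 1) / 2 * (blocks v).card)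

/-- The dual net without zero components, projected to the components in `v`. -/
def dualNet (b m : ℕ) {d : ℕ} (P : (ZMod b)[X]) (g : Fin d → (ZMod b)[X]) (v : Finset (Fin d)) :
    Set (v → ℕ) :=
  {l | (∀ j, 0 < l j) ∧ P ∣ ∑ j, truncPoly b m (l j) * g j}

/-- The search criterion `E_d(g_1,…,g_d)`; it depends on the first `d` components of `g` only. -/
def criterion (b m : ℕ) {s α : ℕ} (γ : Finset (Fin s) → ℝ≥0) (P : (ZMod b)[X])
    (d : ℕ) (g : Fin (s * α) → (ZMod b)[X]) : ℝ≥0∞ :=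
  ∑ v : Finset (Fin (s * α)) with v.Nonempty ∧ ∀ j ∈ v, j.val < d,
    ENNReal.ofReal (cbcWeight b γ v) *
      ∑' l : dualNet b m P g v, ((b : ℝ≥0∞) ^ (α * ∑ j, mu1 b (l.1 j)))⁻¹

/-- `g` is an output of the component-by-component algorithm: the first component is `1`, and
each further component minimizes the criterion over `G_{b,m}`, given the previous ones. -/
structure IsCBC (b m : ℕ) {s α : ℕ} (γ : Finset (Fin s) → ℝ≥0) (P : (ZMod b)[X])
    (g : Fin (s * α) → (ZMod b)[X]) : Prop where
  mem : ∀ j, g j ∈ polySet b m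
  first : ∀ j : Fin (s * α), j.val = 0 → g j = 1
  minimal : ∀ j : Fin (s * α), 0 < j.val → ∀ p ∈ polySet b m,
    criterion b m γ P (j.val + 1) g ≤ criterion b m γ P (j.val + 1) (Function.update g j p)

end IPL

end

/-!
Integrating the `k`-th Walsh function by parts removes its highest nonzero digit, say the `N`-th:
the other digits are constant on the intervals of length `b ^ (1 - N)`, while the character of the
`N`-th digit has mean zero there, so that its primitive is periodic and of size `b ^ (-N)`. After
`α` integrations, or as soon as no nonzero digit is left, the Walsh coefficient of `F` is bounded by
the norm of a derivative times `b ^ (-(N₁ + N₂ + ⋯))`, where `N₁ > N₂ > ⋯` are the positions of the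
(at most `α`) highest nonzero digits. If `k` interlaces `ℓ₁, …, ℓ_α`, then the leading digits of the
`ℓ_i ≠ 0` stand at different positions in `k`, so that this power is at most
`b ^ (-α (μ₁(ℓ₁) + ⋯ + μ₁(ℓ_α)))` up to a constant.

Averaging the Walsh functions over the point set leaves only those with index in the dual net, hence
the error of the rule is at most the search criterion times the norm of `F`. For `lam ≤ 1` the power
`lam` is subadditive, and a given `ℓ` is in the dual net for at most one candidate, unless
`tr_m(ℓ_j) = 0`. Since a minimum is at most the average over all candidates, the power `lam` of
the criterion stays below the asserted sum in each step of the construction.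
-/

namespace IPL

section PeriodicFunctions

/-! ### Primitives of periodic functions -/

variable {E : Type*} [NormedAddCommGroup E]

lemma intervalIntegrable_of_norm_le {f : ℝ → E} (hf : AEStronglyMeasurable f) {C : ℝ}
    (hC : ∀ x, ‖f x‖ ≤ C) (a b : ℝ) : IntervalIntegrable f volume a b :=
  (intervalIntegrable_const (c := C)).mono_fun hf.restrict
    (.of_forall fun x => (hC x).trans (le_abs_self C))

variable [NormedSpace ℝ E]

lemma periodic_primitive_of_integral_eq_zero {f : ℝ → E} {T : ℝ} (hf : f.Periodic T)
    (hf_int : ∀ a b, IntervalIntegrable f volume a b) (hzero : ∫ x in (0 : ℝ)..T, f x = 0) :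
    Function.Periodic (fun x => ∫ y in (0 : ℝ)..x, f y) T := fun x => by
  simpa [hzero] using hf.intervalIntegral_add_eq_add 0 x hf_int

lemma norm_integral_le_half_period {f : ℝ → E} {T C : ℝ} (hT : 0 < T) (hf : f.Periodic T)
    (hf_int : ∀ a b, IntervalIntegrable f volume a b) (hzero : ∫ x in (0 : ℝ)..T, f x = 0)
    (hC : ∀ x, ‖f x‖ ≤ C) (a b : ℝ) : ‖∫ x in a..b, f x‖ ≤ T * C / 2 := by
  have bound : ∀ c d, c ≤ d → ‖∫ x in c..d, f x‖ ≤ C * (d - c) := fun c d hcd => by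
    simpa [abs_of_nonneg (sub_nonneg.2 hcd)] using
      intervalIntegral.norm_integral_le_of_norm_le_const (a := c) (b := d) fun x _ => hC x
  obtain ⟨c, ⟨hac, hca⟩, hbc⟩ :=
    (periodic_primitive_of_integral_eq_zero hf hf_int hzero).exists_mem_Ico hT b a
  have from_left : ∫ x in a..b, f x = ∫ x in a..c, f x := by
    rw [← intervalIntegral.integral_interval_sub_left (hf_int 0 b) (hf_int 0 a), hbc,
      intervalIntegral.integral_interval_sub_left (hf_int 0 c) (hf_int 0 a)]
  have from_right : ∫ x in a..c, f x = -∫ x in c..(a + T), f x := by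
    rw [eq_neg_iff_add_eq_zero, intervalIntegral.integral_add_adjacent_intervals (hf_int _ _)
      (hf_int _ _), hf.intervalIntegral_add_eq a 0, zero_add, hzero]
  have h₁ := bound a c hac
  have h₂ := bound c (a + T) hca.le
  rw [from_left]
  rw [← norm_neg, ← from_right] at h₂
  linarith

lemma periodic_nat_mul_of_twisted {f : ℝ → ℂ} {T : ℝ} {ζ : ℂ} {n : ℕ} (hζ : ζ ^ n = 1)
    (hf : ∀ x, f (x + T) = ζ * f x) : f.Periodic (n * T) := fun x => by
  have iterate : ∀ k : ℕ, f (x + k * T) = ζ ^ k * f x := fun k => by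
    induction k with
    | zero => simp
    | succ k ih => rw [Nat.cast_succ, add_one_mul, ← add_assoc, hf, ih, pow_succ', mul_assoc]
  rw [iterate, hζ, one_mul]

lemma periodic_norm_of_twisted {f : ℝ → ℂ} {T : ℝ} {ζ : ℂ} (hζ : ‖ζ‖ = 1)
    (hf : ∀ x, f (x + T) = ζ * f x) : Function.Periodic (fun x => ‖f x‖) T := fun x => by
  simp only [hf, norm_mul, hζ, one_mul]

lemma primitive_sub_twisted {f : ℝ → ℂ} {T : ℝ} {ζ : ℂ} (hζ : ζ ≠ 1)
    (hf_int : ∀ a b, IntervalIntegrable f volume a b) (hf : ∀ x, f (x + T) = ζ * f x) (x : ℝ) :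
    (∫ y in (0 : ℝ)..(x + T), f y) - (∫ y in (0 : ℝ)..T, f y) / (1 - ζ) =
      ζ * ((∫ y in (0 : ℝ)..x, f y) - (∫ y in (0 : ℝ)..T, f y) / (1 - ζ)) := by
  have h1ζ : (1 : ℂ) - ζ ≠ 0 := sub_ne_zero.2 hζ.symm
  have shift : ∫ y in T..(x + T), f y = ζ * ∫ y in (0 : ℝ)..x, f y := by
    rw [← intervalIntegral.integral_const_mul]
    simp_rw [← hf]
    rw [intervalIntegral.integral_comp_add_right, zero_add]
  rw [← intervalIntegral.integral_add_adjacent_intervals (hf_int 0 T) (hf_int T _), shift]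
  field_simp
  ring

lemma integral_eq_zero_of_twisted {f : ℝ → ℂ} {T δ : ℝ} {ζ : ℂ} (hζ : ζ ≠ 1)
    (hT : f.Periodic T) (hδ : ∀ x, f (x + δ) = ζ * f x) : ∫ x in (0 : ℝ)..T, f x = 0 := by
  have shift : ζ * ∫ x in (0 : ℝ)..T, f x = ∫ x in (0 : ℝ)..T, f x := by
    rw [← intervalIntegral.integral_const_mul]
    simp_rw [← hδ]
    rw [intervalIntegral.integral_comp_add_right, zero_add, add_comm T,
      hT.intervalIntegral_add_eq δ 0, zero_add]
  by_contra hne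
  exact hζ ((mul_eq_right₀ hne).1 shift)

/-- On each interval `[n T, (n + 1) T)` the second factor is constant, and the primitive of the
first one vanishes at the end points of these intervals. -/
lemma integral_mul_eq_of_const_on_cells {f u : ℝ → ℂ} {T : ℝ} (hT : 0 < T) (hf : f.Periodic T)
    (hf_int : ∀ a b, IntervalIntegrable f volume a b)
    (hmul_int : ∀ a b, IntervalIntegrable (fun x => f x * u x) volume a b)
    (hzero : ∫ x in (0 : ℝ)..T, f x = 0) (hu : ∀ x y, ⌊x / T⌋ = ⌊y / T⌋ → u x = u y)
    {x : ℝ} (hx : 0 ≤ x) : ∫ y in (0 : ℝ)..x, f y * u y = (∫ y in (0 : ℝ)..x, f y) * u x := by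
  have floor_eq : ∀ (n : ℕ) (y : ℝ), n * T ≤ y → y < (n + 1) * T → ⌊y / T⌋ = n := fun n y h₁ h₂ =>
    Int.floor_eq_iff.2 ⟨by exact_mod_cast (le_div_iff₀ hT).2 h₁,
      by exact_mod_cast (div_lt_iff₀ hT).2 h₂⟩
  have primitive_grid : ∀ n : ℕ, ∫ y in (0 : ℝ)..(n * T), f y = 0 := fun n => by
    simpa using (periodic_primitive_of_integral_eq_zero hf hf_int hzero).nat_mul_eq n
  have cell : ∀ (n : ℕ) (y : ℝ), n * T ≤ y → y ≤ (n + 1) * T →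
      ∫ t in (n * T)..y, f t * u t = (∫ t in (0 : ℝ)..y, f t) * u (n * T) := by
    intro n y hny hyn
    have const : Set.EqOn (fun t => f t * u t) (fun t => f t * u (n * T)) (Set.Ioo (n * T) y) :=
      fun t ht => by
        simp only
        rw [hu t (n * T) ((floor_eq n t ht.1.le (ht.2.trans_le hyn)).trans
          (floor_eq n _ le_rfl (by linarith)).symm)]
    rw [intervalIntegral.integral_congr_Ioo_of_le hny const, intervalIntegral.integral_mul_const,
      ← intervalIntegral.integral_interval_sub_left (hf_int 0 y) (hf_int 0 _), primitive_grid,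
      sub_zero]
  have mul_grid : ∀ n : ℕ, ∫ y in (0 : ℝ)..(n * T), f y * u y = 0 := by
    intro n
    induction n with
    | zero => simp
    | succ n ih =>
      rw [← intervalIntegral.integral_add_adjacent_intervals (hmul_int 0 (n * T)) (hmul_int _ _),
        ih, cell n _ (by push_cast; linarith) (by push_cast; rfl), primitive_grid]
      simp
  have hxT : 0 ≤ x / T := by positivity
  have lower : ⌊x / T⌋₊ * T ≤ x := (le_div_iff₀ hT).1 (Nat.floor_le hxT)
  have upper : x < (⌊x / T⌋₊ + 1) * T := (div_lt_iff₀ hT).1 (Nat.lt_floor_add_one _)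
  rw [← intervalIntegral.integral_add_adjacent_intervals (hmul_int 0 (⌊x / T⌋₊ * T))
    (hmul_int _ _), mul_grid, zero_add, cell _ x lower upper.le,
    hu _ x ((floor_eq _ _ le_rfl (by linarith)).trans (floor_eq _ _ lower upper).symm)]

/-- A measurable function of period `T` with mean `μ` over a period that stays within distance `ω`
of its mean. The pair `(μ, ω)` is what the decay estimate of the Walsh coefficients keeps track of
when it takes repeated primitives. -/
structure PeriodicMeanOsc (T : ℝ) (f : ℝ → ℂ) (μ : ℂ) (ω : ℝ) : Prop where
  measurable : Measurable f
  periodic : f.Periodic T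
  integral_eq : ∫ x in (0 : ℝ)..T, f x = T * μ
  norm_sub_le : ∀ x, ‖f x - μ‖ ≤ ω

namespace PeriodicMeanOsc

variable {T : ℝ} {f : ℝ → ℂ} {μ : ℂ} {ω : ℝ}

lemma const (T : ℝ) (c : ℂ) : PeriodicMeanOsc T (fun _ => c) c 0 where
  measurable := measurable_const
  periodic := fun _ => rfl
  integral_eq := by simp
  norm_sub_le := by simp

lemma norm_le (h : PeriodicMeanOsc T f μ ω) (x : ℝ) : ‖f x‖ ≤ ‖μ‖ + ω := by
  linarith [norm_le_norm_add_norm_sub' (f x) μ, h.norm_sub_le x]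

lemma intervalIntegrable (h : PeriodicMeanOsc T f μ ω) (a b : ℝ) :
    IntervalIntegrable f volume a b :=
  intervalIntegrable_of_norm_le h.measurable.aestronglyMeasurable h.norm_le a b

lemma nat_mul (h : PeriodicMeanOsc T f μ ω) (n : ℕ) : PeriodicMeanOsc (n * T) f μ ω where
  measurable := h.measurable
  periodic := h.periodic.nat_mul n
  integral_eq := by
    have := h.periodic.intervalIntegral_add_zsmul_eq n 0 h.intervalIntegrable
    simp only [zero_add, h.integral_eq, natCast_zsmul, nsmul_eq_mul] at this
    rw [this]
    push_cast
    ring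
  norm_sub_le := h.norm_sub_le

lemma integral_sub_mean (h : PeriodicMeanOsc T f μ ω) (a : ℝ) :
    ∫ x in (0 : ℝ)..a, (f x - μ) = (∫ x in (0 : ℝ)..a, f x) - a * μ := by
  rw [intervalIntegral.integral_sub (h.intervalIntegrable _ _) intervalIntegrable_const]
  simp

lemma integral_sub_mean_period (h : PeriodicMeanOsc T f μ ω) :
    ∫ x in (0 : ℝ)..T, (f x - μ) = 0 := by
  rw [h.integral_sub_mean, h.integral_eq, sub_self]

lemma norm_integral_sub_mean_le (h : PeriodicMeanOsc T f μ ω) (hT : 0 < T) (a b : ℝ) :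
    ‖∫ x in a..b, (f x - μ)‖ ≤ T * ω / 2 :=
  norm_integral_le_half_period hT (fun x => by simp only [h.periodic x])
    (fun a b => (h.intervalIntegrable a b).sub intervalIntegrable_const)
    h.integral_sub_mean_period h.norm_sub_le a b

lemma primitive_sub_mean (h : PeriodicMeanOsc T f μ ω) (hT : 0 < T) :
    PeriodicMeanOsc T (fun x => ∫ y in (0 : ℝ)..x, (f y - μ))
      ((T : ℂ)⁻¹ * ∫ x in (0 : ℝ)..T, ∫ y in (0 : ℝ)..x, (f y - μ)) (T * ω / 2) := by
  have hf_int : ∀ a b, IntervalIntegrable (fun x => f x - μ) volume a b := fun a b =>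
    (h.intervalIntegrable a b).sub intervalIntegrable_const
  set H : ℝ → ℂ := fun x => ∫ y in (0 : ℝ)..x, (f y - μ) with hH
  have hHc : Continuous H := intervalIntegral.continuous_primitive hf_int 0
  have hT' : (T : ℂ) ≠ 0 := by exact_mod_cast hT.ne'
  refine ⟨hHc.measurable, periodic_primitive_of_integral_eq_zero
    (fun x => by simp only [h.periodic x]) hf_int h.integral_sub_mean_period,
    by simp [hT'], fun x => ?_⟩
  have average : H x - (T : ℂ)⁻¹ * ∫ y in (0 : ℝ)..T, H y =
      (T : ℂ)⁻¹ * ∫ y in (0 : ℝ)..T, (H x - H y) := by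
    rw [intervalIntegral.integral_sub intervalIntegrable_const (hHc.intervalIntegrable _ _)]
    simp only [intervalIntegral.integral_const, sub_zero, Complex.real_smul]
    field_simp
  have osc : ∀ y, ‖H x - H y‖ ≤ T * ω / 2 := fun y => by
    rw [hH, intervalIntegral.integral_interval_sub_left (hf_int _ _) (hf_int _ _)]
    exact h.norm_integral_sub_mean_le hT y x
  have := intervalIntegral.norm_integral_le_of_norm_le_const (a := 0) (b := T) fun y _ => osc y
  rw [average, norm_mul, norm_inv, Complex.norm_real, Real.norm_of_nonneg hT.le]
  rw [sub_zero, abs_of_pos hT, mul_comm] at this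
  exact (inv_mul_le_iff₀ hT).2 this

lemma norm_integral_sub_div_le (h : PeriodicMeanOsc T f μ ω) (hT : 0 < T) {ζ : ℂ}
    (hζ : ‖ζ‖ = 1) (hζ1 : ζ ≠ 1) {x : ℝ} (hx : x ∈ Set.Icc 0 T) :
    ‖(∫ y in (0 : ℝ)..x, f y) - T * μ / (1 - ζ)‖ ≤ T * (‖μ‖ / ‖1 - ζ‖ + ω / 2) := by
  have h1ζ : (1 : ℂ) - ζ ≠ 0 := sub_ne_zero.2 hζ1.symm
  have hT' : (T : ℂ) ≠ 0 := by exact_mod_cast hT.ne'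
  have split : (∫ y in (0 : ℝ)..x, f y) - T * μ / (1 - ζ) =
      (∫ y in (0 : ℝ)..x, (f y - μ)) - T * μ / (1 - ζ) * ((1 - x / T : ℝ) + (x / T : ℝ) * ζ) := by
    rw [h.integral_sub_mean]
    push_cast
    field_simp
    ring
  have convex : ‖((1 - x / T : ℝ) + (x / T : ℝ) * ζ : ℂ)‖ ≤ 1 := by
    have h₀ : 0 ≤ x / T := div_nonneg hx.1 hT.le
    have h₁ : 0 ≤ 1 - x / T := sub_nonneg.2 ((div_le_one hT).2 hx.2)
    refine (norm_add_le _ _).trans ?_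
    rw [norm_mul, hζ, Complex.norm_real, Complex.norm_real, Real.norm_of_nonneg h₀,
      Real.norm_of_nonneg h₁]
    linarith
  calc ‖(∫ y in (0 : ℝ)..x, f y) - T * μ / (1 - ζ)‖
      ≤ T * ω / 2 + ‖(T * μ / (1 - ζ) : ℂ)‖ * 1 := by
        rw [split]
        refine (_root_.norm_sub_le _ _).trans (add_le_add (h.norm_integral_sub_mean_le hT _ _) ?_)
        rw [norm_mul]
        gcongr
    _ = T * (‖μ‖ / ‖1 - ζ‖ + ω / 2) := by
        rw [norm_div, norm_mul, Complex.norm_real, Real.norm_of_nonneg hT.le]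
        ring

/-- With `c = T μ / (1 - ζ)` the primitive `G` satisfies `G (x + T) - c = ζ (G x - c)`, so that
it has mean `c`, and `G - c` only needs to be estimated on `[0, T]`. -/
lemma primitive_twisted (h : PeriodicMeanOsc T f μ ω) (hT : 0 < T) {ζ : ℂ} (hζ1 : ζ ≠ 1) {n : ℕ}
    (hn : n ≠ 0) (hζn : ζ ^ n = 1) {g : ℝ → ℂ} (hg : Measurable g)
    (hgT : ∀ x, g (x + T) = ζ * g x) (hgf : ∀ x ∈ Set.Ico 0 T, g x = f x) :
    PeriodicMeanOsc (n * T) (fun x => ∫ y in (0 : ℝ)..x, g y) (T * μ / (1 - ζ))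
      (T * (‖μ‖ / ‖1 - ζ‖ + ω / 2)) := by
  have hζ : ‖ζ‖ = 1 := Complex.norm_eq_one_of_pow_eq_one hζn hn
  have g_norm_le : ∀ x, ‖g x‖ ≤ ‖μ‖ + ω := fun x => by
    obtain ⟨y, hy, hxy⟩ := (periodic_norm_of_twisted hζ hgT).exists_mem_Ico₀ hT x
    simpa only [hxy, hgf y hy] using h.norm_le y
  have hg_int := intervalIntegrable_of_norm_le hg.aestronglyMeasurable g_norm_le
  have eq_on_cell : ∀ x ∈ Set.Icc 0 T, ∫ y in (0 : ℝ)..x, g y = ∫ y in (0 : ℝ)..x, f y :=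
    fun x hx => intervalIntegral.integral_congr_Ioo_of_le hx.1 fun y hy =>
      hgf y ⟨hy.1.le, hy.2.trans_le hx.2⟩
  have shift := primitive_sub_twisted hζ1 hg_int hgT
  rw [eq_on_cell T ⟨hT.le, le_rfl⟩, h.integral_eq] at shift
  set c : ℂ := T * μ / (1 - ζ)
  have hGc : Continuous fun x => ∫ y in (0 : ℝ)..x, g y :=
    intervalIntegral.continuous_primitive hg_int 0
  have periodic_sub :=
    periodic_nat_mul_of_twisted (f := fun x => (∫ y in (0 : ℝ)..x, g y) - c) hζn shift
  refine ⟨hGc.measurable, fun x => sub_left_inj.1 (periodic_sub x), ?_, fun x => ?_⟩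
  · have mean_sub := integral_eq_zero_of_twisted hζ1 periodic_sub shift
    rw [intervalIntegral.integral_sub (hGc.intervalIntegrable _ _) intervalIntegrable_const,
      sub_eq_zero] at mean_sub
    simpa using mean_sub
  · obtain ⟨y, hy, hxy⟩ := (periodic_norm_of_twisted
      (f := fun x => (∫ y in (0 : ℝ)..x, g y) - c) hζ shift).exists_mem_Ico₀ hT x
    rw [hxy, eq_on_cell y ⟨hy.1, hy.2.le⟩]
    exact h.norm_integral_sub_div_le hT hζ hζ1 ⟨hy.1, hy.2.le⟩

end PeriodicMeanOsc

end PeriodicFunctions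

section WalshFunctions

/-! ### Walsh functions -/

variable {b : ℕ} [Fact (1 < b)]

/-- The Walsh function in base `b` of the number with the digits `κ 0, …, κ (N - 1)`; the digits
of the argument `x` are read off modulo `b` from the integers `⌊x b⌋, …, ⌊x b ^ N⌋`. -/
noncomputable def walsh (N : ℕ) (κ : ℕ → ZMod b) (x : ℝ) : ℂ :=
  ∏ i ∈ Finset.range N, ZMod.stdAddChar (κ i * (⌊x * (b : ℝ) ^ (i + 1)⌋ : ZMod b))

lemma one_lt_base (b : ℕ) [Fact (1 < b)] : (1 : ℝ) < b := Nat.one_lt_cast.2 Fact.out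

lemma base_pos (b : ℕ) [Fact (1 < b)] : (0 : ℝ) < b := zero_lt_one.trans (one_lt_base b)

lemma walsh_succ (N : ℕ) (κ : ℕ → ZMod b) (x : ℝ) :
    walsh (N + 1) κ x =
      walsh N κ x * ZMod.stdAddChar (κ N * (⌊x * (b : ℝ) ^ (N + 1)⌋ : ZMod b)) :=
  Finset.prod_range_succ _ _

lemma walsh_succ_of_eq_zero {N : ℕ} {κ : ℕ → ZMod b} (hκ : κ N = 0) :
    walsh (N + 1) κ = walsh N κ := by
  ext x
  simp [walsh_succ, hκ]

lemma walsh_of_eq_zero {N : ℕ} {κ : ℕ → ZMod b} (hκ : ∀ i < N, κ i = 0) (x : ℝ) :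
    walsh N κ x = 1 :=
  Finset.prod_eq_one fun i hi => by simp [hκ i (Finset.mem_range.1 hi)]

lemma norm_walsh (N : ℕ) (κ : ℕ → ZMod b) (x : ℝ) : ‖walsh N κ x‖ = 1 := by
  simp [walsh, norm_prod]

lemma measurable_stdAddChar_floor (t : ZMod b) (c : ℝ) :
    Measurable fun x : ℝ => (ZMod.stdAddChar (t * (⌊x * c⌋ : ZMod b)) : ℂ) :=
  (measurable_of_countable fun n : ℤ => (ZMod.stdAddChar (t * (n : ZMod b)) : ℂ)).comp
    (Int.measurable_floor.comp (measurable_id.mul_const c))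

lemma measurable_walsh (N : ℕ) (κ : ℕ → ZMod b) : Measurable (walsh N κ) :=
  Finset.measurable_fun_prod _ fun _ _ => measurable_stdAddChar_floor _ _

lemma floor_mul_pow_div (x : ℝ) (N : ℕ) :
    ⌊x * (b : ℝ) ^ (N + 1)⌋ / (b : ℤ) = ⌊x * (b : ℝ) ^ N⌋ := by
  rw [← Int.floor_div_natCast, pow_succ, ← mul_assoc, mul_div_cancel_right₀ _ (base_pos b).ne']

lemma walsh_eq_of_floor_eq {N : ℕ} (κ : ℕ → ZMod b) {x y : ℝ}
    (h : ⌊x * (b : ℝ) ^ N⌋ = ⌊y * (b : ℝ) ^ N⌋) : walsh N κ x = walsh N κ y := by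
  induction N with
  | zero => rfl
  | succ N ih =>
    rw [walsh_succ, walsh_succ, h, ih (by rw [← floor_mul_pow_div, h, floor_mul_pow_div])]

lemma stdAddChar_floor_add_inv (t : ZMod b) {c : ℝ} (hc : c ≠ 0) (x : ℝ) :
    (ZMod.stdAddChar (t * (⌊(x + c⁻¹) * c⌋ : ZMod b)) : ℂ) =
      ZMod.stdAddChar t * ZMod.stdAddChar (t * (⌊x * c⌋ : ZMod b)) := by
  rw [add_mul, inv_mul_cancel₀ hc, Int.floor_add_one, Int.cast_add, Int.cast_one, mul_add_one,
    AddChar.map_add_eq_mul, mul_comm]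

lemma stdAddChar_pow_base (t : ZMod b) : (ZMod.stdAddChar t : ℂ) ^ b = 1 := by
  simp [← AddChar.map_nsmul_eq_pow]

lemma stdAddChar_ne_one {t : ZMod b} (ht : t ≠ 0) : (ZMod.stdAddChar t : ℂ) ≠ 1 := by
  rw [← AddChar.map_zero_eq_one (ZMod.stdAddChar (N := b))]
  exact ZMod.injective_stdAddChar.ne ht

lemma sin_pi_div_pos (b : ℕ) [Fact (1 < b)] : 0 < Real.sin (Real.pi / b) :=
  Real.sin_pos_of_pos_of_lt_pi (div_pos Real.pi_pos (base_pos b))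
    (div_lt_self Real.pi_pos (one_lt_base b))

lemma sin_le_sin_of_le_of_le_pi_sub {x y : ℝ} (hx : 0 ≤ x) (hxy : x ≤ y)
    (hy : y ≤ Real.pi - x) : Real.sin x ≤ Real.sin y := by
  rcases le_total y (Real.pi / 2) with h | h
  · exact Real.sin_le_sin_of_le_of_le_pi_div_two (by linarith [Real.pi_pos]) h hxy
  · rw [← Real.sin_pi_sub y]
    exact Real.sin_le_sin_of_le_of_le_pi_div_two (by linarith [Real.pi_pos]) (by linarith)
      (by linarith)

lemma two_sin_le_norm_one_sub_stdAddChar {t : ZMod b} (ht : t ≠ 0) :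
    2 * Real.sin (Real.pi / b) ≤ ‖(1 : ℂ) - ZMod.stdAddChar t‖ := by
  have hb := base_pos b
  have val_pos : (1 : ℝ) ≤ t.val :=
    Nat.one_le_cast.2 (Nat.pos_of_ne_zero (by simpa [ZMod.val_eq_zero] using ht))
  have val_lt : (t.val : ℝ) + 1 ≤ b := by exact_mod_cast ZMod.val_lt t
  have exp_form : (ZMod.stdAddChar t : ℂ) =
      Complex.exp (Complex.I * (2 * Real.pi * t.val / b : ℝ)) := by
    conv_lhs => rw [show t = ((t.val : ℤ) : ZMod b) by simp]
    rw [ZMod.stdAddChar_coe]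
    congr 1
    push_cast
    ring
  rw [exp_form, norm_sub_rev, Complex.norm_exp_I_mul_ofReal_sub_one, norm_mul, Real.norm_two,
    show 2 * Real.pi * t.val / b / 2 = Real.pi * t.val / b by ring]
  refine mul_le_mul_of_nonneg_left ((sin_le_sin_of_le_of_le_pi_sub (by positivity) ?_ ?_).trans
    (le_abs_self _)) two_pos.le
  · gcongr
    nlinarith [Real.pi_pos]
  · rw [le_sub_iff_add_le, ← add_div, div_le_iff₀ hb]
    nlinarith [Real.pi_pos]

/-- One step of the Fine-Walsh integration by parts: the highest digit is removed from the Walsh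
function, and the new factor is the primitive of `W` times the character of that digit. -/
lemma PeriodicMeanOsc.exists_primitive_mul_walsh {N : ℕ} {κ : ℕ → ZMod b} {W : ℝ → ℂ} {μ : ℂ}
    {ω : ℝ} (h : PeriodicMeanOsc ((b : ℝ) ^ (N + 1))⁻¹ W μ ω) (hκ : κ N ≠ 0) :
    ∃ V : ℝ → ℂ, PeriodicMeanOsc ((b : ℝ) ^ N)⁻¹ V
        ((((b : ℝ) ^ (N + 1))⁻¹ : ℝ) * μ / (1 - ZMod.stdAddChar (κ N)))
        (((b : ℝ) ^ (N + 1))⁻¹ * (‖μ‖ / ‖(1 : ℂ) - ZMod.stdAddChar (κ N)‖ + ω / 2)) ∧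
      V 1 = 0 ∧
      ∀ x, 0 ≤ x → ∫ y in (0 : ℝ)..x, W y * walsh (N + 1) κ y = V x * walsh N κ x := by
  have hb := base_pos b
  set c : ℝ := (b : ℝ) ^ (N + 1) with hc
  have hc0 : 0 < c := by positivity
  have period : b * c⁻¹ = ((b : ℝ) ^ N)⁻¹ := by rw [hc, pow_succ]; field_simp
  set χ : ℝ → ℂ := fun x => ZMod.stdAddChar (κ N * (⌊x * c⌋ : ZMod b)) with hχ
  have hg : Measurable fun x => W x * χ x := h.measurable.mul (measurable_stdAddChar_floor _ _)
  have twisted : ∀ x, W (x + c⁻¹) * χ (x + c⁻¹) = ZMod.stdAddChar (κ N) * (W x * χ x) := fun x => by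
    simp only [hχ, h.periodic x, stdAddChar_floor_add_inv _ hc0.ne']
    ring
  have eq_W : ∀ x ∈ Set.Ico 0 c⁻¹, W x * χ x = W x := fun x hx => by
    have : ⌊x * c⌋ = 0 := Int.floor_eq_zero_iff.2
      ⟨mul_nonneg hx.1 hc0.le, by simpa [hc0.ne'] using mul_lt_mul_of_pos_right hx.2 hc0⟩
    simp [hχ, this]
  have bound : ∀ {u v : ℝ → ℂ}, (∀ x, ‖u x‖ = 1) → (∀ x, ‖v x‖ = 1) →
      ∀ x, ‖W x * u x * v x‖ ≤ ‖μ‖ + ω := fun hu hv x => by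
    simpa [hu, hv] using h.norm_le x
  have norm_χ : ∀ x, ‖χ x‖ = 1 := fun x => AddChar.norm_apply _ _
  have hf_int := intervalIntegrable_of_norm_le hg.aestronglyMeasurable
    fun x => by simpa using bound norm_χ (fun _ => norm_one (α := ℂ)) x
  have hper := periodic_nat_mul_of_twisted (f := fun x => W x * χ x) (stdAddChar_pow_base (κ N))
    twisted
  have primitive := h.primitive_twisted (inv_pos.2 hc0) (stdAddChar_ne_one hκ)
    (zero_lt_one.trans Fact.out : 0 < b).ne' (stdAddChar_pow_base (κ N)) hg twisted eq_W
  refine ⟨_, period ▸ primitive, ?_, fun x hx => ?_⟩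
  · have := (period ▸ primitive.periodic).nat_mul_eq (b ^ N)
    simpa [hb.ne'] using this
  · simp only [walsh_succ, mul_comm (walsh N κ _), ← mul_assoc]
    exact integral_mul_eq_of_const_on_cells (T := b * c⁻¹) (by positivity) hper hf_int
      (intervalIntegrable_of_norm_le (hg.mul (measurable_walsh N κ)).aestronglyMeasurable
        (bound norm_χ (norm_walsh N κ)))
      (integral_eq_zero_of_twisted (stdAddChar_ne_one hκ) hper twisted)
      (fun x y hxy => walsh_eq_of_floor_eq κ (by simpa [period] using hxy)) hx

lemma integral_walsh {κ : ℕ → ZMod b} {N : ℕ} (hκ : ∃ j < N, κ j ≠ 0) :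
    ∫ x in (0 : ℝ)..1, walsh N κ x = 0 := by
  induction N with
  | zero => simp at hκ
  | succ N ih =>
    by_cases hN : κ N = 0
    · rw [walsh_succ_of_eq_zero hN]
      exact ih (by grind)
    · obtain ⟨V, -, hV1, hV⟩ :=
        (PeriodicMeanOsc.const ((b : ℝ) ^ (N + 1))⁻¹ 1).exists_primitive_mul_walsh hN
      simpa [hV1] using hV 1 zero_le_one

end WalshFunctions

section WalshDecay

/-! ### Decay of Walsh coefficients in one variable -/

/-- Measurable functions that are bounded on the unit interval, the functions against which the
derivatives of a function are integrated. -/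
def BoundedOnUnit (ψ : ℝ → ℂ) : Prop := Measurable ψ ∧ ∃ C, ∀ x ∈ Set.Icc (0 : ℝ) 1, ‖ψ x‖ ≤ C

/-- The functionals `A i : ψ ↦ ∫ f^(i) ψ` for `i ≤ α`, reduced to the properties that the decay of
the Walsh coefficients of `f` depends on. In several variables the functionals of this form are
obtained by fixing the other variables. -/
structure IsDerivFamily (α : ℕ) (A : ℕ → (ℝ → ℂ) → ℂ) (B : ℝ) : Prop where
  add : ∀ i ≤ α, ∀ (c : ℂ) (ψ : ℝ → ℂ), BoundedOnUnit ψ →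
    A i (fun x => c + ψ x) = c * A i (fun _ => 1) + A i ψ
  parts : ∀ i < α, ∀ ψ h : ℝ → ℂ, BoundedOnUnit ψ → BoundedOnUnit h →
    (∀ x ∈ Set.Icc (0 : ℝ) 1, ∫ y in (0 : ℝ)..x, ψ y = h x) → h 1 = 0 → A i ψ = -A (i + 1) h
  norm_one_le : ∀ i, 1 ≤ i → i ≤ α → ‖A i fun _ => 1‖ ≤ B
  norm_top_le : ∀ (K : ℝ → ℂ) (C : ℝ), Measurable K → (∀ x ∈ Set.Icc (0 : ℝ) 1, ‖K x‖ ≤ C) →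
    ‖A α K‖ ≤ B * C

lemma PeriodicMeanOsc.boundedOnUnit {T : ℝ} {W : ℝ → ℂ} {μ : ℂ} {ω : ℝ}
    (h : PeriodicMeanOsc T W μ ω) : BoundedOnUnit W :=
  ⟨h.measurable, _, fun x _ => h.norm_le x⟩

variable {b : ℕ}

/-- The sum of the positions (counted from one) of the `n` leading nonzero digits among the first
`N` digits `κ`; it is the order of decay of the Walsh coefficients of smooth functions. -/
def topDigitSum (κ : ℕ → ZMod b) : ℕ → ℕ → ℕ
  | 0, _ => 0
  | N + 1, n => if κ N = 0 ∨ n = 0 then topDigitSum κ N n else N + 1 + topDigitSum κ N (n - 1)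

@[simp]
lemma topDigitSum_zero_right (κ : ℕ → ZMod b) (N : ℕ) : topDigitSum κ N 0 = 0 := by
  induction N with
  | zero => rfl
  | succ N ih => simp [topDigitSum, ih]

lemma topDigitSum_succ_of_eq_zero {κ : ℕ → ZMod b} {N : ℕ} (hκ : κ N = 0) (n : ℕ) :
    topDigitSum κ (N + 1) n = topDigitSum κ N n := by
  simp [topDigitSum, hκ]

lemma topDigitSum_succ_succ {κ : ℕ → ZMod b} {N : ℕ} (hκ : κ N ≠ 0) (n : ℕ) :
    topDigitSum κ (N + 1) (n + 1) = N + 1 + topDigitSum κ N n := by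
  simp [topDigitSum, hκ]

variable [Fact (1 < b)]

lemma BoundedOnUnit.mul_walsh {W : ℝ → ℂ} (hW : BoundedOnUnit W) (N : ℕ) (κ : ℕ → ZMod b) :
    BoundedOnUnit fun x => W x * walsh N κ x :=
  ⟨hW.1.mul (measurable_walsh N κ), hW.2.imp fun C hC x hx => by
    simpa only [norm_mul, norm_walsh, mul_one] using hC x hx⟩

namespace IsDerivFamily

variable {α : ℕ} {A : ℕ → (ℝ → ℂ) → ℂ} {B : ℝ}

lemma nonneg (h : IsDerivFamily α A B) (hα : 1 ≤ α) : 0 ≤ B :=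
  (norm_nonneg _).trans (h.norm_one_le 1 le_rfl hα)

/-- Downward induction on the order: subtracting the mean from `W` produces the first term, and
the primitive of the rest is periodic with half the oscillation. -/
lemma norm_le_mean_add_osc (h : IsDerivFamily α A B) {i n : ℕ} (hin : i + n = α) (hi : 1 ≤ i)
    {W : ℝ → ℂ} {μ : ℂ} {ω : ℝ} (hW : PeriodicMeanOsc 1 W μ ω) :
    ‖A i W‖ ≤ B * (‖μ‖ + ω) := by
  induction n generalizing i W μ ω with
  | zero =>
    obtain rfl : i = α := hin
    exact h.norm_top_le W _ hW.measurable fun x _ => hW.norm_le x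
  | succ n ih =>
    have hB := h.nonneg (by omega)
    have hH := hW.primitive_sub_mean one_pos
    set H : ℝ → ℂ := fun x => ∫ y in (0 : ℝ)..x, (W y - μ)
    set ν : ℂ := ((1 : ℝ) : ℂ)⁻¹ * ∫ x in (0 : ℝ)..1, H x
    have H_zero : H 0 = 0 := intervalIntegral.integral_same
    have H_one : H 1 = 0 := hW.integral_sub_mean_period
    have bounded_sub : BoundedOnUnit fun x => W x - μ :=
      ⟨hW.measurable.sub_const μ, ω, fun x _ => hW.norm_sub_le x⟩
    have split : A i W = μ * A i (fun _ => 1) - A (i + 1) H := by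
      rw [sub_eq_add_neg, ← h.parts i (by omega) _ H bounded_sub hH.boundedOnUnit
        (fun _ _ => rfl) H_one, ← h.add i (by omega) μ _ bounded_sub]
      simp
    have norm_mean : ‖ν‖ ≤ ω / 2 := by
      simpa [H_zero] using hH.norm_sub_le 0
    calc ‖A i W‖ ≤ ‖μ‖ * B + B * (‖ν‖ + 1 * ω / 2) := by
          rw [split]
          refine (norm_sub_le _ _).trans (add_le_add ?_ (ih (by omega) (by omega) hH))
          rw [norm_mul]
          exact mul_le_mul_of_nonneg_left (h.norm_one_le i hi (by omega)) (norm_nonneg μ)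
      _ ≤ B * (‖μ‖ + ω) := by
          linarith [mul_le_mul_of_nonneg_left norm_mean hB]

/-- The bounds `‖μ‖ ≤ D rⁱ` and `ω ≤ 2 E D` are reproduced with `D` divided by `b ^ (N + 1)`. -/
lemma exists_norm_mul_walsh_succ_eq (h : IsDerivFamily α A B) {r E : ℝ}
    (hr : r = (2 * Real.sin (Real.pi / b))⁻¹) (hE : ∀ i, 1 ≤ i → i ≤ α → r ^ i ≤ E)
    {κ : ℕ → ZMod b} {N i : ℕ} (hκ : κ N ≠ 0) (hi : i < α) {D : ℝ} (hD : 0 ≤ D) {W : ℝ → ℂ}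
    {μ : ℂ} {ω : ℝ} (hW : PeriodicMeanOsc ((b : ℝ) ^ (N + 1))⁻¹ W μ ω) (hμ : ‖μ‖ ≤ D * r ^ i)
    (hω : ω ≤ 2 * E * D) :
    ∃ (V : ℝ → ℂ) (ν : ℂ) (o : ℝ), PeriodicMeanOsc ((b : ℝ) ^ N)⁻¹ V ν o ∧
      ‖ν‖ ≤ ((b : ℝ) ^ (N + 1))⁻¹ * D * r ^ (i + 1) ∧ o ≤ 2 * E * (((b : ℝ) ^ (N + 1))⁻¹ * D) ∧
      ‖A i fun x => W x * walsh (N + 1) κ x‖ = ‖A (i + 1) fun x => V x * walsh N κ x‖ := by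
  have hb := base_pos b
  have hr0 : 0 < r := hr ▸ inv_pos.2 (mul_pos two_pos (sin_pi_div_pos b))
  have quotient_le : ‖μ‖ / ‖(1 : ℂ) - ZMod.stdAddChar (κ N)‖ ≤ D * r ^ (i + 1) := by
    rw [div_eq_mul_inv, pow_succ, ← mul_assoc]
    refine mul_le_mul hμ ?_ (by positivity) (by positivity)
    rw [hr]
    exact inv_anti₀ (mul_pos two_pos (sin_pi_div_pos b)) (two_sin_le_norm_one_sub_stdAddChar hκ)
  obtain ⟨V, hV, hV1, hV_eq⟩ := hW.exists_primitive_mul_walsh hκ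
  refine ⟨V, _, _, hV, ?_, ?_, ?_⟩
  · rw [norm_div, norm_mul, Complex.norm_real, Real.norm_of_nonneg (by positivity),
      mul_div_assoc, mul_assoc]
    gcongr
  · calc ((b : ℝ) ^ (N + 1))⁻¹ * (‖μ‖ / ‖(1 : ℂ) - ZMod.stdAddChar (κ N)‖ + ω / 2)
        ≤ ((b : ℝ) ^ (N + 1))⁻¹ * (D * E + 2 * E * D / 2) := by
          gcongr
          exact quotient_le.trans (mul_le_mul_of_nonneg_left (hE _ (by omega) hi) hD)
      _ = 2 * E * (((b : ℝ) ^ (N + 1))⁻¹ * D) := by ring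
  · rw [h.parts i hi _ _ (hW.boundedOnUnit.mul_walsh _ _) (hV.boundedOnUnit.mul_walsh N κ)
      (fun x hx => hV_eq x hx.1) (by rw [hV1, zero_mul]), norm_neg]

lemma norm_mul_walsh_le (h : IsDerivFamily α A B) (hα : 1 ≤ α) {r E : ℝ}
    (hr : r = (2 * Real.sin (Real.pi / b))⁻¹) (hE : ∀ i, 1 ≤ i → i ≤ α → r ^ i ≤ E)
    {κ : ℕ → ZMod b} {N n i : ℕ} (hin : i + n = α) (hiκ : 1 ≤ i ∨ ∃ j < N, κ j ≠ 0) {D : ℝ}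
    (hD : 0 ≤ D) {W : ℝ → ℂ} {μ : ℂ} {ω : ℝ} (hW : PeriodicMeanOsc ((b : ℝ) ^ N)⁻¹ W μ ω)
    (hμ : ‖μ‖ ≤ D * r ^ i) (hω : ω ≤ 2 * E * D) :
    ‖A i fun x => W x * walsh N κ x‖ ≤ B * (3 * E * D * ((b : ℝ) ^ topDigitSum κ N n)⁻¹) := by
  have hb := base_pos b
  have hB := h.nonneg hα
  have norm_add_le : ∀ {i : ℕ} {D : ℝ} {μ : ℂ} {ω : ℝ}, 1 ≤ i → i ≤ α → 0 ≤ D →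
      ‖μ‖ ≤ D * r ^ i → ω ≤ 2 * E * D → ‖μ‖ + ω ≤ 3 * E * D := fun hi hiα hD hμ hω => by
    linarith [mul_le_mul_of_nonneg_left (hE _ hi hiα) hD]
  induction N generalizing n i D W μ ω with
  | zero =>
    have hi : 1 ≤ i := hiκ.resolve_right (by simp)
    have := h.norm_le_mean_add_osc hin hi (by simpa using hW)
    simpa [walsh, topDigitSum] using
      this.trans (mul_le_mul_of_nonneg_left (norm_add_le hi (by omega) hD hμ hω) hB)
  | succ N ih =>
    by_cases hκ : κ N = 0
    · have period : b * ((b : ℝ) ^ (N + 1))⁻¹ = ((b : ℝ) ^ N)⁻¹ := by rw [pow_succ]; field_simp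
      rw [walsh_succ_of_eq_zero hκ, topDigitSum_succ_of_eq_zero hκ]
      exact ih hin (by grind) hD (period ▸ hW.nat_mul b) hμ hω
    cases n with
    | zero =>
      obtain rfl : i = α := hin
      rw [topDigitSum_zero_right, pow_zero, inv_one, mul_one]
      refine h.norm_top_le _ _ (hW.measurable.mul (measurable_walsh _ _)) fun x _ => ?_
      rw [norm_mul, norm_walsh, mul_one]
      exact (hW.norm_le x).trans (norm_add_le hα le_rfl hD hμ hω)
    | succ n =>
      obtain ⟨V, ν, o, hV, hν, ho, norm_eq⟩ :=
        h.exists_norm_mul_walsh_succ_eq hr hE hκ (by omega) hD hW hμ hω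
      rw [norm_eq, topDigitSum_succ_succ hκ, pow_add]
      refine (ih (n := n) (by omega) (Or.inl (by omega)) (by positivity) hV hν ho).trans_eq ?_
      rw [mul_inv]
      ring

lemma norm_walsh_le (h : IsDerivFamily α A B) (hα : 1 ≤ α) {E : ℝ}
    (hE : ∀ i, 1 ≤ i → i ≤ α → (2 * Real.sin (Real.pi / b))⁻¹ ^ i ≤ E)
    {κ : ℕ → ZMod b} {N : ℕ} (hκ : ∃ j < N, κ j ≠ 0) :
    ‖A 0 (walsh N κ)‖ ≤ 3 * E * ((b : ℝ) ^ topDigitSum κ N α)⁻¹ * B := by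
  have hE0 : 0 ≤ E := (pow_nonneg (inv_nonneg.2 (mul_pos two_pos (sin_pi_div_pos b)).le) 1).trans
    (hE 1 le_rfl hα)
  have := h.norm_mul_walsh_le hα rfl hE (zero_add α) (Or.inr hκ) zero_le_one (.const _ 1)
    (by simp) (by linarith)
  simp only [one_mul, mul_one] at this
  linarith

end IsDerivFamily

end WalshDecay

section UnitTestFunctions

/-! ### Test functions in one variable -/

open Filter Topology

/-- Smooth functions with compact support in the open unit interval; products of them are the test
functions on the cube that the Walsh functions are approximated by. -/
structure IsUnitTest (φ : ℝ → ℂ) : Prop where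
  contDiff : ContDiff ℝ (⊤ : ℕ∞) φ
  tsupport_subset : tsupport φ ⊆ Set.Ioo 0 1

lemma exists_Icc_of_isCompact_of_subset_Ioo {K : Set ℝ} {a b : ℝ} (hK : IsCompact K) (hab : a < b)
    (hKab : K ⊆ Set.Ioo a b) : ∃ l u, a < l ∧ u < b ∧ K ⊆ Set.Icc l u := by
  rcases K.eq_empty_or_nonempty with rfl | hne
  · exact ⟨(a + b) / 2, (a + b) / 2, by linarith, by linarith, Set.empty_subset _⟩
  · exact ⟨sInf K, sSup K, (hKab (hK.sInf_mem hne)).1, (hKab (hK.sSup_mem hne)).2,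
      fun x hx => ⟨csInf_le hK.bddBelow hx, le_csSup hK.bddAbove hx⟩⟩

namespace IsUnitTest

variable {φ η : ℝ → ℂ}

lemma hasCompactSupport (h : IsUnitTest φ) : HasCompactSupport φ :=
  isCompact_Icc.of_isClosed_subset (isClosed_tsupport φ)
    (h.tsupport_subset.trans Set.Ioo_subset_Icc_self)

lemma continuous (h : IsUnitTest φ) : Continuous φ := h.contDiff.continuous

lemma deriv (h : IsUnitTest φ) : IsUnitTest (deriv φ) where
  contDiff := by
    have contDiff := h.contDiff
    rw [show ((⊤ : ℕ∞) : WithTop ℕ∞) = ((⊤ : ℕ∞) : WithTop ℕ∞) + 1 from rfl,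
      contDiff_succ_iff_deriv] at contDiff
    exact contDiff.2.2
  tsupport_subset := (tsupport_deriv_subset (𝕜 := ℝ)).trans h.tsupport_subset

lemma iteratedDeriv (h : IsUnitTest φ) (n : ℕ) : IsUnitTest (iteratedDeriv n φ) := by
  induction n with
  | zero => simpa using h
  | succ n ih => rw [iteratedDeriv_succ]; exact ih.deriv

lemma sub (hφ : IsUnitTest φ) (hη : IsUnitTest η) : IsUnitTest (fun x => φ x - η x) where
  contDiff := hφ.contDiff.sub hη.contDiff
  tsupport_subset :=
    (tsupport_sub _ _).trans (Set.union_subset hφ.tsupport_subset hη.tsupport_subset)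

lemma mul_left {u : ℝ → ℂ} (hu : ContDiff ℝ (⊤ : ℕ∞) u) (h : IsUnitTest φ) :
    IsUnitTest (fun x => u x * φ x) where
  contDiff := hu.mul h.contDiff
  tsupport_subset := tsupport_mul_subset_right.trans h.tsupport_subset

lemma ofReal {f : ℝ → ℝ} (hf : ContDiff ℝ (⊤ : ℕ∞) f) (hsupp : tsupport f ⊆ Set.Ioo 0 1) :
    IsUnitTest (fun x => (f x : ℂ)) where
  contDiff := Complex.ofRealCLM.contDiff.comp hf
  tsupport_subset := (tsupport_comp_subset Complex.ofReal_zero f).trans hsupp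

lemma eq_zero (h : IsUnitTest φ) {x : ℝ} (hx : x ∉ Set.Ioo (0 : ℝ) 1) : φ x = 0 :=
  image_eq_zero_of_notMem_tsupport fun hmem => hx (h.tsupport_subset hmem)

lemma exists_norm_le (h : IsUnitTest φ) : ∃ C, ∀ x, ‖φ x‖ ≤ C :=
  h.continuous.bounded_above_of_compact_support h.hasCompactSupport

lemma boundedOnUnit (h : IsUnitTest φ) : BoundedOnUnit φ :=
  ⟨h.continuous.measurable, h.exists_norm_le.imp fun _ hC x _ => hC x⟩

lemma primitive_eq_zero_of_notMem_Icc (h : IsUnitTest φ) (hzero : ∫ x in (0 : ℝ)..1, φ x = 0)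
    {l u x : ℝ} (hlu : tsupport φ ⊆ Set.Icc l u)
    (hx : x ∉ Set.Icc l u) : ∫ y in (0 : ℝ)..x, φ y = 0 := by
  have vanish : ∀ {a b : ℝ}, (∀ y ∈ Set.uIcc a b, y ∉ Set.Icc l u ∨ y ∉ Set.Ioo (0 : ℝ) 1) →
      ∫ y in a..b, φ y = 0 := fun hab => by
    rw [intervalIntegral.integral_congr (g := fun _ => 0) fun y hy => ?_,
      intervalIntegral.integral_zero]
    exact (hab y hy).elim (fun hy => image_eq_zero_of_notMem_tsupport fun hmem => hy (hlu hmem))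
      h.eq_zero
  rw [Set.mem_Icc, not_and_or, not_le, not_le] at hx
  rcases hx with hx | hx
  · exact vanish fun y hy => by grind [Set.mem_uIcc]
  · rw [← hzero, ← intervalIntegral.integral_add_adjacent_intervals
      (h.continuous.intervalIntegrable 0 x) (h.continuous.intervalIntegrable x 1),
      vanish (a := x) fun y hy => by grind [Set.mem_uIcc], add_zero]

lemma deriv_primitive (h : IsUnitTest φ) : _root_.deriv (fun x => ∫ y in (0 : ℝ)..x, φ y) = φ :=
  funext (h.continuous.deriv_integral φ 0)

lemma primitive (h : IsUnitTest φ) (hzero : ∫ x in (0 : ℝ)..1, φ x = 0) :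
    IsUnitTest fun x => ∫ y in (0 : ℝ)..x, φ y where
  contDiff := by
    rw [show ((⊤ : ℕ∞) : WithTop ℕ∞) = ((⊤ : ℕ∞) : WithTop ℕ∞) + 1 from rfl,
      contDiff_succ_iff_deriv, h.deriv_primitive]
    exact ⟨fun x => (h.continuous.integral_hasStrictDerivAt 0 x).hasDerivAt.differentiableAt,
      by simp, h.contDiff⟩
  tsupport_subset := by
    obtain ⟨l, u, hl, hu, hlu⟩ :=
      exists_Icc_of_isCompact_of_subset_Ioo h.hasCompactSupport one_pos h.tsupport_subset
    refine (closure_minimal (fun x hx => ?_) isClosed_Icc).trans (Set.Icc_subset_Ioo hl hu)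
    by_contra hxlu
    exact hx (h.primitive_eq_zero_of_notMem_Icc hzero hlu hxlu)

lemma norm_primitive_le (h : IsUnitTest φ) (hzero : ∫ x in (0 : ℝ)..1, φ x = 0) {C : ℝ}
    (hC : ∀ x, ‖φ x‖ ≤ C) (x : ℝ) : ‖∫ y in (0 : ℝ)..x, φ y‖ ≤ C := by
  have hC0 : 0 ≤ C := (norm_nonneg _).trans (hC 0)
  by_cases hx : x ∈ Set.Ioo (0 : ℝ) 1
  · refine (intervalIntegral.norm_integral_le_of_norm_le_const fun y _ => hC y).trans
      (mul_le_of_le_one_right hC0 ?_)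
    rw [sub_zero, abs_of_pos hx.1]
    exact hx.2.le
  · rw [(h.primitive hzero).eq_zero hx, norm_zero]
    exact hC0

end IsUnitTest

lemma exists_isUnitTest_integral_eq_one :
    ∃ η : ℝ → ℂ, IsUnitTest η ∧ ∫ x in (0 : ℝ)..1, η x = 1 := by
  let bump : ContDiffBump (1 / 2 : ℝ) := ⟨1 / 8, 1 / 4, by norm_num, by norm_num⟩
  have supp : tsupport (bump.normed volume) ⊆ Set.Ioo 0 1 := by
    rw [bump.tsupport_normed_eq, Real.closedBall_eq_Icc]
    exact Set.Icc_subset_Ioo (by norm_num [bump]) (by norm_num [bump])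
  refine ⟨fun x => (bump.normed volume x : ℂ), .ofReal bump.contDiff_normed supp, ?_⟩
  rw [intervalIntegral.integral_ofReal, intervalIntegral.integral_of_le zero_le_one,
    setIntegral_eq_integral_of_forall_compl_eq_zero, bump.integral_normed, Complex.ofReal_one]
  intro x hx
  by_contra hne
  exact hx (Set.Ioo_subset_Ioc_self (supp (subset_tsupport _ hne)))

lemma exists_cutoff_eventually_eq_one :
    ∃ χ : ℕ → ℝ → ℝ, (∀ n, ContDiff ℝ (⊤ : ℕ∞) (χ n) ∧ tsupport (χ n) ⊆ Set.Ioo 0 1) ∧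
      (∀ n x, |χ n x| ≤ 1) ∧ ∀ x ∈ Set.Ioo (0 : ℝ) 1, ∀ᶠ n in atTop, χ n x = 1 := by
  have inv_le : ∀ n : ℕ, 1 / ((n : ℝ) + 3) ≤ 1 / 3 := fun n =>
    one_div_le_one_div_of_le (by norm_num) (by linarith [(Nat.cast_nonneg n : (0 : ℝ) ≤ n)])
  have inv_lt : ∀ n : ℕ, 1 / ((n : ℝ) + 4) < 1 / ((n : ℝ) + 3) := fun n =>
    one_div_lt_one_div_of_lt (by positivity) (by linarith)
  let bump : ℕ → ContDiffBump (1 / 2 : ℝ) := fun n =>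
    ⟨1 / 2 - 1 / ((n : ℝ) + 3), 1 / 2 - 1 / ((n : ℝ) + 4), by linarith [inv_le n],
      by linarith [inv_lt n]⟩
  refine ⟨fun n => bump n, fun n => ⟨(bump n).contDiff, ?_⟩, fun n x => ?_, fun x hx => ?_⟩
  · rw [(bump n).tsupport_eq, Real.closedBall_eq_Icc]
    have : (0 : ℝ) < 1 / ((n : ℝ) + 4) := by positivity
    exact Set.Icc_subset_Ioo (by simp only [bump]; linarith) (by simp only [bump]; linarith)
  · rw [abs_of_nonneg (bump n).nonneg]
    exact (bump n).le_one
  · have dist_lt : 0 < 1 / 2 - |x - 1 / 2| :=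
      sub_pos.2 (abs_lt.2 ⟨by linarith [hx.1], by linarith [hx.2]⟩)
    have radius : Tendsto (fun n : ℕ => 1 / ((n : ℝ) + 3)) atTop (𝓝 0) :=
      tendsto_const_nhds.div_atTop
        (tendsto_atTop_add_const_right _ _ tendsto_natCast_atTop_atTop)
    filter_upwards [radius.eventually (gt_mem_nhds dist_lt)] with n hn
    refine (bump n).one_of_mem_closedBall ?_
    rw [Metric.mem_closedBall, Real.dist_eq]
    simp only [bump]
    linarith

lemma exists_contDiff_tendsto_ae {F : Type*} [NormedAddCommGroup F] [NormedSpace ℝ F]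
    [CompleteSpace F] {f : ℝ → F} (hf : AEStronglyMeasurable f) {C : ℝ} (hC : ∀ x, ‖f x‖ ≤ C) :
    ∃ φ : ℕ → ℝ → F, (∀ n, ContDiff ℝ (⊤ : ℕ∞) (φ n)) ∧ (∀ n x, ‖φ n x‖ ≤ C) ∧
      ∀ᵐ x, Tendsto (fun n => φ n x) atTop (𝓝 (f x)) := by
  have hfl : LocallyIntegrable f := (locallyIntegrable_const C).mono hf
    (.of_forall fun x => (hC x).trans (le_abs_self C))
  let bump : ℕ → ContDiffBump (0 : ℝ) := fun n =>
    ⟨1 / ((n : ℝ) + 1), 2 / ((n : ℝ) + 1), by positivity, by gcongr; norm_num⟩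
  refine ⟨fun n => convolution ((bump n).normed volume) f (.lsmul ℝ ℝ) volume,
    fun n => (bump n).hasCompactSupport_normed.contDiff_convolution_left _
      (bump n).contDiff_normed hfl, fun n x => ?_, ?_⟩
  · simp only [convolution_def, ContinuousLinearMap.lsmul_apply]
    calc ‖∫ t, (bump n).normed volume t • f (x - t)‖ ≤ ∫ t, (bump n).normed volume t * C := by
          refine norm_integral_le_of_norm_le ((bump n).integrable_normed.mul_const C)
            (.of_forall fun t => ?_)
          rw [norm_smul, Real.norm_of_nonneg ((bump n).nonneg_normed t)]
          exact mul_le_mul_of_nonneg_left (hC _) ((bump n).nonneg_normed t)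
      _ = C := by rw [integral_mul_const, (bump n).integral_normed, one_mul]
  · refine ContDiffBump.ae_convolution_tendsto_right_of_locallyIntegrable (K := 2) ?_
      (.of_forall fun n => (mul_one_div 2 _).ge) hfl
    simpa [bump, div_eq_mul_inv] using
      (tendsto_one_div_add_atTop_nhds_zero_nat (𝕜 := ℝ)).const_mul 2

lemma exists_isUnitTest_tendsto {ψ : ℝ → ℂ} (hψ : BoundedOnUnit ψ) :
    ∃ (φ : ℕ → ℝ → ℂ) (C : ℝ), (∀ n, IsUnitTest (φ n)) ∧ (∀ n x, ‖φ n x‖ ≤ C) ∧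
      ∀ᵐ x ∂volume.restrict (Set.Icc (0 : ℝ) 1), Tendsto (fun n => φ n x) atTop (𝓝 (ψ x)) := by
  obtain ⟨hm, C, hC⟩ := hψ
  have extension_le : ∀ x, ‖(Set.Icc (0 : ℝ) 1).indicator ψ x‖ ≤ C := fun x => by
    rw [norm_indicator_eq_indicator_norm]
    exact Set.indicator_le' hC (fun _ _ => (norm_nonneg _).trans (hC 0 (by simp))) x
  obtain ⟨f, hf, hfC, hft⟩ := exists_contDiff_tendsto_ae
    (hm.indicator measurableSet_Icc).aestronglyMeasurable extension_le
  obtain ⟨χ, hχ, hχ1, hχt⟩ := exists_cutoff_eventually_eq_one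
  refine ⟨fun n x => f n x * χ n x, C, fun n => .mul_left (hf n) (.ofReal (hχ n).1 (hχ n).2),
    fun n x => ?_, ?_⟩
  · rw [norm_mul, Complex.norm_real]
    exact (mul_le_of_le_one_right (norm_nonneg _) (hχ1 n x)).trans (hfC n x)
  · rw [← restrict_Ioo_eq_restrict_Icc]
    filter_upwards [ae_restrict_mem measurableSet_Ioo, ae_restrict_of_ae hft] with x hx hxt
    rw [Set.indicator_of_mem (Set.Ioo_subset_Icc_self hx)] at hxt
    refine hxt.congr' ?_
    filter_upwards [hχt x hx] with n hn
    rw [hn, Complex.ofReal_one, mul_one]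

lemma tendsto_primitive_of_tendsto_ae {φ : ℕ → ℝ → ℂ} {ψ : ℝ → ℂ} {C : ℝ}
    (hm : ∀ n, AEStronglyMeasurable (φ n)) (hC : ∀ n x, ‖φ n x‖ ≤ C)
    (hlim : ∀ᵐ x ∂volume.restrict (Set.Icc (0 : ℝ) 1), Tendsto (fun n => φ n x) atTop (𝓝 (ψ x)))
    {x : ℝ} (hx : x ∈ Set.Icc (0 : ℝ) 1) :
    Tendsto (fun n => ∫ y in (0 : ℝ)..x, φ n y) atTop (𝓝 (∫ y in (0 : ℝ)..x, ψ y)) := by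
  refine intervalIntegral.tendsto_integral_filter_of_dominated_convergence (fun _ => C)
    (.of_forall fun n => (hm n).restrict) (.of_forall fun n => .of_forall fun y _ => hC n y)
    intervalIntegrable_const ?_
  filter_upwards [(ae_restrict_iff' measurableSet_Icc).1 hlim] with y hy hyx
  rw [Set.uIoc_of_le hx.1] at hyx
  exact hy ⟨hyx.1.le, hyx.2.trans hx.2⟩

-- A multiple of a fixed test function of integral one, tending to zero, is subtracted.
lemma exists_isUnitTest_integral_eq_zero_tendsto {ψ : ℝ → ℂ} (hψ : BoundedOnUnit ψ)
    (hzero : ∫ x in (0 : ℝ)..1, ψ x = 0) :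
    ∃ (φ : ℕ → ℝ → ℂ) (C : ℝ), (∀ n, IsUnitTest (φ n)) ∧ (∀ n, ∫ x in (0 : ℝ)..1, φ n x = 0) ∧
      (∀ n x, ‖φ n x‖ ≤ C) ∧
      ∀ᵐ x ∂volume.restrict (Set.Icc (0 : ℝ) 1), Tendsto (fun n => φ n x) atTop (𝓝 (ψ x)) := by
  obtain ⟨p, C, hp, hpC, hpt⟩ := exists_isUnitTest_tendsto hψ
  obtain ⟨η, hη, hη1⟩ := exists_isUnitTest_integral_eq_one
  obtain ⟨D, hηD⟩ := hη.exists_norm_le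
  let I : ℕ → ℂ := fun n => ∫ y in (0 : ℝ)..1, p n y
  have I_tendsto : Tendsto I atTop (𝓝 0) := hzero ▸ tendsto_primitive_of_tendsto_ae
    (fun n => (hp n).continuous.aestronglyMeasurable) hpC hpt (Set.right_mem_Icc.2 zero_le_one)
  have norm_I_le : ∀ n, ‖I n‖ ≤ C := fun n => by
    simpa using intervalIntegral.norm_integral_le_of_norm_le_const (a := 0) (b := 1)
      fun x _ => hpC n x
  refine ⟨fun n x => p n x - I n * η x, C + C * D,
    fun n => (hp n).sub (.mul_left contDiff_const hη), fun n => ?_, fun n x => ?_, ?_⟩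
  · dsimp only
    rw [intervalIntegral.integral_sub ((hp n).continuous.intervalIntegrable _ _)
      ((hη.continuous.intervalIntegrable _ _).const_mul (I n)),
      intervalIntegral.integral_const_mul, hη1, mul_one, sub_self]
  · refine (norm_sub_le _ _).trans (add_le_add (hpC n x) ?_)
    rw [norm_mul]
    exact mul_le_mul (norm_I_le n) (hηD x) (norm_nonneg _) ((norm_nonneg _).trans (hpC 0 0))
  · filter_upwards [hpt] with x hx
    simpa using hx.sub (I_tendsto.mul_const (η x))

lemma exists_isUnitTest_tendsto_deriv {ψ h : ℝ → ℂ} (hψ : BoundedOnUnit ψ)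
    (hh : ∀ x ∈ Set.Icc (0 : ℝ) 1, ∫ y in (0 : ℝ)..x, ψ y = h x) (h_one : h 1 = 0) :
    ∃ (φ : ℕ → ℝ → ℂ) (C : ℝ), (∀ n, IsUnitTest (φ n)) ∧ (∀ n x, ‖φ n x‖ ≤ C) ∧
      (∀ n x, ‖deriv (φ n) x‖ ≤ C) ∧
      (∀ᵐ x ∂volume.restrict (Set.Icc (0 : ℝ) 1), Tendsto (fun n => φ n x) atTop (𝓝 (h x))) ∧
      ∀ᵐ x ∂volume.restrict (Set.Icc (0 : ℝ) 1),
        Tendsto (fun n => deriv (φ n) x) atTop (𝓝 (ψ x)) := by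
  obtain ⟨r, C, hr, integral_r, hrC, hrt⟩ := exists_isUnitTest_integral_eq_zero_tendsto hψ
    ((hh 1 (Set.right_mem_Icc.2 zero_le_one)).trans h_one)
  refine ⟨fun n x => ∫ y in (0 : ℝ)..x, r n y, C, fun n => (hr n).primitive (integral_r n),
    fun n => (hr n).norm_primitive_le (integral_r n) (hrC n), fun n x => ?_, ?_, ?_⟩
  · rw [(hr n).deriv_primitive]
    exact hrC n x
  · filter_upwards [ae_restrict_mem measurableSet_Icc] with x hx
    exact hh x hx ▸ tendsto_primitive_of_tendsto_ae
      (fun n => (hr n).continuous.aestronglyMeasurable) hrC hrt hx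
  · simpa only [(hr _).deriv_primitive] using hrt

end UnitTestFunctions

section Pairing

/-! ### Weak derivatives tested against products -/

open Filter Topology

variable {s : ℕ}

/-- The real part of a multiple of a product of functions of one variable; these are the real test
functions to which the definition of the weak derivative is applied. -/
def reProd (c : ℂ) (φ : Fin s → ℝ → ℂ) (x : Fin s → ℝ) : ℝ := (c * ∏ i, φ i (x i)).re

lemma contDiff_reProd (c : ℂ) {φ : Fin s → ℝ → ℂ} (hφ : ∀ i, IsUnitTest (φ i)) :
    ContDiff ℝ (⊤ : ℕ∞) (reProd c φ) :=
  Complex.reCLM.contDiff.comp (contDiff_const.mul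
    (contDiff_prod fun i _ => (hφ i).contDiff.comp (contDiff_apply ℝ ℝ i)))

lemma tsupport_reProd_subset (c : ℂ) {φ : Fin s → ℝ → ℂ} :
    tsupport (reProd c φ) ⊆ Set.univ.pi fun i => tsupport (φ i) := by
  refine closure_minimal (fun x hx i _ => ?_) (isClosed_set_pi fun i _ => isClosed_tsupport _)
  by_contra hxi
  apply hx
  rw [reProd, Finset.prod_eq_zero (Finset.mem_univ i)
    (image_eq_zero_of_notMem_tsupport (f := φ i) hxi), mul_zero, Complex.zero_re]

lemma prod_update_apply_eq {M : Type*} [CommMonoid M] (φ : Fin s → ℝ → M) (j : Fin s) (g : ℝ → M)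
    (x : Fin s → ℝ) :
    ∏ i, Function.update φ j g i (x i) = g (x j) * ∏ i ∈ Finset.univ.erase j, φ i (x i) := by
  rw [← Finset.mul_prod_erase Finset.univ _ (Finset.mem_univ j), Function.update_self]
  congr 1
  refine Finset.prod_congr rfl fun i hi => ?_
  rw [Function.update_of_ne (Finset.ne_of_mem_erase hi)]

lemma IsUnitTest.update {φ : Fin s → ℝ → ℂ} (hφ : ∀ i, IsUnitTest (φ i)) (j : Fin s)
    {g : ℝ → ℂ} (hg : IsUnitTest g) (i : Fin s) : IsUnitTest (Function.update φ j g i) := by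
  rcases eq_or_ne i j with rfl | hij
  · rwa [Function.update_self]
  · rw [Function.update_of_ne hij]
    exact hφ i

lemma partialDeriv_reProd (c : ℂ) {φ : Fin s → ℝ → ℂ} (hφ : ∀ i, IsUnitTest (φ i)) (j : Fin s) :
    partialDeriv j (reProd c φ) = reProd c (Function.update φ j (deriv (φ j))) := by
  ext x
  have along_line : (fun t : ℝ => reProd c φ (x + t • Pi.single j 1)) =
      fun t : ℝ => (c * (φ j (x j + t) * ∏ i ∈ Finset.univ.erase j, φ i (x i))).re := by
    ext t
    rw [reProd, ← Finset.mul_prod_erase Finset.univ _ (Finset.mem_univ j)]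
    congr 3
    · simp
    · refine Finset.prod_congr rfl fun i hi => ?_
      simp [Pi.single_eq_of_ne (Finset.ne_of_mem_erase hi)]
  have factor : HasDerivAt (fun t : ℝ => φ j (x j + t)) (deriv (φ j) (x j + 0)) 0 :=
    (((hφ j).contDiff.differentiable (by simp) _).hasDerivAt).comp_const_add (x j) 0
  have product := Complex.reCLM.hasFDerivAt.comp_hasDerivAt (0 : ℝ)
    ((factor.mul_const (∏ i ∈ Finset.univ.erase j, φ i (x i))).const_mul c)
  rw [partialDeriv,
    ← ((contDiff_reProd c hφ).differentiable (by simp) x).lineDeriv_eq_fderiv, lineDeriv,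
    along_line, reProd, prod_update_apply_eq]
  exact (HasDerivAt.deriv product).trans (by simp)

lemma iterate_partialDeriv_reProd (c : ℂ) {φ : Fin s → ℝ → ℂ} (hφ : ∀ i, IsUnitTest (φ i))
    (j : Fin s) (n : ℕ) :
    (partialDeriv j)^[n] (reProd c φ) = reProd c (Function.update φ j (iteratedDeriv n (φ j))) := by
  induction n with
  | zero => simp
  | succ n ih =>
    rw [Function.iterate_succ_apply', ih,
      partialDeriv_reProd c (.update hφ j ((hφ j).iteratedDeriv n)), Function.update_self,
      Function.update_idem, iteratedDeriv_succ]

lemma mixedPartial_reProd (c : ℂ) {φ : Fin s → ℝ → ℂ} (hφ : ∀ i, IsUnitTest (φ i))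
    (ν : Fin s → ℕ) :
    mixedPartial ν (reProd c φ) = reProd c fun i => iteratedDeriv (ν i) (φ i) := by
  have foldr_eq : ∀ l : List (Fin s), l.Nodup →
      l.foldr (fun j g => (partialDeriv j)^[ν j] g) (reProd c φ) =
        reProd c fun i => if i ∈ l then iteratedDeriv (ν i) (φ i) else φ i := by
    intro l hl
    induction l with
    | nil => simp
    | cons j l ih =>
      rw [List.nodup_cons] at hl
      rw [List.foldr_cons, ih hl.2, iterate_partialDeriv_reProd]
      · congr 1
        ext i x
        rcases eq_or_ne i j with rfl | hij
        · simp [hl.1]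
        · simp [hij]
      · intro i
        split_ifs
        exacts [(hφ i).iteratedDeriv _, hφ i]
  rw [mixedPartial, foldr_eq _ (List.nodup_finRange s)]
  simp

lemma cube_eq_pi (s : ℕ) : cube s = Set.univ.pi fun _ => Set.Icc (0 : ℝ) 1 :=
  (Set.pi_univ_Icc 0 1).symm

lemma restrict_cube (s : ℕ) : (volume.restrict (cube s) : Measure (Fin s → ℝ)) =
    Measure.pi fun _ => volume.restrict (Set.Icc (0 : ℝ) 1) := by
  rw [cube_eq_pi, volume_pi, Measure.restrict_pi_pi]

lemma measurableSet_cube (s : ℕ) : MeasurableSet (cube s) := measurableSet_Icc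

instance : IsProbabilityMeasure (volume.restrict (Set.Icc (0 : ℝ) 1)) := ⟨by simp⟩

instance : IsProbabilityMeasure (volume.restrict (cube s)) := by
  rw [restrict_cube]
  infer_instance

/-- The integral over the cube of a function times a product of functions of one variable; as a
function of one factor with the others fixed, it reduces several variables to one. -/
noncomputable def pairing (G : (Fin s → ℝ) → ℝ) (ψ : Fin s → ℝ → ℂ) : ℂ :=
  ∫ x in cube s, (G x : ℂ) * ∏ i, ψ i (x i)

lemma measurable_prod_apply {ψ : Fin s → ℝ → ℂ} (hψ : ∀ i, Measurable (ψ i)) :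
    Measurable fun x : Fin s → ℝ => ∏ i, ψ i (x i) :=
  Finset.measurable_prod _ fun i _ => (hψ i).comp (measurable_pi_apply i)

lemma norm_prod_apply_le {ψ : Fin s → ℝ → ℂ} {C : Fin s → ℝ}
    (hC : ∀ i, ∀ x ∈ Set.Icc (0 : ℝ) 1, ‖ψ i x‖ ≤ C i) {x : Fin s → ℝ} (hx : x ∈ cube s) :
    ‖∏ i, ψ i (x i)‖ ≤ ∏ i, C i := by
  rw [cube_eq_pi] at hx
  rw [norm_prod]
  exact Finset.prod_le_prod (fun i _ => norm_nonneg _) fun i _ => hC i _ (hx i (Set.mem_univ i))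

lemma integrableOn_pairing {G : (Fin s → ℝ) → ℝ} (hG : IntegrableOn G (cube s))
    {ψ : Fin s → ℝ → ℂ} (hψ : ∀ i, BoundedOnUnit (ψ i)) :
    IntegrableOn (fun x => (G x : ℂ) * ∏ i, ψ i (x i)) (cube s) := by
  choose hm C hC using hψ
  refine hG.ofReal.mul_bdd (c := ∏ i, C i) (measurable_prod_apply hm).aestronglyMeasurable ?_
  filter_upwards [ae_restrict_mem (measurableSet_cube s)] with x hx
  exact norm_prod_apply_le hC hx

lemma integral_mul_reProd {G : (Fin s → ℝ) → ℝ} (hG : IntegrableOn G (cube s))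
    {ψ : Fin s → ℝ → ℂ} (hψ : ∀ i, BoundedOnUnit (ψ i)) (c : ℂ) :
    ∫ x in cube s, G x * reProd c ψ x = (c * pairing G ψ).re := by
  rw [pairing, ← integral_const_mul, ← Complex.reCLM_apply,
    ← Complex.reCLM.integral_comp_comm ((integrableOn_pairing hG hψ).const_mul c)]
  congr 1
  ext x
  rw [reProd, Complex.reCLM_apply, mul_left_comm, Complex.re_ofReal_mul]

lemma IsWeakDeriv.integral_mul_reProd_eq {ν : Fin s → ℕ} {F G : (Fin s → ℝ) → ℝ}
    (h : IsWeakDeriv ν F G) {φ : Fin s → ℝ → ℂ} (hφ : ∀ i, IsUnitTest (φ i)) (c : ℂ) :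
    ∫ x in cube s, F x * reProd c (fun i => iteratedDeriv (ν i) (φ i)) x =
      (-1) ^ (∑ j, ν j) * ∫ x in cube s, G x * reProd c φ x := by
  have tsupport_subset := tsupport_reProd_subset c (φ := φ)
  rw [← mixedPartial_reProd c hφ]
  refine h.integral_eq _ (contDiff_reProd c hφ) ?_ ?_
  · exact (isCompact_univ_pi fun i => (hφ i).hasCompactSupport).of_isClosed_subset
      (isClosed_tsupport _) tsupport_subset
  · exact tsupport_subset.trans (Set.pi_mono fun i _ => (hφ i).tsupport_subset)

lemma IsWeakDeriv.pairing_eq {ν : Fin s → ℕ} {F G : (Fin s → ℝ) → ℝ} (h : IsWeakDeriv ν F G)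
    (hF : IntegrableOn F (cube s)) {φ : Fin s → ℝ → ℂ} (hφ : ∀ i, IsUnitTest (φ i)) :
    pairing F (fun i => iteratedDeriv (ν i) (φ i)) = (-1) ^ (∑ j, ν j) * pairing G φ := by
  have re_mul_eq : ∀ c : ℂ, (c * pairing F (fun i => iteratedDeriv (ν i) (φ i))).re =
      (c * ((-1) ^ (∑ j, ν j) * pairing G φ)).re := fun c => by
    rw [← integral_mul_reProd hF fun i => ((hφ i).iteratedDeriv _).boundedOnUnit,
      h.integral_mul_reProd_eq hφ, integral_mul_reProd h.integrableOn fun i => (hφ i).boundedOnUnit,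
      mul_left_comm, ← Complex.re_ofReal_mul]
    push_cast
    rfl
  apply Complex.ext
  · simpa using re_mul_eq 1
  · simpa using re_mul_eq (-Complex.I)

lemma IsWeakDeriv.pairing_update_deriv {ν : Fin s → ℕ} {F G G' : (Fin s → ℝ) → ℝ} {j : Fin s}
    (h : IsWeakDeriv ν F G) (h' : IsWeakDeriv (Function.update ν j (ν j + 1)) F G')
    (hF : IntegrableOn F (cube s)) {φ : Fin s → ℝ → ℂ} (hφ : ∀ i, IsUnitTest (φ i)) :
    pairing G (Function.update φ j (deriv (φ j))) = -pairing G' φ := by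
  have derivatives_eq : (fun i => iteratedDeriv (ν i) (Function.update φ j (deriv (φ j)) i)) =
      fun i => iteratedDeriv (Function.update ν j (ν j + 1) i) (φ i) := by
    ext i : 1
    rcases eq_or_ne i j with rfl | hij
    · simp [iteratedDeriv_succ']
    · simp [hij]
  have order_eq : ∑ i, Function.update ν j (ν j + 1) i = ∑ i, ν i + 1 := by
    rw [Finset.sum_update_of_mem (Finset.mem_univ j), Finset.sdiff_singleton_eq_erase,
      ← Finset.add_sum_erase _ ν (Finset.mem_univ j)]
    ring
  have both := h.pairing_eq hF (.update hφ j (hφ j).deriv)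
  rw [derivatives_eq, h'.pairing_eq hF hφ, order_eq, pow_succ, mul_assoc, neg_one_mul] at both
  exact (mul_left_cancel₀ (pow_ne_zero _ (by norm_num)) both).symm

lemma tendsto_pairing {G : (Fin s → ℝ) → ℝ} (hG : IntegrableOn G (cube s))
    {φ : ℕ → Fin s → ℝ → ℂ} {ψ : Fin s → ℝ → ℂ} {C : Fin s → ℝ}
    (hm : ∀ n i, Measurable (φ n i)) (hC : ∀ n i x, ‖φ n i x‖ ≤ C i)
    (hlim : ∀ i, ∀ᵐ x ∂volume.restrict (Set.Icc (0 : ℝ) 1),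
      Tendsto (fun n => φ n i x) atTop (𝓝 (ψ i x))) :
    Tendsto (fun n => pairing G (φ n)) atTop (𝓝 (pairing G ψ)) := by
  refine tendsto_integral_of_dominated_convergence (fun x => ‖G x‖ * ∏ i, C i)
    (fun n => hG.ofReal.aestronglyMeasurable.mul
      (measurable_prod_apply (hm n)).aestronglyMeasurable)
    (hG.norm.mul_const _) (fun n => ?_) ?_
  · filter_upwards [ae_restrict_mem (measurableSet_cube s)] with x hx
    rw [norm_mul, Complex.norm_real]
    exact mul_le_mul_of_nonneg_left (norm_prod_apply_le (fun i x _ => hC n i x) hx) (norm_nonneg _)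
  · have factors : ∀ᵐ x ∂(Measure.pi fun _ : Fin s => volume.restrict (Set.Icc (0 : ℝ) 1)),
        ∀ i, Tendsto (fun n => φ n i (x i)) atTop (𝓝 (ψ i (x i))) :=
      eventually_all.2 fun i => (Measure.tendsto_eval_ae_ae
        (μ := fun _ : Fin s => volume.restrict (Set.Icc (0 : ℝ) 1))).eventually (hlim i)
    rw [restrict_cube]
    filter_upwards [factors] with x hx
    exact (tendsto_finsetProd _ fun i _ => hx i).const_mul _

lemma tendsto_pairing_update {G : (Fin s → ℝ) → ℝ} (hG : IntegrableOn G (cube s)) (j : Fin s)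
    {φ : ℕ → Fin s → ℝ → ℂ} {ψ : Fin s → ℝ → ℂ} {C : Fin s → ℝ} {r : ℕ → ℝ → ℂ} {g : ℝ → ℂ} {D : ℝ}
    (hm : ∀ n i, Measurable (φ n i)) (hC : ∀ n i x, ‖φ n i x‖ ≤ C i)
    (hlim : ∀ i, ∀ᵐ x ∂volume.restrict (Set.Icc (0 : ℝ) 1),
      Tendsto (fun n => φ n i x) atTop (𝓝 (ψ i x)))
    (hmr : ∀ n, Measurable (r n)) (hD : ∀ n x, ‖r n x‖ ≤ D)
    (hrg : ∀ᵐ x ∂volume.restrict (Set.Icc (0 : ℝ) 1), Tendsto (fun n => r n x) atTop (𝓝 (g x))) :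
    Tendsto (fun n => pairing G (Function.update (φ n) j (r n))) atTop
      (𝓝 (pairing G (Function.update ψ j g))) := by
  refine tendsto_pairing hG (C := Function.update C j D) (fun n i => ?_) (fun n i x => ?_)
    fun i => ?_
  all_goals rcases eq_or_ne i j with rfl | hij
  · simpa using hmr n
  · simpa [hij] using hm n i
  · simpa using hD n x
  · simpa [hij] using hC n i x
  · simpa using hrg
  · simpa [hij] using hlim i

lemma IsWeakDeriv.pairing_parts {ν : Fin s → ℕ} {F G G' : (Fin s → ℝ) → ℝ} {j : Fin s}
    (h : IsWeakDeriv ν F G) (h' : IsWeakDeriv (Function.update ν j (ν j + 1)) F G')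
    (hF : IntegrableOn F (cube s)) {ψ : Fin s → ℝ → ℂ} (hψ : ∀ i, BoundedOnUnit (ψ i))
    {g : ℝ → ℂ} (hg : ∀ x ∈ Set.Icc (0 : ℝ) 1, ∫ y in (0 : ℝ)..x, ψ j y = g x) (hg1 : g 1 = 0) :
    pairing G ψ = -pairing G' (Function.update ψ j g) := by
  choose φ C hφ hC hlim using fun i => exists_isUnitTest_tendsto (hψ i)
  obtain ⟨p, D, hp, hD, hD', hpg, hpψ⟩ := exists_isUnitTest_tendsto_deriv (hψ j) hg hg1
  have measurable_φ : ∀ n i, Measurable (φ i n) := fun n i => (hφ i n).continuous.measurable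
  have left : Tendsto (fun n => pairing G (Function.update (fun i => φ i n) j (deriv (p n)))) atTop
      (𝓝 (pairing G ψ)) := by
    simpa using tendsto_pairing_update h.integrableOn j (ψ := ψ) measurable_φ (fun n i => hC i n)
      hlim (fun n => (hp n).deriv.continuous.measurable) hD' hpψ
  have right := tendsto_pairing_update h'.integrableOn j measurable_φ (fun n i => hC i n) hlim
    (fun n => (hp n).continuous.measurable) hD hpg
  refine tendsto_nhds_unique left (right.neg.congr fun n => ?_)
  simpa using (h.pairing_update_deriv h' hF (.update (fun i => hφ i n) j (hp n))).symm

end Pairing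

section MultivariateDecay

/-! ### Decay of Walsh coefficients in several variables -/

variable {s : ℕ}

lemma le_lpSum {ι : Type*} {p : ℝ≥0∞} (hp : p ≠ 0) {S : Finset ι} (a : ι → ℝ≥0∞) {i : ι}
    (hi : i ∈ S) : a i ≤ lpSum p S a := by
  rw [lpSum]
  split_ifs with htop
  · exact Finset.le_sup hi
  · rw [one_div, ENNReal.le_rpow_inv_iff (ENNReal.toReal_pos hp htop)]
    exact Finset.single_le_sum (f := fun i => a i ^ p.toReal) (fun _ _ => zero_le) hi

lemma measurePreserving_piecewise (v : Finset (Fin s)) :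
    MeasurePreserving (fun p : (Fin s → ℝ) × (Fin s → ℝ) => v.piecewise p.1 p.2)
      ((volume.restrict (cube s)).prod (volume.restrict (cube s))) (volume.restrict (cube s)) := by
  have hm : Measurable fun p : (Fin s → ℝ) × (Fin s → ℝ) => v.piecewise p.1 p.2 := by
    refine measurable_pi_lambda _ fun i => ?_
    by_cases hi : i ∈ v
    · simp only [hi, Finset.piecewise_eq_of_mem]
      fun_prop
    · simp only [hi, not_false_eq_true, Finset.piecewise_eq_of_notMem]
      fun_prop
  refine ⟨hm, ?_⟩
  rw [restrict_cube]
  refine (Measure.pi_eq fun t ht => ?_).symm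
  rw [Measure.map_apply hm (MeasurableSet.univ_pi ht)]
  have preimage_pi : (fun p : (Fin s → ℝ) × (Fin s → ℝ) => v.piecewise p.1 p.2) ⁻¹'
      Set.univ.pi t = (Set.univ.pi fun i => if i ∈ v then t i else Set.univ) ×ˢ
        (Set.univ.pi fun i => if i ∈ v then Set.univ else t i) := by
    ext p
    simp only [Set.mem_preimage, Set.mem_pi, Set.mem_univ, true_imp_iff, Set.mem_prod,
      ← forall_and]
    refine forall_congr' fun i => ?_
    by_cases hi : i ∈ v <;> simp [hi]
  rw [preimage_pi, Measure.prod_prod, Measure.pi_pi, Measure.pi_pi, ← Finset.prod_mul_distrib]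
  refine Finset.prod_congr rfl fun i _ => ?_
  by_cases hi : i ∈ v <;> simp [hi]

/-- The function of the coordinates in `v` that remains when the other coordinates are integrated
out, as in the definition of the Sobolev norm. -/
noncomputable def marginal (v : Finset (Fin s)) (G : (Fin s → ℝ) → ℝ) (y : Fin s → ℝ) : ℝ :=
  ∫ z in cube s, G (v.piecewise y z)

lemma integrable_marginal {G : (Fin s → ℝ) → ℝ} (hG : IntegrableOn G (cube s))
    (v : Finset (Fin s)) : IntegrableOn (marginal v G) (cube s) :=
  ((measurePreserving_piecewise v).integrable_comp_of_integrable hG).integral_prod_left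

lemma pairing_marginal {G : (Fin s → ℝ) → ℝ} (hG : IntegrableOn G (cube s)) {v : Finset (Fin s)}
    {ψ : Fin s → ℝ → ℂ} (hψ : ∀ i, BoundedOnUnit (ψ i)) (hv : ∀ i ∉ v, ψ i = fun _ => 1) :
    pairing (marginal v G) ψ = pairing G ψ := by
  have mp := measurePreserving_piecewise v
  have integrable := integrableOn_pairing hG hψ
  have prod_piecewise : ∀ y z : Fin s → ℝ, ∏ i, ψ i (v.piecewise y z i) = ∏ i, ψ i (y i) :=
    fun y z => Finset.prod_congr rfl fun i _ => by
      by_cases hi : i ∈ v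
      · rw [Finset.piecewise_eq_of_mem _ _ _ hi]
      · rw [hv i hi]
  symm
  calc pairing G ψ = ∫ p : (Fin s → ℝ) × (Fin s → ℝ),
        (G (v.piecewise p.1 p.2) : ℂ) * ∏ i, ψ i (v.piecewise p.1 p.2 i)
          ∂(volume.restrict (cube s)).prod (volume.restrict (cube s)) := by
        rw [pairing]
        conv_lhs => rw [← mp.map_eq]
        exact integral_map mp.measurable.aemeasurable
          (by rw [mp.map_eq]; exact integrable.aestronglyMeasurable)
    _ = pairing (marginal v G) ψ := by
        refine (integral_prod _ (mp.integrable_comp_of_integrable integrable)).trans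
          (integral_congr_ae (.of_forall fun y => ?_))
        simp only [Function.comp_apply, prod_piecewise, integral_mul_const]
        exact congrArg (· * _) integral_ofReal

lemma norm_pairing_le_eLpNorm_marginal {G : (Fin s → ℝ) → ℝ} (hG : IntegrableOn G (cube s))
    {v : Finset (Fin s)} {ψ : Fin s → ℝ → ℂ} {C : Fin s → ℝ} (hm : ∀ i, Measurable (ψ i))
    (hC : ∀ i, ∀ x ∈ Set.Icc (0 : ℝ) 1, ‖ψ i x‖ ≤ C i) (hv : ∀ i ∉ v, ψ i = fun _ => 1)
    {q B : ℝ≥0∞} (hq : 1 ≤ q) (hB : B ≠ ∞)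
    (hle : eLpNorm (marginal v G) q (volume.restrict (cube s)) ≤ B) :
    ‖pairing G ψ‖ ≤ (∏ i, C i) * B.toReal := by
  have marginal_integrable := integrable_marginal hG v
  have norm_prod_le : ∀ y ∈ cube s, ‖∏ i, ψ i (y i)‖ ≤ ∏ i, C i := fun y => norm_prod_apply_le hC
  calc ‖pairing G ψ‖ ≤ ∫ y in cube s, ‖marginal v G y‖ * ∏ i, C i := by
        rw [← pairing_marginal hG (fun i => ⟨hm i, C i, hC i⟩) hv]
        refine norm_integral_le_of_norm_le (marginal_integrable.norm.mul_const _) ?_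
        filter_upwards [ae_restrict_mem (measurableSet_cube s)] with y hy
        rw [norm_mul, Complex.norm_real]
        exact mul_le_mul_of_nonneg_left (norm_prod_le y hy) (norm_nonneg _)
    _ = (∏ i, C i) * (eLpNorm (marginal v G) 1 (volume.restrict (cube s))).toReal := by
        rw [integral_mul_const, mul_comm, eLpNorm_one_eq_lintegral_enorm,
          integral_norm_eq_lintegral_enorm marginal_integrable.aestronglyMeasurable]
    _ ≤ (∏ i, C i) * B.toReal := by
        refine mul_le_mul_of_nonneg_left (ENNReal.toReal_mono hB ?_)
          ((norm_nonneg _).trans (norm_prod_le 0 (by simp [cube])))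
        exact (eLpNorm_le_eLpNorm_of_exponent_le hq marginal_integrable.aestronglyMeasurable).trans
          hle

lemma isWeakDeriv_zero {F : (Fin s → ℝ) → ℝ} (hF : IntegrableOn F (cube s)) :
    IsWeakDeriv 0 F F where
  integrableOn := hF
  integral_eq φ _ _ _ := by
    have mixedPartial_zero : mixedPartial 0 φ = φ := by
      rw [mixedPartial]
      induction List.finRange s with
      | nil => rfl
      | cons j l _ => simp
    simp [mixedPartial_zero]

lemma isWeakDeriv_weakDeriv {ν : Fin s → ℕ} {F : (Fin s → ℝ) → ℝ}
    (h : ∃ G, IsWeakDeriv ν F G) : IsWeakDeriv ν F (weakDeriv ν F) := by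
  rw [weakDeriv, dif_pos h]
  exact h.choose_spec

lemma BoundedOnUnit.update {ψ : Fin s → ℝ → ℂ} (hψ : ∀ i, BoundedOnUnit (ψ i)) (j : Fin s)
    {g : ℝ → ℂ} (hg : BoundedOnUnit g) (i : Fin s) : BoundedOnUnit (Function.update ψ j g i) := by
  rcases eq_or_ne i j with rfl | hij
  · rwa [Function.update_self]
  · rw [Function.update_of_ne hij]
    exact hψ i

lemma boundedOnUnit_one : BoundedOnUnit fun _ => 1 := ⟨measurable_const, 1, by simp⟩

lemma pairing_update_add {G : (Fin s → ℝ) → ℝ} (hG : IntegrableOn G (cube s))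
    {ψ : Fin s → ℝ → ℂ} (hψ : ∀ i, BoundedOnUnit (ψ i)) (j : Fin s) (c : ℂ) {g : ℝ → ℂ}
    (hg : BoundedOnUnit g) :
    pairing G (Function.update ψ j fun x => c + g x) =
      c * pairing G (Function.update ψ j fun _ => 1) + pairing G (Function.update ψ j g) := by
  rw [pairing, pairing, pairing, ← integral_const_mul, ← integral_add
    ((integrableOn_pairing hG (.update hψ j boundedOnUnit_one)).const_mul c)
    (integrableOn_pairing hG (.update hψ j hg))]
  refine integral_congr_ae (.of_forall fun x => ?_)
  simp only [prod_update_apply_eq]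
  ring

/-- The factors `g` at which the repeated partial integrations in one coordinate stop, the order `k`
of the derivative reached by then, and the bound `c` for `g`: either `α` integrations were possible,
or a constant was left after fewer of them. -/
def IsTerminalFactor (α k : ℕ) (g : ℝ → ℂ) (c : ℝ) : Prop :=
  (k = α ∧ Measurable g ∧ ∀ x ∈ Set.Icc (0 : ℝ) 1, ‖g x‖ ≤ c) ∨
    (k ∈ Finset.Icc 1 α ∧ (g = fun _ => 1) ∧ c = 1)

lemma IsTerminalFactor.order_le {α k : ℕ} {g : ℝ → ℂ} {c : ℝ} (h : IsTerminalFactor α k g c) :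
    k ≤ α := h.elim (fun h => h.1.le) fun h => (Finset.mem_Icc.1 h.1).2

lemma IsTerminalFactor.boundedOnUnit {α k : ℕ} {g : ℝ → ℂ} {c : ℝ}
    (h : IsTerminalFactor α k g c) : BoundedOnUnit g := by
  obtain ⟨-, hm, hc⟩ | ⟨-, rfl, -⟩ := h
  exacts [⟨hm, c, hc⟩, boundedOnUnit_one]

section Walsh

variable {b α N : ℕ} [Fact (1 < b)] {κ : Fin s → ℕ → ZMod b} {w : Fin s → ℝ}

/-- The state of the partial integrations when they are still to be done in the coordinates in `R`,
where the factor is a Walsh function and `w` is the bound to be reached, and have been done in those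
in `u ∖ R`; nothing happens outside of `u`. -/
structure IsWalshState (α N : ℕ) (κ : Fin s → ℕ → ZMod b) (w : Fin s → ℝ) (u R : Finset (Fin s))
    (ν : Fin s → ℕ) (ψ : Fin s → ℝ → ℂ) (c : Fin s → ℝ) : Prop where
  walsh_factor : ∀ j ∈ R, ν j = 0 ∧ ψ j = walsh N (κ j) ∧ c j = w j
  terminal : ∀ j ∈ u, j ∉ R → IsTerminalFactor α (ν j) (ψ j) (c j)
  trivial : ∀ j ∉ u, ν j = 0 ∧ (ψ j = fun _ => 1) ∧ c j = 1

namespace IsWalshState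

variable {u R : Finset (Fin s)} {ν : Fin s → ℕ} {ψ : Fin s → ℝ → ℂ} {c : Fin s → ℝ} {a : Fin s}

lemma order_le (h : IsWalshState α N κ w u R ν ψ c) (j : Fin s) : ν j ≤ α := by
  by_cases hjR : j ∈ R
  · exact (h.walsh_factor j hjR).1.trans_le (Nat.zero_le α)
  by_cases hju : j ∈ u
  · exact (h.terminal j hju hjR).order_le
  · exact (h.trivial j hju).1.trans_le (Nat.zero_le α)

lemma boundedOnUnit (h : IsWalshState α N κ w u R ν ψ c) (j : Fin s) :
    BoundedOnUnit (ψ j) := by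
  by_cases hjR : j ∈ R
  · rw [(h.walsh_factor j hjR).2.1]
    exact ⟨measurable_walsh _ _, 1, fun x _ => (norm_walsh _ _ _).le⟩
  by_cases hju : j ∈ u
  · exact (h.terminal j hju hjR).boundedOnUnit
  · rw [(h.trivial j hju).2.1]
    exact boundedOnUnit_one

lemma update (h : IsWalshState α N κ w u (insert a R) ν ψ c) (haR : a ∉ R) (hau : a ∈ u) {k : ℕ}
    {g : ℝ → ℂ} {d : ℝ} (hg : IsTerminalFactor α k g d) :
    IsWalshState α N κ w u R (Function.update ν a k) (Function.update ψ a g)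
      (Function.update c a d) where
  walsh_factor j hj := by
    simpa [ne_of_mem_of_not_mem hj haR] using h.walsh_factor j (Finset.mem_insert_of_mem hj)
  terminal j hju hjR := by
    rcases eq_or_ne j a with rfl | hja
    · simpa using hg
    · simpa [hja] using h.terminal j hju (by simp [hja, hjR])
  trivial j hj := by
    simpa [(ne_of_mem_of_not_mem hau hj).symm] using h.trivial j hj

lemma isDerivFamily_pairing {F : (Fin s → ℝ) → ℝ} (hF : IntegrableOn F (cube s))
    {G : (Fin s → ℕ) → (Fin s → ℝ) → ℝ}
    (hG : ∀ ν : Fin s → ℕ, (∀ j, ν j ≤ α) → IsWeakDeriv ν F (G ν))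
    (h : IsWalshState α N κ w u R ν ψ c) {B : ℝ}
    (hB : ∀ k g d, IsTerminalFactor α k g d →
      ‖pairing (G (Function.update ν a k)) (Function.update ψ a g)‖ ≤ d * B) :
    IsDerivFamily α (fun k g => pairing (G (Function.update ν a k)) (Function.update ψ a g)) B := by
  have weakDeriv_update : ∀ k ≤ α, IsWeakDeriv (Function.update ν a k) F
      (G (Function.update ν a k)) := fun k hk => hG _ fun j => by
    rcases eq_or_ne j a with rfl | hja
    · simpa using hk
    · simpa [hja] using h.order_le j
  refine ⟨fun k hk c g hg => pairing_update_add (weakDeriv_update k hk).integrableOn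
    h.boundedOnUnit a c hg, fun k hk g g' hg _ hgg' hg1 => ?_, fun k hk1 hk => ?_,
    fun g d hm hd => ?_⟩
  · have next := weakDeriv_update (k + 1) hk
    rw [show Function.update ν a (k + 1) = Function.update (Function.update ν a k) a
      (Function.update ν a k a + 1) by simp] at next
    simpa using (weakDeriv_update k hk.le).pairing_parts next hF (.update h.boundedOnUnit a hg)
      (g := g') (by simpa using hgg') hg1
  · simpa using hB k _ 1 (.inr ⟨Finset.mem_Icc.2 ⟨hk1, hk⟩, rfl, rfl⟩)
  · rw [mul_comm]
    exact hB α g d (.inl ⟨rfl, hm, hd⟩)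

end IsWalshState

lemma norm_pairing_le_of_isWalshState (hα : 1 ≤ α) {E : ℝ}
    (hE : ∀ i, 1 ≤ i → i ≤ α → (2 * Real.sin (Real.pi / b))⁻¹ ^ i ≤ E)
    {F : (Fin s → ℝ) → ℝ} (hF : IntegrableOn F (cube s)) {G : (Fin s → ℕ) → (Fin s → ℝ) → ℝ}
    (hG : ∀ ν : Fin s → ℕ, (∀ j, ν j ≤ α) → IsWeakDeriv ν F (G ν)) {u : Finset (Fin s)}
    (hκ : ∀ j ∈ u, ∃ i < N, κ j i ≠ 0)
    (hw : ∀ j, w j = 3 * E * ((b : ℝ) ^ topDigitSum (κ j) N α)⁻¹) {B : ℝ}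
    (hB : ∀ ν ψ c, IsWalshState α N κ w u ∅ ν ψ c → ‖pairing (G ν) ψ‖ ≤ (∏ j, c j) * B)
    {R : Finset (Fin s)} (hR : R ⊆ u) :
    ∀ ν ψ c, IsWalshState α N κ w u R ν ψ c → ‖pairing (G ν) ψ‖ ≤ (∏ j, c j) * B := by
  induction R using Finset.induction with
  | empty => exact hB
  | insert a R haR ih =>
    intro ν ψ c h
    obtain ⟨hau, hRu⟩ := Finset.insert_subset_iff.1 hR
    obtain ⟨hνa, hψa, hca⟩ := h.walsh_factor a (Finset.mem_insert_self a R)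
    have family := h.isDerivFamily_pairing (a := a) hF hG
      (B := (∏ j ∈ Finset.univ.erase a, c j) * B) fun k g d hg => by
        refine (ih hRu _ _ _ (h.update haR hau hg)).trans_eq ?_
        rw [Finset.prod_update_of_mem (Finset.mem_univ a), Finset.sdiff_singleton_eq_erase,
          mul_assoc]
    have bound := family.norm_walsh_le hα hE (hκ a hau)
    rwa [← hw, ← hca, ← hνa, ← hψa, Function.update_eq_self, Function.update_eq_self, ← mul_assoc,
      Finset.mul_prod_erase _ _ (Finset.mem_univ a)] at bound

end Walsh

namespace MemSobolev

variable {α : ℕ} {γ : Finset (Fin s) → ℝ≥0} {q : ℝ≥0∞} {F : (Fin s → ℝ) → ℝ}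

lemma lpSum_le (h : MemSobolev α γ q ∞ F) (u : Finset (Fin s)) :
    lpSum q (u.powerset.sigma fun v => mixedOrders α u v) (fun p =>
        eLpNorm (marginal p.1 (weakDeriv p.2 F)) q (volume.restrict (cube s))) ≤
      γ u * sobolevENorm α γ q ∞ F := by
  set S := lpSum q (u.powerset.sigma fun v => mixedOrders α u v) fun p =>
    eLpNorm (marginal p.1 (weakDeriv p.2 F)) q (volume.restrict (cube s))
  have inv_mul_le : (γ u : ℝ≥0∞)⁻¹ * S ≤ sobolevENorm α γ q ∞ F :=
    le_lpSum (by simp) _ (Finset.mem_univ u)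
  by_cases hγ : γ u = 0
  · by_contra! hS
    rw [hγ, ENNReal.coe_zero, ENNReal.inv_zero, ENNReal.top_mul (bot_lt_of_lt hS).ne'] at inv_mul_le
    exact (inv_mul_le.trans_lt h.norm_lt_top).false
  · rwa [ENNReal.inv_mul_le_iff (by simpa using hγ) (by simp)] at inv_mul_le

lemma eLpNorm_marginal_weakDeriv_le (h : MemSobolev α γ q ∞ F) (hq : q ≠ 0) {u v : Finset (Fin s)}
    (hv : v ⊆ u) {ν : Fin s → ℕ} (hν : ν ∈ mixedOrders α u v) :
    eLpNorm (marginal v (weakDeriv ν F)) q (volume.restrict (cube s)) ≤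
      γ u * sobolevENorm α γ q ∞ F :=
  (le_lpSum hq (fun p : (_ : Finset (Fin s)) × (Fin s → ℕ) =>
    eLpNorm (marginal p.1 (weakDeriv p.2 F)) q (volume.restrict (cube s))) (i := ⟨v, ν⟩)
    (Finset.mem_sigma.2 ⟨Finset.mem_powerset.2 hv, hν⟩)).trans (h.lpSum_le u)

variable {b N : ℕ} [Fact (1 < b)] {κ : Fin s → ℕ → ZMod b} {w : Fin s → ℝ} {u : Finset (Fin s)}

open Classical in
lemma norm_pairing_weakDeriv_le (h : MemSobolev α γ q ∞ F) (hq : 1 ≤ q) {ν : Fin s → ℕ}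
    {ψ : Fin s → ℝ → ℂ} {c : Fin s → ℝ} (hstate : IsWalshState α N κ w u ∅ ν ψ c) :
    ‖pairing (weakDeriv ν F) ψ‖ ≤ (∏ j, c j) * (γ u * (sobolevENorm α γ q ∞ F).toReal) := by
  let v : Finset (Fin s) :=
    {j ∈ u | ν j = α ∧ Measurable (ψ j) ∧ ∀ x ∈ Set.Icc (0 : ℝ) 1, ‖ψ j x‖ ≤ c j}
  have constant : ∀ j ∈ u, j ∉ v → ν j ∈ Finset.Icc 1 α ∧ (ψ j = fun _ => 1) ∧ c j = 1 :=
    fun j hju hjv => (hstate.terminal j hju (Finset.notMem_empty j)).resolve_left fun hj =>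
      hjv (Finset.mem_filter.2 ⟨hju, hj⟩)
  have factor_one : ∀ j ∉ v, (ψ j = fun _ => 1) ∧ c j = 1 := fun j hjv => by
    by_cases hju : j ∈ u
    exacts [(constant j hju hjv).2, (hstate.trivial j hju).2]
  have factor_le : ∀ j, ∀ x ∈ Set.Icc (0 : ℝ) 1, ‖ψ j x‖ ≤ c j := fun j x hx => by
    by_cases hjv : j ∈ v
    · exact (Finset.mem_filter.1 hjv).2.2.2 x hx
    · simp [factor_one j hjv]
  have mem_mixedOrders : ν ∈ mixedOrders α u v := Fintype.mem_piFinset.2 fun j => by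
    split_ifs with hjv hju
    · exact Finset.mem_singleton.2 (Finset.mem_filter.1 hjv).2.1
    · exact (constant j hju hjv).1
    · exact Finset.mem_singleton.2 (hstate.trivial j hju).1
  have bound := norm_pairing_le_eLpNorm_marginal
    (isWeakDeriv_weakDeriv (h.exists_weakDeriv ν hstate.order_le)).integrableOn
    (fun j => (hstate.boundedOnUnit j).1) factor_le (fun j hj => (factor_one j hj).1) hq
    (ENNReal.mul_ne_top ENNReal.coe_ne_top h.norm_lt_top.ne)
    (h.eLpNorm_marginal_weakDeriv_le (zero_lt_one.trans_le hq).ne' (Finset.filter_subset _ u)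
      mem_mixedOrders)
  rwa [ENNReal.toReal_mul, ENNReal.coe_toReal] at bound

open Classical in
lemma norm_pairing_walsh_le (hα : 1 ≤ α) (hq : 1 ≤ q) (h : MemSobolev α γ q ∞ F) {E : ℝ}
    (hE : ∀ i, 1 ≤ i → i ≤ α → (2 * Real.sin (Real.pi / b))⁻¹ ^ i ≤ E) (hu : u.Nonempty)
    (hκ : ∀ j, j ∈ u ↔ ∃ i < N, κ j i ≠ 0) :
    ‖pairing F fun j => walsh N (κ j)‖ ≤
      (∏ j ∈ u, 3 * E * ((b : ℝ) ^ topDigitSum (κ j) N α)⁻¹) *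
        (γ u * (sobolevENorm α γ q ∞ F).toReal) := by
  have hF : IntegrableOn F (cube s) := h.continuousOn.integrableOn_compact isCompact_Icc
  -- `weakDeriv 0 F` agrees with `F` almost everywhere only, which the pairing does not see.
  let G : (Fin s → ℕ) → (Fin s → ℝ) → ℝ := fun ν => if ν = 0 then F else weakDeriv ν F
  have hG : ∀ ν : Fin s → ℕ, (∀ j, ν j ≤ α) → IsWeakDeriv ν F (G ν) := fun ν hν => by
    by_cases hν0 : ν = 0
    · simpa [G, hν0] using isWeakDeriv_zero hF
    · simpa [G, hν0] using isWeakDeriv_weakDeriv (h.exists_weakDeriv ν hν)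
  let w : Fin s → ℝ := fun j => 3 * E * ((b : ℝ) ^ topDigitSum (κ j) N α)⁻¹
  have initial : IsWalshState α N κ w u u 0 (fun j => walsh N (κ j))
      (fun j => if j ∈ u then w j else 1) := by
    refine ⟨fun j hj => by simp [hj], fun j hj hj' => absurd hj hj', fun j hj => ?_⟩
    have digits_zero : ∀ i < N, κ j i = 0 := by simpa using (hκ j).not.1 hj
    exact ⟨rfl, funext (walsh_of_eq_zero digits_zero), if_neg hj⟩
  have bound := norm_pairing_le_of_isWalshState hα hE hF hG (fun j => (hκ j).1) (fun _ => rfl)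
    (B := γ u * (sobolevENorm α γ q ∞ F).toReal) (fun ν ψ c hstate => ?_) subset_rfl _ _ _ initial
  · simpa [G, Finset.prod_ite_mem] using bound
  · obtain ⟨j, hj⟩ := hu
    have hν : ν ≠ 0 := by
      rintro rfl
      rcases hstate.terminal j hj (Finset.notMem_empty j) with hterm | hterm
      · exact absurd hterm.1 (by simp; omega)
      · simp at hterm
    simpa [G, hν] using h.norm_pairing_weakDeriv_le hq hstate

end MemSobolev

end MultivariateDecay

section WalshSeries

/-! ### Walsh series on the cube -/

/-- The digit `κ_a` of `k = κ_0 + κ_1 b + κ_2 b² + ⋯`, as a residue modulo `b`. -/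
def natDigit (b k a : ℕ) : ZMod b := ((k / b ^ a % b : ℕ) : ZMod b)

/-- The sequence that interlaces `α` sequences, the `a`-th term of the `i`-th of them taking the
position `i + α a`. -/
def interlaceSeq {α : ℕ} [NeZero α] {β : Type*} (c : Fin α → ℕ → β) (n : ℕ) : β :=
  c (Fin.ofNat α n) (n / α)

lemma interlaceSeq_add_mul {α : ℕ} [NeZero α] {β : Type*} (c : Fin α → ℕ → β) (i : Fin α) (a : ℕ) :
    interlaceSeq c (i + α * a) = c i a := by
  have index : Fin.ofNat α (i + α * a) = i := Fin.ext (by simp [Fin.ofNat, Nat.mod_eq_of_lt i.2])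
  rw [interlaceSeq, index, Nat.add_mul_div_left _ _ (NeZero.pos α), Nat.div_eq_of_lt i.2, zero_add]

@[to_additive]
lemma prod_range_interlace {α : ℕ} {β : Type*} [CommMonoid β] (M : ℕ) (f : ℕ → β) :
    ∏ n ∈ Finset.range (M * α), f n = ∏ i : Fin α, ∏ a : Fin M, f (i + α * a) := by
  rw [Finset.prod_range, ← Equiv.prod_comp finProdFinEquiv, Fintype.prod_prod_type,
    Finset.prod_comm]
  rfl

/-- The `a`-th digit of the `p`-th of the `s α` numbers that the coordinates of `x` interlace. -/
noncomputable def deinterlacedDigit {s α : ℕ} (b : ℕ) (x : Fin s → ℝ) (p : Fin (s * α))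
    (a : ℕ) : ZMod b :=
  (⌊x p.divNat * (b : ℝ) ^ ((p.modNat : ℕ) + α * a + 1)⌋ : ZMod b)

lemma deinterlacedDigit_finProdFinEquiv {s α : ℕ} (b : ℕ) (x : Fin s → ℝ) (j : Fin s)
    (i : Fin α) (a : ℕ) :
    deinterlacedDigit b x (finProdFinEquiv (j, i)) a =
      (⌊x j * (b : ℝ) ^ ((i : ℕ) + α * a + 1)⌋ : ZMod b) := by
  have symm_eq := Prod.ext_iff.1 (finProdFinEquiv.symm_apply_apply (j, i))
  rw [deinterlacedDigit, show Fin.divNat _ = j from symm_eq.1, show Fin.modNat _ = i from symm_eq.2]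

variable {s b : ℕ} [Fact (1 < b)]

lemma natDigit_log_ne_zero {k : ℕ} (hk : k ≠ 0) : natDigit b k (Nat.log b k) ≠ 0 := by
  have leading_lt : k / b ^ Nat.log b k < b :=
    Nat.div_lt_of_lt_mul (pow_succ b _ ▸ Nat.lt_pow_succ_log_self Fact.out k)
  have leading_pos : 0 < k / b ^ Nat.log b k :=
    Nat.div_pos (Nat.pow_log_le_self b hk) (Nat.pow_pos (zero_lt_one.trans Fact.out))
  rw [natDigit, Nat.mod_eq_of_lt leading_lt, Ne, ZMod.natCast_eq_zero_iff]
  exact Nat.not_dvd_of_pos_of_lt leading_pos leading_lt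

lemma exists_natDigit_ne_zero {M k : ℕ} (hk : k < b ^ M) (hk0 : k ≠ 0) :
    ∃ a < M, natDigit b k a ≠ 0 :=
  ⟨Nat.log b k, Nat.log_lt_of_lt_pow hk0 hk, natDigit_log_ne_zero hk0⟩

lemma sum_zmod_eq_sum_fin {β : Type*} [AddCommMonoid β] (h : ZMod b → β) :
    ∑ t, h t = ∑ c : Fin b, h (c : ℕ) :=
  Fintype.sum_equiv (e := (⟨fun t => ⟨t.val, t.val_lt⟩, fun c => (c : ℕ), ZMod.natCast_zmod_val,
    fun c => Fin.ext (ZMod.val_natCast_of_lt c.2)⟩ : ZMod b ≃ Fin b)) _ _ fun t => by simp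

lemma sum_prod_natDigit {β : Type*} [CommSemiring β] (M : ℕ) (f : Fin M → ZMod b → β) :
    ∑ n ∈ Finset.range (b ^ M), ∏ a : Fin M, f a (natDigit b n a) = ∏ a, ∑ t, f a t := by
  have natDigit_finFunctionFinEquiv : ∀ (g : Fin M → Fin b) (a : Fin M),
      natDigit b (finFunctionFinEquiv g : Fin (b ^ M)) a = ((g a : ℕ) : ZMod b) := fun g a => by
    conv_rhs => rw [← finFunctionFinEquiv.symm_apply_apply g]
    rfl
  rw [Finset.sum_range, ← Equiv.sum_comp finFunctionFinEquiv]
  simp only [natDigit_finFunctionFinEquiv, sum_zmod_eq_sum_fin]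
  rw [Finset.prod_univ_sum, Fintype.piFinset_univ]

lemma sum_prod_stdAddChar_natDigit (M : ℕ) (d : ℕ → ZMod b) :
    ∑ n ∈ Finset.range (b ^ M), ∏ a : Fin M, (ZMod.stdAddChar (natDigit b n a * d a) : ℂ) =
      ∏ a : Fin M, if d a = 0 then (b : ℂ) else 0 := by
  rw [sum_prod_natDigit M fun a t => (ZMod.stdAddChar (t * d a) : ℂ)]
  refine Finset.prod_congr rfl fun a _ => ?_
  rw [AddChar.sum_mulShift _ (ZMod.isPrimitive_stdAddChar b), ZMod.card, Nat.cast_ite,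
    Nat.cast_zero]

lemma floor_eq_of_digits_eq {x y : ℝ} (hx : x ∈ Set.Ico (0 : ℝ) 1) (hy : y ∈ Set.Ico (0 : ℝ) 1)
    {N : ℕ} (h : ∀ n < N, (⌊y * (b : ℝ) ^ (n + 1)⌋ : ZMod b) = (⌊x * (b : ℝ) ^ (n + 1)⌋ : ZMod b)) :
    ⌊y * (b : ℝ) ^ N⌋ = ⌊x * (b : ℝ) ^ N⌋ := by
  induction N with
  | zero =>
    rw [pow_zero, mul_one, mul_one, Int.floor_eq_zero_iff.2 hx, Int.floor_eq_zero_iff.2 hy]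
  | succ N ih =>
    have div_eq := ih fun n hn => h n (hn.trans N.lt_succ_self)
    rw [← floor_mul_pow_div y, ← floor_mul_pow_div x] at div_eq
    have mod_eq := (ZMod.intCast_eq_intCast_iff' _ _ _).1 (h N N.lt_succ_self)
    rw [← Int.mul_ediv_add_emod ⌊y * (b : ℝ) ^ (N + 1)⌋ b, div_eq, mod_eq, Int.mul_ediv_add_emod]

lemma abs_sub_le_of_floor_eq {x y : ℝ} {N : ℕ} (h : ⌊y * (b : ℝ) ^ N⌋ = ⌊x * (b : ℝ) ^ N⌋) :
    |y - x| ≤ ((b : ℝ) ^ N)⁻¹ := by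
  have pow_pos : 0 < (b : ℝ) ^ N := pow_pos (base_pos b) N
  have abs_lt_one := Int.abs_sub_lt_one_of_floor_eq_floor h
  rw [← sub_mul, abs_mul, abs_of_pos pow_pos] at abs_lt_one
  rw [← one_div, le_div_iff₀ pow_pos]
  exact abs_lt_one.le

variable {α : ℕ} [NeZero α]

/-- The base `b` digits of the number whose digit sequence interlaces those of the `j`-th block of
`α` components of `l`. -/
def interlacedDigits (b : ℕ) (l : Fin (s * α) → ℕ) (j : Fin s) : ℕ → ZMod b :=
  interlaceSeq fun i => natDigit b (l (finProdFinEquiv (j, i)))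

/-- The Walsh function on the cube whose indices interlace the first `M` digits of `l`. -/
noncomputable def interlacedWalsh (M : ℕ) (l : Fin (s * α) → ℕ) (x : Fin s → ℝ) : ℂ :=
  ∏ j, walsh (M * α) (interlacedDigits b l j) (x j)

/-- All vectors of numbers with at most `M` digits. -/
def digitBox (b M d : ℕ) : Finset (Fin d → ℕ) := Fintype.piFinset fun _ => Finset.range (b ^ M)

lemma zero_mem_digitBox (M d : ℕ) : (0 : Fin d → ℕ) ∈ digitBox b M d :=
  Fintype.mem_piFinset.2 fun _ =>
    Finset.mem_range.2 (Nat.pow_pos (zero_lt_one.trans Fact.out))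

lemma interlacedWalsh_eq_prod (M : ℕ) (l : Fin (s * α) → ℕ) (x : Fin s → ℝ) :
    interlacedWalsh (b := b) M l x = ∏ p : Fin (s * α), ∏ a : Fin M,
      ZMod.stdAddChar (natDigit b (l p) a * deinterlacedDigit b x p a) := by
  rw [interlacedWalsh, ← Equiv.prod_comp finProdFinEquiv, Fintype.prod_prod_type]
  refine Finset.prod_congr rfl fun j _ => ?_
  rw [walsh, prod_range_interlace]
  refine Finset.prod_congr rfl fun i _ => Finset.prod_congr rfl fun a _ => ?_
  rw [interlacedDigits, interlaceSeq_add_mul, deinterlacedDigit_finProdFinEquiv]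

lemma norm_interlacedWalsh (M : ℕ) (l : Fin (s * α) → ℕ) (x : Fin s → ℝ) :
    ‖interlacedWalsh (b := b) M l x‖ = 1 := by
  simp [interlacedWalsh, norm_walsh]

lemma interlacedWalsh_zero (M : ℕ) (x : Fin s → ℝ) :
    interlacedWalsh (b := b) M (0 : Fin (s * α) → ℕ) x = 1 :=
  Finset.prod_eq_one fun _ _ => walsh_of_eq_zero (fun _ _ => by
    simp [interlacedDigits, interlaceSeq, natDigit]) _

lemma integrable_interlacedWalsh (M : ℕ) (l : Fin (s * α) → ℕ) :
    IntegrableOn (interlacedWalsh (b := b) M l) (cube s) :=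
  (integrable_const (1 : ℂ)).mono
    (measurable_prod_apply fun _ => measurable_walsh _ _).aestronglyMeasurable
    (.of_forall fun y => by rw [norm_interlacedWalsh, norm_one])

lemma exists_interlacedDigits_ne_zero {M : ℕ} {l : Fin (s * α) → ℕ}
    (hl : l ∈ digitBox b M (s * α)) {p : Fin (s * α)} (hp : l p ≠ 0) :
    ∃ n < M * α, interlacedDigits b l p.divNat n ≠ 0 := by
  obtain ⟨a, haM, ha⟩ :=
    exists_natDigit_ne_zero (Finset.mem_range.1 (Fintype.mem_piFinset.1 hl p)) hp
  refine ⟨p.modNat + α * a, (finProdFinEquiv (⟨a, haM⟩, p.modNat) : Fin (M * α)).2, ?_⟩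
  rwa [interlacedDigits, interlaceSeq_add_mul,
    show finProdFinEquiv (p.divNat, p.modNat) = p from finProdFinEquiv.apply_symm_apply p]

lemma integral_interlacedWalsh {M : ℕ} {l : Fin (s * α) → ℕ} (hl : l ∈ digitBox b M (s * α)) :
    ∫ y in cube s, interlacedWalsh (b := b) M l y = if l = 0 then 1 else 0 := by
  split_ifs with hl0
  · simp [hl0, interlacedWalsh_zero]
  · obtain ⟨p, hp⟩ : ∃ p, l p ≠ 0 := Function.ne_iff.1 hl0
    simp only [interlacedWalsh, restrict_cube]
    rw [integral_fintype_prod_eq_prod fun j t => walsh (M * α) (interlacedDigits b l j) t]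
    refine Finset.prod_eq_zero (Finset.mem_univ p.divNat) ?_
    rw [integral_Icc_eq_integral_Ioc, ← intervalIntegral.integral_of_le zero_le_one]
    exact integral_walsh (exists_interlacedDigits_ne_zero hl hp)

/-- The half-open unit cube `[0,1)^s`. -/
def halfOpenCube (s : ℕ) : Set (Fin s → ℝ) := Set.univ.pi fun _ => Set.Ico (0 : ℝ) 1

lemma halfOpenCube_subset_cube : halfOpenCube s ⊆ cube s := by
  rw [cube_eq_pi]
  exact Set.pi_mono fun _ _ => Set.Ico_subset_Icc_self

lemma ae_mem_halfOpenCube : ∀ᵐ y ∂volume.restrict (cube s), y ∈ halfOpenCube s := by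
  rw [restrict_cube]
  have ae_mem_Ico : ∀ᵐ t ∂volume.restrict (Set.Icc (0 : ℝ) 1), t ∈ Set.Ico (0 : ℝ) 1 := by
    rw [← restrict_Ico_eq_restrict_Icc]
    exact ae_restrict_mem measurableSet_Ico
  have ae_coordinates := Filter.eventually_all.2 fun i : Fin s =>
    (Measure.tendsto_eval_ae_ae (i := i)
      (μ := fun _ : Fin s => volume.restrict (Set.Icc (0 : ℝ) 1))).eventually ae_mem_Ico
  filter_upwards [ae_coordinates] with y hy i _ using hy i

/-- The Dirichlet kernel of the Walsh system. -/
noncomputable def walshKernel (b M α : ℕ) [Fact (1 < b)] [NeZero α] (x y : Fin s → ℝ) : ℂ :=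
  ∑ l ∈ digitBox b M (s * α),
    interlacedWalsh (b := b) M l y * starRingEnd ℂ (interlacedWalsh (b := b) M l x)

lemma walshKernel_eq_prod (M : ℕ) (x y : Fin s → ℝ) :
    walshKernel b M α x y = ∏ p : Fin (s * α), ∏ a : Fin M,
      if deinterlacedDigit b y p a - deinterlacedDigit b x p a = 0 then (b : ℂ) else 0 := by
  calc walshKernel b M α x y = ∑ l ∈ digitBox b M (s * α), ∏ p, ∏ a : Fin M, ZMod.stdAddChar
        (natDigit b (l p) a * (deinterlacedDigit b y p a - deinterlacedDigit b x p a)) := by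
        refine Finset.sum_congr rfl fun l _ => ?_
        simp only [interlacedWalsh_eq_prod, map_prod, ← Finset.prod_mul_distrib,
          ← AddChar.map_neg_eq_conj, ← AddChar.map_add_eq_mul, ← mul_neg, ← mul_add,
          ← sub_eq_add_neg]
    _ = _ := by
        rw [digitBox, ← Finset.prod_univ_sum (fun _ => Finset.range (b ^ M)) fun p n =>
          ∏ a : Fin M, (ZMod.stdAddChar
            (natDigit b n a * (deinterlacedDigit b y p a - deinterlacedDigit b x p a)) : ℂ)]
        exact Finset.prod_congr rfl fun p _ => sum_prod_stdAddChar_natDigit M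
          fun a => deinterlacedDigit b y p a - deinterlacedDigit b x p a

lemma dist_le_of_walshKernel_ne_zero {M : ℕ} {x y : Fin s → ℝ} (hx : x ∈ halfOpenCube s)
    (hy : y ∈ halfOpenCube s) (h : walshKernel b M α x y ≠ 0) :
    dist y x ≤ ((b : ℝ) ^ (M * α))⁻¹ := by
  rw [walshKernel_eq_prod, Finset.prod_ne_zero_iff] at h
  refine (dist_pi_le_iff (by positivity)).2 fun j => ?_
  refine abs_sub_le_of_floor_eq (floor_eq_of_digits_eq (hx j trivial) (hy j trivial) fun n hn => ?_)
  have factor_ne_zero := Finset.prod_ne_zero_iff.1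
    (h (finProdFinEquiv (j, ⟨n % α, Nat.mod_lt _ (NeZero.pos α)⟩)) (Finset.mem_univ _))
    ⟨n / α, (Nat.div_lt_iff_lt_mul (NeZero.pos α)).2 hn⟩ (Finset.mem_univ _)
  have digit_eq := sub_eq_zero.1 (ite_ne_right_iff.1 factor_ne_zero).1
  rwa [deinterlacedDigit_finProdFinEquiv, deinterlacedDigit_finProdFinEquiv,
    Nat.mod_add_div] at digit_eq

lemma ofReal_norm_walshKernel (M : ℕ) (x y : Fin s → ℝ) :
    (‖walshKernel b M α x y‖ : ℂ) = walshKernel b M α x y := by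
  simp only [walshKernel_eq_prod, norm_prod, apply_ite norm, Complex.norm_natCast, norm_zero,
    Complex.ofReal_prod, apply_ite Complex.ofReal, Complex.ofReal_natCast, Complex.ofReal_zero]

lemma integrable_walshKernel (M : ℕ) (x : Fin s → ℝ) :
    IntegrableOn (walshKernel b M α x) (cube s) :=
  integrable_finsetSum _ fun l _ => (integrable_interlacedWalsh M l).mul_const _

lemma integral_walshKernel (M : ℕ) (x : Fin s → ℝ) :
    ∫ y in cube s, walshKernel b M α x y = 1 := by
  simp only [walshKernel]
  rw [integral_finsetSum _ fun l _ => (integrable_interlacedWalsh M l).mul_const _]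
  simp_rw [integral_mul_const]
  rw [Finset.sum_eq_single_of_mem 0 (zero_mem_digitBox M _)]
  · simp [interlacedWalsh_zero]
  · intro l hl hl0
    rw [integral_interlacedWalsh hl, if_neg hl0, zero_mul]

lemma integral_norm_walshKernel (M : ℕ) (x : Fin s → ℝ) :
    ∫ y in cube s, ‖walshKernel b M α x y‖ = 1 := by
  rw [← Complex.ofReal_inj, ← integral_complex_ofReal]
  simp only [ofReal_norm_walshKernel, integral_walshKernel, Complex.ofReal_one]

/-- The partial sum at `x` of the Walsh series of `F`, over the indices with at most `M` digits. -/
noncomputable def walshPartialSum (b M α : ℕ) [Fact (1 < b)] [NeZero α] (F : (Fin s → ℝ) → ℝ)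
    (x : Fin s → ℝ) : ℂ :=
  ∑ l ∈ digitBox b M (s * α), pairing F (fun j => walsh (M * α) (interlacedDigits b l j)) *
    starRingEnd ℂ (interlacedWalsh (b := b) M l x)

variable {F : (Fin s → ℝ) → ℝ}

lemma integrable_mul_interlacedWalsh (hF : IntegrableOn F (cube s)) (M : ℕ)
    (l : Fin (s * α) → ℕ) :
    IntegrableOn (fun y => (F y : ℂ) * interlacedWalsh (b := b) M l y) (cube s) :=
  integrableOn_pairing hF fun _ => ⟨measurable_walsh _ _, 1, fun _ _ => (norm_walsh _ _ _).le⟩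

lemma mul_walshKernel (M : ℕ) (x y : Fin s → ℝ) :
    (F y : ℂ) * walshKernel b M α x y = ∑ l ∈ digitBox b M (s * α),
      (F y : ℂ) * interlacedWalsh (b := b) M l y *
        starRingEnd ℂ (interlacedWalsh (b := b) M l x) := by
  simp only [walshKernel, Finset.mul_sum, mul_assoc]

lemma integrable_mul_walshKernel (hF : IntegrableOn F (cube s)) (M : ℕ) (x : Fin s → ℝ) :
    IntegrableOn (fun y => (F y : ℂ) * walshKernel b M α x y) (cube s) := by
  simp only [mul_walshKernel]
  exact integrable_finsetSum _ fun l _ => (integrable_mul_interlacedWalsh hF M l).mul_const _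

lemma walshPartialSum_eq_integral (hF : IntegrableOn F (cube s)) (M : ℕ) (x : Fin s → ℝ) :
    walshPartialSum b M α F x = ∫ y in cube s, (F y : ℂ) * walshKernel b M α x y := by
  simp only [mul_walshKernel]
  rw [integral_finsetSum _ fun l _ => (integrable_mul_interlacedWalsh hF M l).mul_const _]
  simp only [integral_mul_const]
  rfl

lemma norm_walshPartialSum_sub_le (hF : IntegrableOn F (cube s)) {M : ℕ} {ε : ℝ}
    {x : Fin s → ℝ} (hx : x ∈ halfOpenCube s)
    (hε : ∀ y ∈ halfOpenCube s, dist y x ≤ ((b : ℝ) ^ (M * α))⁻¹ → |F y - F x| ≤ ε) :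
    ‖walshPartialSum b M α F x - F x‖ ≤ ε := by
  have kernel_integrable := integrable_walshKernel (b := b) (α := α) M x
  calc ‖walshPartialSum b M α F x - F x‖
      = ‖∫ y in cube s, ((F y - F x : ℝ) : ℂ) * walshKernel b M α x y‖ := by
        simp only [Complex.ofReal_sub, sub_mul]
        rw [integral_sub (integrable_mul_walshKernel hF M x) (kernel_integrable.const_mul _),
          integral_const_mul, integral_walshKernel, mul_one, walshPartialSum_eq_integral hF]
    _ ≤ ∫ y in cube s, ε * ‖walshKernel b M α x y‖ := by
        refine norm_integral_le_of_norm_le (kernel_integrable.norm.const_mul ε) ?_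
        filter_upwards [ae_mem_halfOpenCube] with y hy
        rw [norm_mul, Complex.norm_real]
        by_cases h0 : walshKernel b M α x y = 0
        · simp [h0]
        · exact mul_le_mul_of_nonneg_right (hε y hy (dist_le_of_walshKernel_ne_zero hx hy h0))
            (norm_nonneg _)
    _ = ε := by rw [integral_const_mul, integral_norm_walshKernel, mul_one]

theorem tendstoUniformlyOn_walshPartialSum (hF : ContinuousOn F (cube s)) :
    TendstoUniformlyOn (fun M => walshPartialSum b M α F) (fun x => (F x : ℂ)) Filter.atTop
      (halfOpenCube s) := by
  refine Metric.tendstoUniformlyOn_iff.2 fun ε hε => ?_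
  obtain ⟨δ, hδ, uniform⟩ := Metric.uniformContinuousOn_iff_le.1
    (isCompact_Icc.uniformContinuousOn_of_continuous hF) (ε / 2) (half_pos hε)
  have mesh_tendsto : Filter.Tendsto (fun M : ℕ => ((b : ℝ) ^ (M * α))⁻¹) Filter.atTop (nhds 0) :=
    ((tendsto_pow_atTop_atTop_of_one_lt (one_lt_base b)).comp
      (Filter.tendsto_id.atTop_mul_const' (NeZero.pos α))).inv_tendsto_atTop
  filter_upwards [mesh_tendsto.eventually_le_const hδ] with M hM x hx
  rw [dist_comm, dist_eq_norm]
  refine (norm_walshPartialSum_sub_le (hF.integrableOn_compact isCompact_Icc) hx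
    fun y hy hyx => ?_).trans_lt (half_lt_self hε)
  exact uniform y (halfOpenCube_subset_cube hy) x (halfOpenCube_subset_cube hx) (hyx.trans hM)

end WalshSeries

section CharacterSums

/-! ### Character sums over the point set -/

section DigitSum

variable {b : ℕ}

/-- The number `0.c₀c₁…c_{N-1}` in base `b`. -/
noncomputable def digitSum (b N : ℕ) (c : ℕ → ZMod b) : ℝ :=
  ∑ i ∈ Finset.range N, ((c i).val : ℝ) / (b : ℝ) ^ (i + 1)

lemma natCast_digit {x : ℝ} (hx : 0 ≤ x) (a : ℕ) :
    (digit b x a : ZMod b) = (⌊x * (b : ℝ) ^ a⌋ : ZMod b) := by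
  rw [digit, ZMod.natCast_mod, mul_comm, ← Int.natCast_floor_eq_floor (by positivity),
    Int.cast_natCast]

/-- The digits of `vmap b m L`, continued by zeros. -/
def vmapDigit (b m : ℕ) (L : LaurentSeries (ZMod b)) (a : ℕ) : ZMod b :=
  if a < m then L.coeff ((a + 1 : ℕ) : ℤ) else 0

lemma vmapDigit_of_lt {m a : ℕ} (ha : a < m) (L : LaurentSeries (ZMod b)) :
    vmapDigit b m L a = L.coeff ((a + 1 : ℕ) : ℤ) :=
  if_pos ha

lemma vmapDigit_of_le {m a : ℕ} (ha : m ≤ a) (L : LaurentSeries (ZMod b)) :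
    vmapDigit b m L a = 0 :=
  if_neg ha.not_gt

lemma digitSum_succ (N : ℕ) (c : ℕ → ZMod b) :
    digitSum b (N + 1) c = ((c 0).val + digitSum b N fun i => c (i + 1)) / b := by
  rw [digitSum, Finset.sum_range_succ', add_div, digitSum, Finset.sum_div, add_comm, zero_add,
    pow_one]
  exact congrArg _ (Finset.sum_congr rfl fun i _ => by rw [pow_succ _ (i + 1), div_div])

lemma vmap_eq_digitSum (m : ℕ) (L : LaurentSeries (ZMod b)) :
    vmap b m L = digitSum b m (vmapDigit b m L) := by
  rw [vmap, ← Finset.Ico_add_one_right_eq_Icc, Finset.sum_Ico_eq_sum_range, Nat.add_sub_cancel,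
    digitSum]
  exact Finset.sum_congr rfl fun i hi => by
    rw [vmapDigit_of_lt (Finset.mem_range.1 hi), add_comm 1 i]

variable [Fact (1 < b)]

lemma digitSum_mem_Ico (N : ℕ) (c : ℕ → ZMod b) : digitSum b N c ∈ Set.Ico (0 : ℝ) 1 := by
  induction N generalizing c with
  | zero => simp [digitSum]
  | succ N ih =>
    obtain ⟨tail_nonneg, tail_lt⟩ := ih fun i => c (i + 1)
    have leading_le : ((c 0).val : ℝ) + 1 ≤ b := by exact_mod_cast (c 0).val_lt
    rw [digitSum_succ, Set.mem_Ico, div_lt_one (base_pos b)]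
    exact ⟨by positivity, by linarith⟩

lemma floor_digitSum {N : ℕ} {c : ℕ → ZMod b} (hc : ∀ i ≥ N, c i = 0) (n : ℕ) :
    (⌊digitSum b N c * (b : ℝ) ^ (n + 1)⌋ : ZMod b) = c n := by
  induction n generalizing N c with
  | zero | succ n ih =>
    cases N with
    | zero => simp [digitSum, hc]
    | succ N =>
      have shift : ∀ n, digitSum b (N + 1) c * (b : ℝ) ^ (n + 1) =
          digitSum b N (fun i => c (i + 1)) * (b : ℝ) ^ n + ((c 0).val * b ^ n : ℕ) := fun n => by
        have base_ne_zero := (base_pos b).ne'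
        rw [digitSum_succ]
        push_cast
        field_simp
        ring
      rw [shift, Int.floor_add_natCast, Int.cast_add]
      first
      | rw [ih fun i hi => hc (i + 1) (by omega)]
        simp
      | rw [pow_zero, mul_one, Int.floor_eq_zero_iff.2 (digitSum_mem_Ico N _)]
        simp

lemma digit_digitSum {N : ℕ} {c : ℕ → ZMod b} (hc : ∀ i ≥ N, c i = 0) (n : ℕ) :
    digit b (digitSum b N c) (n + 1) = (c n).val := by
  rw [← floor_digitSum hc n, ← natCast_digit (digitSum_mem_Ico N c).1, ZMod.val_natCast_of_lt]
  exact Nat.mod_lt _ (zero_lt_one.trans Fact.out)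

lemma digit_vmap (m : ℕ) (L : LaurentSeries (ZMod b)) (a : ℕ) :
    digit b (vmap b m L) (a + 1) = (vmapDigit b m L a).val := by
  rw [vmap_eq_digitSum, digit_digitSum fun i hi => vmapDigit_of_le hi L]

variable {α : ℕ} [NeZero α]

lemma interlace_vmap (m : ℕ) (L : Fin α → LaurentSeries (ZMod b)) :
    interlace b α (fun i => vmap b m (L i)) =
      digitSum b (m * α) (interlaceSeq fun i => vmapDigit b m (L i)) := by
  simp only [interlace, digit_vmap]
  rw [digitSum, sum_range_interlace, Finset.sum_comm, tsum_eq_sum (s := Finset.range m),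
    Finset.sum_range]
  · refine Finset.sum_congr rfl fun a _ => Finset.sum_congr rfl fun i _ => ?_
    rw [interlaceSeq_add_mul, add_right_comm, mul_comm α]
  · intro a ha
    simp [vmapDigit_of_le (not_lt.1 (Finset.mem_range.not.1 ha))]

lemma interlace_vmap_mem_Ico (m : ℕ) (L : Fin α → LaurentSeries (ZMod b)) :
    interlace b α (fun i => vmap b m (L i)) ∈ Set.Ico (0 : ℝ) 1 := by
  rw [interlace_vmap]
  exact digitSum_mem_Ico _ _

lemma floor_interlace_vmap (m : ℕ) (L : Fin α → LaurentSeries (ZMod b)) (i : Fin α) (a : ℕ) :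
    (⌊interlace b α (fun i => vmap b m (L i)) * (b : ℝ) ^ ((i : ℕ) + α * a + 1)⌋ : ZMod b) =
      vmapDigit b m (L i) a := by
  rw [interlace_vmap, floor_digitSum fun n hn => ?_, interlaceSeq_add_mul]
  exact vmapDigit_of_le ((Nat.le_div_iff_mul_le (NeZero.pos α)).2 hn) _

end DigitSum

section LaurentSeries

variable {b : ℕ}

lemma toLaurentInv_mul (p q : (ZMod b)[X]) :
    toLaurentInv b (p * q) = toLaurentInv b p * toLaurentInv b q :=
  eval₂_mul _ _

lemma toLaurentInv_add (p q : (ZMod b)[X]) :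
    toLaurentInv b (p + q) = toLaurentInv b p + toLaurentInv b q :=
  eval₂_add _ _

lemma toLaurentInv_sum {ι : Type*} (t : Finset ι) (f : ι → (ZMod b)[X]) :
    toLaurentInv b (∑ i ∈ t, f i) = ∑ i ∈ t, toLaurentInv b (f i) :=
  eval₂_finsetSum _ _ _ _

lemma toLaurentInv_C_mul_X_pow (c : ZMod b) (a : ℕ) :
    toLaurentInv b (C c * X ^ a) = HahnSeries.single (-(a : ℤ)) c := by
  rw [toLaurentInv, eval₂_mul, eval₂_C, eval₂_pow, eval₂_X, HahnSeries.single_pow, one_pow,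
    HahnSeries.C_apply, HahnSeries.single_mul_single]
  simp

lemma coeff_toLaurentInv_eq_sum (p : (ZMod b)[X]) (n : ℤ) :
    (toLaurentInv b p).coeff n =
      ∑ i ∈ Finset.range (p.natDegree + 1), if n = -(i : ℤ) then p.coeff i else 0 := by
  conv_lhs => rw [p.as_sum_range_C_mul_X_pow, toLaurentInv_sum, HahnSeries.coeff_sum]
  refine Finset.sum_congr rfl fun i _ => ?_
  rw [toLaurentInv_C_mul_X_pow, HahnSeries.coeff_single]
  congr

lemma coeff_toLaurentInv_neg (p : (ZMod b)[X]) (n : ℕ) :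
    (toLaurentInv b p).coeff (-(n : ℤ)) = p.coeff n := by
  simp only [coeff_toLaurentInv_eq_sum, neg_inj, Nat.cast_inj, Finset.sum_ite_eq, Finset.mem_range,
    ite_eq_left_iff, not_lt]
  exact fun hn => (coeff_eq_zero_of_natDegree_lt hn).symm

lemma coeff_toLaurentInv_of_pos (p : (ZMod b)[X]) {n : ℤ} (hn : 0 < n) :
    (toLaurentInv b p).coeff n = 0 := by
  rw [coeff_toLaurentInv_eq_sum]
  exact Finset.sum_eq_zero fun i _ => if_neg (by omega)

lemma coeff_toLaurentInv_of_lt (p : (ZMod b)[X]) {n : ℤ} (hn : n < -(p.natDegree : ℤ)) :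
    (toLaurentInv b p).coeff n = 0 := by
  rw [coeff_toLaurentInv_eq_sum]
  exact Finset.sum_eq_zero fun i hi => if_neg (by have := Finset.mem_range.1 hi; omega)

lemma toLaurentInv_ne_zero {p : (ZMod b)[X]} (hp : p ≠ 0) : toLaurentInv b p ≠ 0 := fun h => by
  have leading_coeff := coeff_toLaurentInv_neg p p.natDegree
  rw [h, HahnSeries.coeff_zero, coeff_natDegree] at leading_coeff
  exact hp (leadingCoeff_eq_zero.1 leading_coeff.symm)

lemma order_toLaurentInv {p : (ZMod b)[X]} (hp : p ≠ 0) :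
    (toLaurentInv b p).order = -(p.natDegree : ℤ) := by
  refine le_antisymm (HahnSeries.order_le_of_coeff_ne_zero ?_) (not_lt.1 fun h => ?_)
  · rw [coeff_toLaurentInv_neg, coeff_natDegree]
    exact leadingCoeff_ne_zero.2 hp
  · exact HahnSeries.coeff_order_eq_zero.not.2 (toLaurentInv_ne_zero hp)
      (coeff_toLaurentInv_of_lt p h)

lemma coeff_one_truncPoly_mul (m k : ℕ) (L : LaurentSeries (ZMod b)) :
    (toLaurentInv b (truncPoly b m k) * L).coeff 1 =
      ∑ a ∈ Finset.range m, natDigit b k a * L.coeff ((a + 1 : ℕ) : ℤ) := by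
  rw [truncPoly, toLaurentInv_sum, Finset.sum_mul, HahnSeries.coeff_sum]
  refine Finset.sum_congr rfl fun a _ => ?_
  rw [toLaurentInv_C_mul_X_pow, HahnSeries.coeff_single_mul, sub_neg_eq_add, Nat.cast_succ,
    add_comm (1 : ℤ)]
  rfl

end LaurentSeries

variable {b : ℕ} [Fact b.Prime]

/-- Modulo polynomials, `Q / P` is `R / P` with `R = Q % P`, whose leading exponent
`natDegree P - natDegree R` would be among the vanishing ones if `R` were not zero. -/
lemma dvd_of_coeff_eq_zero {P Q : (ZMod b)[X]} (hP : P ≠ 0)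
    (h : ∀ a < P.natDegree, (toLaurentInv b Q / toLaurentInv b P).coeff ((a + 1 : ℕ) : ℤ) = 0) :
    P ∣ Q := by
  by_contra not_dvd
  have remainder_ne_zero : Q % P ≠ 0 := fun h0 => not_dvd (EuclideanDomain.mod_eq_zero.1 h0)
  have modulus_ne_zero := toLaurentInv_ne_zero hP
  obtain ⟨H, hH⟩ : ∃ H, H * toLaurentInv b P = toLaurentInv b (Q % P) :=
    ⟨_, div_mul_cancel₀ _ modulus_ne_zero⟩
  have H_ne_zero : H ≠ 0 := fun h0 => toLaurentInv_ne_zero remainder_ne_zero (by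
    rw [← hH, h0, zero_mul])
  have order_eq := congrArg HahnSeries.order hH
  rw [HahnSeries.order_mul H_ne_zero modulus_ne_zero, order_toLaurentInv hP,
    order_toLaurentInv remainder_ne_zero] at order_eq
  have natDegree_lt : (Q % P).natDegree < P.natDegree :=
    natDegree_lt_natDegree remainder_ne_zero (degree_mod_lt Q hP)
  have div_eq : toLaurentInv b Q / toLaurentInv b P = toLaurentInv b (Q / P) + H := by
    rw [div_eq_iff modulus_ne_zero, add_mul, hH, ← toLaurentInv_mul, ← toLaurentInv_add,
      mul_comm, EuclideanDomain.div_add_mod]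
  have coeff_eq_zero := h (P.natDegree - (Q % P).natDegree - 1) (by omega)
  rw [div_eq, HahnSeries.coeff_add, coeff_toLaurentInv_of_pos _ (by omega), zero_add,
    show ((P.natDegree - (Q % P).natDegree - 1 + 1 : ℕ) : ℤ) = H.order by omega] at coeff_eq_zero
  exact HahnSeries.coeff_order_eq_zero.not.2 H_ne_zero coeff_eq_zero

lemma forall_vmapDigit_eq_zero_iff_dvd {m : ℕ} {P : (ZMod b)[X]} (hP : P ≠ 0)
    (hPm : P.natDegree = m) (Q : (ZMod b)[X]) :
    (∀ a : Fin m, vmapDigit b m (toLaurentInv b Q / toLaurentInv b P) a = 0) ↔ P ∣ Q := by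
  refine ⟨fun h => dvd_of_coeff_eq_zero hP fun a ha => ?_, ?_⟩
  · rw [hPm] at ha
    rw [← vmapDigit_of_lt ha]
    exact h ⟨a, ha⟩
  · rintro ⟨A, rfl⟩ a
    rw [toLaurentInv_mul, mul_div_cancel_left₀ _ (toLaurentInv_ne_zero hP), vmapDigit_of_lt a.2]
    exact coeff_toLaurentInv_of_pos _ (by omega)

lemma stdAddChar_sum {ι : Type*} (t : Finset ι) (f : ι → ZMod b) :
    (ZMod.stdAddChar (∑ i ∈ t, f i) : ℂ) = ∏ i ∈ t, ZMod.stdAddChar (f i) :=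
  map_prod (ZMod.stdAddChar (N := b)).toMonoidHom (fun i => Multiplicative.ofAdd (f i)) t

lemma prod_stdAddChar_vmapDigit {m M : ℕ} (hM : m ≤ M) (k : ℕ) (L : LaurentSeries (ZMod b)) :
    ∏ a : Fin M, (ZMod.stdAddChar (natDigit b k a * vmapDigit b m L a) : ℂ) =
      ZMod.stdAddChar ((toLaurentInv b (truncPoly b m k) * L).coeff 1) := by
  rw [coeff_one_truncPoly_mul, stdAddChar_sum, ← Finset.prod_range fun a =>
    (ZMod.stdAddChar (natDigit b k a * vmapDigit b m L a) : ℂ)]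
  refine (Finset.prod_subset_one_on_sdiff (Finset.range_subset_range.2 hM) (fun a ha => ?_)
    fun a ha => ?_).symm
  · rw [vmapDigit_of_le (not_lt.1 (Finset.mem_range.not.1 (Finset.mem_sdiff.1 ha).2)), mul_zero,
      AddChar.map_zero_eq_one]
  · rw [vmapDigit_of_lt (Finset.mem_range.1 ha)]

variable {s α : ℕ} [NeZero α] (m : ℕ) (P : (ZMod b)[X]) (g : Fin (s * α) → (ZMod b)[X])

lemma interlacedPoint_mem_halfOpenCube (n : ℕ) :
    interlacedPoint b m α P g n ∈ halfOpenCube s :=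
  fun _ _ => interlace_vmap_mem_Ico (b := b) m _

lemma deinterlacedDigit_interlacedPoint (n : ℕ) (p : Fin (s * α)) (a : ℕ) :
    deinterlacedDigit b (interlacedPoint b m α P g n) p a = vmapDigit b m
      (toLaurentInv b (truncPoly b m n) * toLaurentInv b (g p) / toLaurentInv b P) a := by
  obtain ⟨⟨j, i⟩, rfl⟩ := finProdFinEquiv.surjective p
  rw [deinterlacedDigit_finProdFinEquiv]
  exact floor_interlace_vmap m (fun i => toLaurentInv b (truncPoly b m n) *
    toLaurentInv b (g (finProdFinEquiv (j, i))) / toLaurentInv b P) i a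

variable {m}

lemma interlacedWalsh_interlacedPoint {M : ℕ} (hM : m ≤ M) (l : Fin (s * α) → ℕ) (n : ℕ) :
    interlacedWalsh (b := b) M l (interlacedPoint b m α P g n) =
      ZMod.stdAddChar ((toLaurentInv b (truncPoly b m n) *
        (toLaurentInv b (∑ p, truncPoly b m (l p) * g p) / toLaurentInv b P)).coeff 1) := by
  simp only [interlacedWalsh_eq_prod, deinterlacedDigit_interlacedPoint,
    prod_stdAddChar_vmapDigit hM]
  rw [← stdAddChar_sum, ← HahnSeries.coeff_sum, toLaurentInv_sum, Finset.sum_div, Finset.mul_sum]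
  refine congrArg _ (congrArg₂ _ (Finset.sum_congr rfl fun p _ => ?_) rfl)
  rw [toLaurentInv_mul]
  ring

variable {P}

lemma sum_interlacedWalsh_interlacedPoint {M : ℕ} (hM : m ≤ M) (hP : P ≠ 0)
    (hPm : P.natDegree = m) (l : Fin (s * α) → ℕ)
    [Decidable (P ∣ ∑ p, truncPoly b m (l p) * g p)] :
    ∑ n ∈ Finset.range (b ^ m), interlacedWalsh (b := b) M l (interlacedPoint b m α P g n) =
      if P ∣ ∑ p, truncPoly b m (l p) * g p then (b : ℂ) ^ m else 0 := by
  simp only [interlacedWalsh_interlacedPoint P g hM, ← prod_stdAddChar_vmapDigit le_rfl]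
  rw [sum_prod_stdAddChar_natDigit, Finset.prod_ite_zero, Finset.prod_const, Finset.card_univ,
    Fintype.card_fin]
  simp only [Finset.mem_univ, true_imp_iff, forall_vmapDigit_eq_zero_iff_dvd hP hPm]

end CharacterSums

section WeightBound

/-! ### The constants in the decay of Walsh coefficients -/

section Mu1

variable {b : ℕ}

lemma mu1_zero : mu1 b 0 = 0 := by
  simp [mu1]

lemma truncPoly_zero (m : ℕ) : truncPoly b m 0 = 0 := by
  simp [truncPoly]

/-- The support of a vector of indices. -/
def indexSupport {d : ℕ} (l : Fin d → ℕ) : Finset (Fin d) := {p | l p ≠ 0}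

lemma mem_indexSupport {d : ℕ} {l : Fin d → ℕ} {p : Fin d} : p ∈ indexSupport l ↔ l p ≠ 0 := by
  simp [indexSupport]

lemma notMem_indexSupport {d : ℕ} {l : Fin d → ℕ} {p : Fin d} : p ∉ indexSupport l ↔ l p = 0 :=
  mem_indexSupport.not_left

lemma indexSupport_nonempty {d : ℕ} {l : Fin d → ℕ} (hl : l ≠ 0) : (indexSupport l).Nonempty :=
  (Function.ne_iff.1 hl).imp fun _ => mem_indexSupport.2

lemma mem_blocks_indexSupport {s α : ℕ} {l : Fin (s * α) → ℕ} {j : Fin s} :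
    j ∈ blocks (indexSupport l) ↔ ∃ i, l (finProdFinEquiv (j, i)) ≠ 0 := by
  simp only [blocks, Finset.mem_image, mem_indexSupport]
  refine ⟨?_, fun ⟨i, hi⟩ =>
    ⟨_, hi, congrArg Prod.fst (finProdFinEquiv.symm_apply_apply (j, i))⟩⟩
  rintro ⟨p, hp, rfl⟩
  exact ⟨p.modNat, by
    rwa [show finProdFinEquiv (p.divNat, p.modNat) = p from finProdFinEquiv.apply_symm_apply p]⟩

lemma sum_blocks_indexSupport_mu1 {s α : ℕ} (l : Fin (s * α) → ℕ) :
    ∑ j ∈ blocks (indexSupport l), ∑ i, mu1 b (l (finProdFinEquiv (j, i))) =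
      ∑ p, mu1 b (l p) := by
  rw [← Equiv.sum_comp finProdFinEquiv, Fintype.sum_prod_type]
  refine Finset.sum_subset (Finset.subset_univ _) fun j _ hj => Finset.sum_eq_zero fun i _ => ?_
  rw [not_not.1 fun h => hj (mem_blocks_indexSupport.2 ⟨i, h⟩), mu1_zero]

lemma sum_le_topDigitSum {κ : ℕ → ZMod b} {N n : ℕ} {T : Finset ℕ} (hT : T ⊆ Finset.range N)
    (hκ : ∀ t ∈ T, κ t ≠ 0) (hn : T.card ≤ n) : ∑ t ∈ T, (t + 1) ≤ topDigitSum κ N n := by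
  induction N generalizing n T with
  | zero =>
    rw [Finset.range_zero, Finset.subset_empty] at hT
    simp [hT]
  | succ N ih =>
    rcases T.eq_empty_or_nonempty with rfl | hne
    · simp
    have max_mem := T.max'_mem hne
    have max_le : T.max' hne ≤ N := Nat.le_of_lt_succ (Finset.mem_range.1 (hT max_mem))
    by_cases hκN : κ N = 0
    · rw [topDigitSum_succ_of_eq_zero hκN]
      have ne_top : ∀ t ∈ T, t ≠ N := fun t ht htN => hκ t ht (htN ▸ hκN)
      exact ih (fun t ht => Finset.mem_range.2 ((Nat.le_of_lt_succ
        (Finset.mem_range.1 (hT ht))).lt_of_ne (ne_top t ht))) hκ hn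
    · obtain ⟨n, rfl⟩ := Nat.exists_eq_add_one.2 (hne.card_pos.trans_le hn)
      rw [topDigitSum_succ_succ hκN, ← Finset.add_sum_erase T _ max_mem]
      refine Nat.add_le_add (Nat.succ_le_succ max_le) (ih (fun t ht => ?_)
        (fun t ht => hκ t (Finset.mem_of_mem_erase ht)) ?_)
      · exact Finset.mem_range.2 ((T.lt_max'_of_mem_erase_max' hne ht).trans_le max_le)
      · rw [Finset.card_erase_of_mem max_mem]
        omega

lemma sum_position_le_topDigitSum {α M : ℕ} [NeZero α] {c : Fin α → ℕ → ZMod b}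
    {I : Finset (Fin α)} {a : Fin α → ℕ} (ha : ∀ i ∈ I, a i < M) (hc : ∀ i ∈ I, c i (a i) ≠ 0) :
    ∑ i ∈ I, ((i : ℕ) + α * a i + 1) ≤ topDigitSum (interlaceSeq c) (M * α) α := by
  have position_mod : ∀ i : Fin α, ((i : ℕ) + α * a i) % α = i := fun i => by
    rw [Nat.add_mul_mod_self_left, Nat.mod_eq_of_lt i.2]
  have position_injOn : Set.InjOn (fun i : Fin α => (i : ℕ) + α * a i) I := fun i _ i' _ h =>
    Fin.ext (by rw [← position_mod i, ← position_mod i']; exact congrArg (· % α) h)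
  rw [← Finset.sum_image (f := fun t => t + 1) position_injOn]
  refine sum_le_topDigitSum (fun t ht => ?_) (fun t ht => ?_)
    (Finset.card_image_le.trans (I.card_le_univ.trans_eq (Fintype.card_fin α)))
  · obtain ⟨i, hi, rfl⟩ := Finset.mem_image.1 ht
    exact Finset.mem_range.2 (finProdFinEquiv (⟨a i, ha i hi⟩, i) : Fin (M * α)).2
  · obtain ⟨i, hi, rfl⟩ := Finset.mem_image.1 ht
    rw [interlaceSeq_add_mul]
    exact hc i hi

end Mu1

variable {b : ℕ} [Fact (1 < b)]

lemma mu1_of_ne_zero {k : ℕ} (hk : k ≠ 0) : mu1 b k = Nat.log b k + 1 :=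
  Nat.length_digits b k Fact.out hk

lemma mul_sum_mu1_le {α M : ℕ} [NeZero α] {k : Fin α → ℕ} (hk : ∀ i, k i < b ^ M) :
    α * ∑ i, mu1 b (k i) ≤
      topDigitSum (interlaceSeq fun i => natDigit b (k i)) (M * α) α + α * (α - 1) / 2 := by
  have term_eq : ∀ i : Fin α, k i ≠ 0 →
      α * mu1 b (k i) = ((i : ℕ) + α * Nat.log b (k i) + 1) + (α - 1 - i) := fun i hi => by
    rw [mu1_of_ne_zero hi, Nat.mul_succ]
    omega
  have sum_gap : ∑ i : Fin α, (α - 1 - (i : ℕ)) = α * (α - 1) / 2 := by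
    rw [← Finset.sum_range fun i => α - 1 - i, Finset.sum_range_reflect fun i => i,
      Finset.sum_range_id]
  calc α * ∑ i, mu1 b (k i) = ∑ i with k i ≠ 0, α * mu1 b (k i) := by
        rw [Finset.mul_sum]
        refine (Finset.sum_filter_of_ne fun i _ => mt fun hi => ?_).symm
        rw [hi, mu1_zero, mul_zero]
    _ = ∑ i with k i ≠ 0, ((i : ℕ) + α * Nat.log b (k i) + 1) +
          ∑ i with k i ≠ 0, (α - 1 - (i : ℕ)) := by
        rw [← Finset.sum_add_distrib]
        exact Finset.sum_congr rfl fun i hi => term_eq i (Finset.mem_filter.1 hi).2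
    _ ≤ _ := by
        refine Nat.add_le_add (sum_position_le_topDigitSum (fun i hi => ?_) fun i hi => ?_)
          ((Finset.sum_le_sum_of_subset (Finset.subset_univ _)).trans_eq sum_gap)
        · exact Nat.log_lt_of_lt_pow (Finset.mem_filter.1 hi).2 (hk i)
        · exact natDigit_log_ne_zero (Finset.mem_filter.1 hi).2

lemma pow_le_max_self_pow {x : ℝ} (hx : 0 ≤ x) {i n : ℕ} (hi : 1 ≤ i) (hin : i ≤ n) :
    x ^ i ≤ max x (x ^ n) := by
  rcases le_total x 1 with h | h
  · exact le_max_of_le_left (pow_le_of_le_one hx h (Nat.one_le_iff_ne_zero.1 hi))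
  · exact le_max_of_le_right (pow_le_pow_right₀ h hin)

variable {α : ℕ}

lemma inv_two_sin_pow_le_constC (hα : 1 < α) {i : ℕ} (hi : 1 ≤ i) (hiα : i ≤ α) :
    (2 * Real.sin (Real.pi / b))⁻¹ ^ i ≤ constC α b / 3 := by
  have base_sub_one_pos : 0 < (b : ℝ) - 1 := sub_pos.2 (one_lt_base b)
  have two_sin_pos : 0 < 2 * Real.sin (Real.pi / b) := mul_pos two_pos (sin_pi_div_pos b)
  rw [constC]
  set m := 2 * Real.sin (Real.pi / b)
  set S := ⨆ z : Finset.Icc 1 (α - 1), 1 / m ^ (z : ℕ)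
  have inv_le : m⁻¹ ≤ S := by
    have one_mem : 1 ∈ Finset.Icc 1 (α - 1) := Finset.mem_Icc.2 ⟨le_rfl, Nat.le_sub_one_of_lt hα⟩
    have le_sup := le_ciSup (f := fun z : Finset.Icc 1 (α - 1) => 1 / m ^ (z : ℕ))
      (Set.finite_range _).bddAbove ⟨1, one_mem⟩
    rwa [pow_one, one_div] at le_sup
  have inv_pow_le : m⁻¹ ^ α ≤ 2 / m ^ α := by
    rw [inv_pow, ← one_div]
    gcongr
    exact one_le_two
  have inv_pow_le_max : m⁻¹ ^ i ≤ max (2 / m ^ α) S :=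
    (pow_le_max_self_pow (by positivity) hi hiα).trans
      (max_comm S _ ▸ max_le_max inv_le inv_pow_le)
  have middle_factor : 1 ≤ (1 + 1 / (b : ℝ) + 1 / ((b : ℝ) * (b + 1))) ^ (α - 2) := by
    refine one_le_pow₀ ?_
    rw [add_assoc]
    exact le_add_of_nonneg_right (by positivity)
  have last_factor : 3 ≤ 3 + 2 / (b : ℝ) + (2 * b + 1) / ((b : ℝ) - 1) := by
    rw [add_assoc]
    exact le_add_of_nonneg_right (by positivity)
  rw [le_div_iff₀ zero_lt_three]
  calc m⁻¹ ^ i * 3 ≤ max (2 / m ^ α) S * 1 * 3 := by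
        rw [mul_one]
        exact mul_le_mul_of_nonneg_right inv_pow_le_max zero_le_three
    _ ≤ _ := by gcongr

variable (b) in
lemma constC_pos (hα : 1 < α) : 0 < constC α b := by
  have two_sin_pos : 0 < 2 * Real.sin (Real.pi / b) := mul_pos two_pos (sin_pi_div_pos b)
  have pow_le := inv_two_sin_pow_le_constC (b := b) hα le_rfl hα.le
  have pow_pos : 0 < (2 * Real.sin (Real.pi / b))⁻¹ ^ 1 := by positivity
  linarith

lemma cbcWeight_nonneg {s : ℕ} (hα : 1 < α) (γ : Finset (Fin s) → ℝ≥0)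
    (v : Finset (Fin (s * α))) : 0 ≤ cbcWeight b γ v := by
  have := constC_pos b hα
  rw [cbcWeight]
  positivity

variable {s M : ℕ} [NeZero α] {γ : Finset (Fin s) → ℝ≥0} {q : ℝ≥0∞} {F : (Fin s → ℝ) → ℝ}

lemma inv_pow_topDigitSum_le {l : Fin (s * α) → ℕ} (hl : l ∈ digitBox b M (s * α)) (j : Fin s) :
    ((b : ℝ) ^ topDigitSum (interlacedDigits b l j) (M * α) α)⁻¹ ≤ (b : ℝ) ^ (α * (α - 1) / 2) *
      ((b : ℝ) ^ (α * ∑ i : Fin α, mu1 b (l (finProdFinEquiv (j, i)))))⁻¹ := by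
  have := base_pos b
  rw [← div_eq_mul_inv, le_div_iff₀ (by positivity), inv_mul_le_iff₀ (by positivity), ← pow_add]
  exact pow_le_pow_right₀ (one_lt_base b).le
    (mul_sum_mu1_le fun i => Finset.mem_range.1 (Fintype.mem_piFinset.1 hl _))

lemma prod_blocks_le_cbcWeight (hα : 1 < α) (γ : Finset (Fin s) → ℝ≥0) {l : Fin (s * α) → ℕ}
    (hl : l ∈ digitBox b M (s * α)) :
    (∏ j ∈ blocks (indexSupport l), constC α b *
        ((b : ℝ) ^ topDigitSum (interlacedDigits b l j) (M * α) α)⁻¹) *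
          γ (blocks (indexSupport l)) ≤
      cbcWeight b γ (indexSupport l) * ((b : ℝ) ^ (α * ∑ p, mu1 b (l p)))⁻¹ := by
  have constC_pos := constC_pos b hα
  have base_pos := base_pos b
  set u := blocks (indexSupport l) with hu
  calc _ ≤ (∏ j ∈ u, constC α b * ((b : ℝ) ^ (α * (α - 1) / 2) *
          ((b : ℝ) ^ (α * ∑ i : Fin α, mu1 b (l (finProdFinEquiv (j, i)))))⁻¹)) * γ u :=
        mul_le_mul_of_nonneg_right (Finset.prod_le_prod (fun j _ => by positivity) fun j _ =>
          mul_le_mul_of_nonneg_left (inv_pow_topDigitSum_le hl j) constC_pos.le) (γ u).2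
    _ = _ := by
        simp only [Finset.prod_mul_distrib, Finset.prod_inv_distrib, Finset.prod_const,
          Finset.prod_pow_eq_pow_sum, cbcWeight, ← hu, pow_mul]
        rw [hu, sum_blocks_indexSupport_mu1, ← hu]
        ring

lemma exists_interlacedDigits_ne_zero_iff {l : Fin (s * α) → ℕ} (hl : l ∈ digitBox b M (s * α))
    (j : Fin s) :
    (∃ n < M * α, interlacedDigits b l j n ≠ 0) ↔ j ∈ blocks (indexSupport l) := by
  refine ⟨fun ⟨n, _, hn⟩ => mem_blocks_indexSupport.2
    ⟨Fin.ofNat α n, fun h => hn (by rw [interlacedDigits, interlaceSeq, h]; simp [natDigit])⟩, ?_⟩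
  simp only [blocks, Finset.mem_image, mem_indexSupport]
  rintro ⟨p, hp, rfl⟩
  exact exists_interlacedDigits_ne_zero hl hp

lemma MemSobolev.norm_pairing_interlacedDigits_le (hα : 1 < α) (hq : 1 ≤ q)
    (h : MemSobolev α γ q ∞ F) {l : Fin (s * α) → ℕ} (hl : l ∈ digitBox b M (s * α))
    (hl0 : l ≠ 0) :
    ‖pairing F fun j => walsh (M * α) (interlacedDigits b l j)‖ ≤
      cbcWeight b γ (indexSupport l) * ((b : ℝ) ^ (α * ∑ p, mu1 b (l p)))⁻¹ *
        (sobolevENorm α γ q ∞ F).toReal := by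
  have coefficient_le := h.norm_pairing_walsh_le hα.le hq
    (fun i hi hiα => inv_two_sin_pow_le_constC hα hi hiα)
    ((indexSupport_nonempty hl0).image Fin.divNat)
    fun j => (exists_interlacedDigits_ne_zero_iff hl j).symm
  rw [mul_div_cancel₀ _ three_ne_zero, ← mul_assoc] at coefficient_le
  exact coefficient_le.trans
    (mul_le_mul_of_nonneg_right (prod_blocks_le_cbcWeight hα γ hl) ENNReal.toReal_nonneg)

end WeightBound

section DualNet

variable {b m d : ℕ} {P : (ZMod b)[X]} {g : Fin d → (ZMod b)[X]}

lemma eq_zero_of_indexSupport_eq {l : Fin d → ℕ} {v : Finset (Fin d)} (hv : indexSupport l = v)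
    {p : Fin d} (hp : p ∉ v) : l p = 0 :=
  notMem_indexSupport.1 (hv ▸ hp)

lemma sum_coe_of_indexSupport_eq {β : Type*} [AddCommMonoid β] {l : Fin d → ℕ}
    {v : Finset (Fin d)} (hv : indexSupport l = v) (f : Fin d → ℕ → β) (hf : ∀ p, f p 0 = 0) :
    ∑ p : v, f p (l p) = ∑ p, f p (l p) := by
  rw [Finset.sum_coe_sort v fun p => f p (l p)]
  refine Finset.sum_subset v.subset_univ fun p _ hp => ?_
  rw [eq_zero_of_indexSupport_eq hv hp, hf]

lemma restrict_mem_dualNet {l : Fin d → ℕ} {v : Finset (Fin d)} (hv : indexSupport l = v)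
    (hl : P ∣ ∑ p, truncPoly b m (l p) * g p) : (fun p : v => l p) ∈ dualNet b m P g v := by
  refine ⟨fun p => Nat.pos_of_ne_zero (mem_indexSupport.1 (hv.symm ▸ p.2)), ?_⟩
  rwa [sum_coe_of_indexSupport_eq hv (fun p k => truncPoly b m k * g p) fun p => by
    rw [truncPoly_zero, zero_mul]]

lemma sum_le_tsum_dualNet (α : ℕ) {v : Finset (Fin d)} {T : Finset (Fin d → ℕ)}
    (hv : ∀ l ∈ T, indexSupport l = v) (hT : ∀ l ∈ T, P ∣ ∑ p, truncPoly b m (l p) * g p) :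
    ∑ l ∈ T, ((b : ℝ≥0∞) ^ (α * ∑ p, mu1 b (l p)))⁻¹ ≤
      ∑' l : dualNet b m P g v, ((b : ℝ≥0∞) ^ (α * ∑ p, mu1 b (l.1 p)))⁻¹ := by
  let restrict (l : T) : dualNet b m P g v :=
    ⟨fun p => l.1 p, restrict_mem_dualNet (hv l l.2) (hT l l.2)⟩
  have restrict_injective : Function.Injective restrict := fun l l' h => by
    refine Subtype.ext (funext fun p => ?_)
    by_cases hp : p ∈ v
    · exact congrFun (congrArg Subtype.val h) ⟨p, hp⟩
    · rw [eq_zero_of_indexSupport_eq (hv l l.2) hp, eq_zero_of_indexSupport_eq (hv l' l'.2) hp]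
  calc ∑ l ∈ T, ((b : ℝ≥0∞) ^ (α * ∑ p, mu1 b (l p)))⁻¹
      = ∑' l : T, ((b : ℝ≥0∞) ^ (α * ∑ p, mu1 b ((restrict l).1 p)))⁻¹ := by
        rw [tsum_fintype, ← Finset.sum_coe_sort]
        refine Finset.sum_congr rfl fun l _ => ?_
        rw [← sum_coe_of_indexSupport_eq (hv l l.2) (fun _ => mu1 b) fun _ => mu1_zero]
    _ ≤ _ := ENNReal.tsum_comp_le_tsum_of_injective restrict_injective _

end DualNet

section ErrorBound

/-! ### The error is bounded by the search criterion -/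

variable {b m s α : ℕ} {γ : Finset (Fin s) → ℝ≥0}

lemma sum_indexSupport_le_criterion {P : (ZMod b)[X]} {g : Fin (s * α) → (ZMod b)[X]}
    {T : Finset (Fin (s * α) → ℕ)} (hT : ∀ l ∈ T, P ∣ ∑ p, truncPoly b m (l p) * g p)
    (hT0 : 0 ∉ T) :
    ∑ l ∈ T, ENNReal.ofReal (cbcWeight b γ (indexSupport l)) *
        ((b : ℝ≥0∞) ^ (α * ∑ p, mu1 b (l p)))⁻¹ ≤ criterion b m γ P (s * α) g := by
  have support_mem : ∀ l ∈ T, indexSupport l ∈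
      ({v | v.Nonempty ∧ ∀ p ∈ v, p.val < s * α} : Finset (Finset (Fin (s * α)))) := fun l hl =>
    Finset.mem_filter.2 ⟨Finset.mem_univ _,
      indexSupport_nonempty (ne_of_mem_of_not_mem hl hT0), fun p _ => p.2⟩
  rw [criterion, ← Finset.sum_fiberwise_of_maps_to support_mem]
  refine Finset.sum_le_sum fun v _ => ?_
  calc _ = ENNReal.ofReal (cbcWeight b γ v) *
        ∑ l ∈ T with indexSupport l = v, ((b : ℝ≥0∞) ^ (α * ∑ p, mu1 b (l p)))⁻¹ := by
        rw [Finset.mul_sum]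
        exact Finset.sum_congr rfl fun l hl => by rw [(Finset.mem_filter.1 hl).2]
    _ ≤ _ := by
        gcongr
        exact sum_le_tsum_dualNet α (fun l hl => (Finset.mem_filter.1 hl).2)
          fun l hl => hT l (Finset.mem_filter.1 hl).1

variable [Fact b.Prime] [NeZero α] {q : ℝ≥0∞} {F : (Fin s → ℝ) → ℝ} {P : (ZMod b)[X]}

lemma MemSobolev.norm_sum_pairing_le (hα : 1 < α) (hq : 1 ≤ q) (h : MemSobolev α γ q ∞ F)
    {g : Fin (s * α) → (ZMod b)[X]} (hfin : criterion b m γ P (s * α) g ≠ ∞) {M : ℕ}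
    {T : Finset (Fin (s * α) → ℕ)} (hTM : T ⊆ digitBox b M (s * α))
    (hT : ∀ l ∈ T, P ∣ ∑ p, truncPoly b m (l p) * g p) (hT0 : 0 ∉ T) :
    ‖∑ l ∈ T, pairing F fun j => walsh (M * α) (interlacedDigits b l j)‖ ≤
      (criterion b m γ P (s * α) g).toReal * (sobolevENorm α γ q ∞ F).toReal := by
  set term : (Fin (s * α) → ℕ) → ℝ≥0∞ := fun l =>
    ENNReal.ofReal (cbcWeight b γ (indexSupport l)) * ((b : ℝ≥0∞) ^ (α * ∑ p, mu1 b (l p)))⁻¹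
  have sum_term_le : ∑ l ∈ T, term l ≤ criterion b m γ P (s * α) g :=
    sum_indexSupport_le_criterion hT hT0
  have pairing_le : ∀ l ∈ T, ‖pairing F fun j => walsh (M * α) (interlacedDigits b l j)‖ ≤
      (term l).toReal * (sobolevENorm α γ q ∞ F).toReal := fun l hl => by
    refine (h.norm_pairing_interlacedDigits_le hα hq (hTM hl)
      (ne_of_mem_of_not_mem hl hT0)).trans_eq ?_
    rw [ENNReal.toReal_mul, ENNReal.toReal_ofReal (cbcWeight_nonneg hα _ _), ENNReal.toReal_inv,
      ENNReal.toReal_pow, ENNReal.toReal_natCast]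
  calc _ ≤ ∑ l ∈ T, (term l).toReal * (sobolevENorm α γ q ∞ F).toReal :=
        norm_sum_le_of_le _ pairing_le
    _ = (∑ l ∈ T, term l).toReal * (sobolevENorm α γ q ∞ F).toReal := by
        rw [← Finset.sum_mul, ENNReal.toReal_sum fun l hl => ne_top_of_le_ne_top hfin
          ((Finset.single_le_sum (fun _ _ => zero_le) hl).trans sum_term_le)]
    _ ≤ _ := mul_le_mul_of_nonneg_right (ENNReal.toReal_mono hfin sum_term_le)
        ENNReal.toReal_nonneg

open Classical in
lemma sum_walshPartialSum_interlacedPoint (hP : P ≠ 0) (hPm : P.natDegree = m)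
    (g : Fin (s * α) → (ZMod b)[X]) {M : ℕ} (hM : m ≤ M) :
    ∑ n ∈ Finset.range (b ^ m), walshPartialSum b M α F (interlacedPoint b m α P g n) =
      (b : ℂ) ^ m * ∑ l ∈ digitBox b M (s * α) with P ∣ ∑ p, truncPoly b m (l p) * g p,
        pairing F fun j => walsh (M * α) (interlacedDigits b l j) := by
  simp only [walshPartialSum]
  rw [Finset.sum_comm, Finset.sum_filter, Finset.mul_sum]
  refine Finset.sum_congr rfl fun l _ => ?_
  rw [← Finset.mul_sum, ← map_sum, sum_interlacedWalsh_interlacedPoint g hM hP hPm]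
  split_ifs
  · rw [map_pow, Complex.conj_natCast, mul_comm]
  · rw [map_zero, mul_zero, mul_zero]

lemma pairing_interlacedDigits_zero (M : ℕ) :
    pairing F (fun j => walsh (M * α) (interlacedDigits b (0 : Fin (s * α) → ℕ) j)) =
      ((∫ y in cube s, F y : ℝ) : ℂ) := by
  rw [pairing, ← integral_complex_ofReal]
  refine integral_congr_ae (.of_forall fun y => ?_)
  change _ * interlacedWalsh (b := b) M (0 : Fin (s * α) → ℕ) y = _
  rw [interlacedWalsh_zero, mul_one]

lemma MemSobolev.norm_average_walshPartialSum_sub_le (hα : 1 < α) (hq : 1 ≤ q)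
    (h : MemSobolev α γ q ∞ F) (hP : P ≠ 0) (hPm : P.natDegree = m)
    {g : Fin (s * α) → (ZMod b)[X]} (hfin : criterion b m γ P (s * α) g ≠ ∞) {M : ℕ}
    (hM : m ≤ M) :
    ‖1 / (b : ℂ) ^ m * ∑ n ∈ Finset.range (b ^ m),
        walshPartialSum b M α F (interlacedPoint b m α P g n) -
          ((∫ y in cube s, F y : ℝ) : ℂ)‖ ≤
      (criterion b m γ P (s * α) g).toReal * (sobolevENorm α γ q ∞ F).toReal := by
  classical
  have base_pow_ne_zero : (b : ℂ) ^ m ≠ 0 :=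
    pow_ne_zero m (Nat.cast_ne_zero.2 (NeZero.ne b))
  have zero_mem : (0 : Fin (s * α) → ℕ) ∈
      {l ∈ digitBox b M (s * α) | P ∣ ∑ p, truncPoly b m (l p) * g p} :=
    Finset.mem_filter.2 ⟨zero_mem_digitBox M _, by simp [truncPoly_zero]⟩
  rw [sum_walshPartialSum_interlacedPoint hP hPm g hM, ← mul_assoc,
    one_div_mul_cancel base_pow_ne_zero, one_mul, ← Finset.add_sum_erase _ _ zero_mem,
    pairing_interlacedDigits_zero, add_sub_cancel_left]
  exact h.norm_sum_pairing_le hα hq hfin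
    ((Finset.erase_subset _ _).trans (Finset.filter_subset _ _))
    (fun l hl => (Finset.mem_filter.1 (Finset.mem_of_mem_erase hl)).2) (Finset.notMem_erase _ _)

theorem MemSobolev.error_le_criterion (hα : 1 < α) (hq : 1 ≤ q) (h : MemSobolev α γ q ∞ F)
    (hP : P ≠ 0) (hPm : P.natDegree = m) {g : Fin (s * α) → (ZMod b)[X]}
    (hfin : criterion b m γ P (s * α) g ≠ ∞) :
    |1 / (b : ℝ) ^ m * ∑ n ∈ Finset.range (b ^ m), F (interlacedPoint b m α P g n) -
        ∫ y in cube s, F y| ≤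
      (criterion b m γ P (s * α) g).toReal * (sobolevENorm α γ q ∞ F).toReal := by
  have average_tendsto : Filter.Tendsto (fun M => 1 / (b : ℂ) ^ m * ∑ n ∈ Finset.range (b ^ m),
      walshPartialSum b M α F (interlacedPoint b m α P g n)) Filter.atTop
      (nhds (1 / (b : ℂ) ^ m * ∑ n ∈ Finset.range (b ^ m),
        (F (interlacedPoint b m α P g n) : ℂ))) :=
    (tendsto_finsetSum _ fun n _ => (tendstoUniformlyOn_walshPartialSum h.continuousOn).tendsto_at
      (interlacedPoint_mem_halfOpenCube m P g n)).const_mul _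
  have error_le := le_of_tendsto (average_tendsto.sub_const _).norm
    ((Filter.eventually_ge_atTop m).mono fun M hM =>
      h.norm_average_walshPartialSum_sub_le hα hq hP hPm hfin hM)
  rw [← Real.norm_eq_abs, ← Complex.norm_real]
  push_cast
  exact error_le

end ErrorBound

section ENNRealSums

/-! ### Sums in `[0,∞]` -/

lemma rpow_sum_le_sum_rpow {ι : Type*} (T : Finset ι) (f : ι → ℝ≥0∞) {p : ℝ} (hp : 0 < p)
    (hp1 : p ≤ 1) : (∑ i ∈ T, f i) ^ p ≤ ∑ i ∈ T, f i ^ p :=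
  Finset.le_sum_of_subadditive (· ^ p) (ENNReal.zero_rpow_of_pos hp).le
    (fun _ _ => ENNReal.rpow_add_le_add_rpow _ _ hp.le hp1) T f

lemma rpow_tsum_le_tsum_rpow {ι : Type*} (f : ι → ℝ≥0∞) {p : ℝ} (hp : 0 < p) (hp1 : p ≤ 1) :
    (∑' i, f i) ^ p ≤ ∑' i, f i ^ p := by
  rw [ENNReal.tsum_eq_iSup_sum, ← ENNReal.orderIsoRpow_apply p hp, map_iSup]
  exact iSup_le fun T => (rpow_sum_le_sum_rpow T f hp hp1).trans (ENNReal.sum_le_tsum T)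

lemma tsum_prod_le_prod_tsum {ι κ : Type*} [Fintype ι] (f : ι → κ → ℝ≥0∞) :
    ∑' l : ι → κ, ∏ i, f i (l i) ≤ ∏ i, ∑' k, f i k := by
  classical
  rw [ENNReal.tsum_eq_iSup_sum]
  refine iSup_le fun T => ?_
  have subset_pi : T ⊆ Fintype.piFinset fun i => T.image fun l => l i := fun l hl =>
    Fintype.mem_piFinset.2 fun i => Finset.mem_image_of_mem _ hl
  calc ∑ l ∈ T, ∏ i, f i (l i)
      ≤ ∑ l ∈ Fintype.piFinset fun i => T.image fun l => l i, ∏ i, f i (l i) :=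
        Finset.sum_le_sum_of_subset subset_pi
    _ = ∏ i, ∑ k ∈ T.image fun l => l i, f i k := (Finset.prod_univ_sum _ _).symm
    _ ≤ ∏ i, ∑' k, f i k := Finset.prod_le_prod' fun i _ => ENNReal.sum_le_tsum _

lemma tsum_mul_prod_le {ι κ : Type*} [Fintype ι] (j : ι) (c f : κ → ℝ≥0∞) :
    ∑' l : ι → κ, c (l j) * ∏ i, f (l i) ≤
      (∑' k, c k * f k) * (∑' k, f k) ^ (Fintype.card ι - 1) := by
  classical
  calc ∑' l : ι → κ, c (l j) * ∏ i, f (l i)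
      = ∑' l : ι → κ, ∏ i, (if i = j then c (l i) else 1) * f (l i) := by
        simp only [Finset.prod_mul_distrib, Finset.prod_ite_eq', Finset.mem_univ, if_true]
    _ ≤ ∏ i, ∑' k, (if i = j then c k else 1) * f k := tsum_prod_le_prod_tsum _
    _ = (∑' k, c k * f k) * ∏ _i ∈ Finset.univ.erase j, ∑' k, f k := by
        rw [← Finset.mul_prod_erase _ _ (Finset.mem_univ j)]
        refine congrArg₂ _ (by simp only [if_true]) (Finset.prod_congr rfl fun _ hi => ?_)
        simp only [if_neg (Finset.ne_of_mem_erase hi), one_mul]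
    _ = (∑' k, c k * f k) * (∑' k, f k) ^ (Fintype.card ι - 1) := by
        rw [Finset.prod_const, Finset.card_erase_of_mem (Finset.mem_univ j), Finset.card_univ]

end ENNRealSums

section DigitSums

/-! ### Sums over the numbers with given digits -/

/-- The term `x ^ μ_1(k)` for `k > 0`, and `0` for `k = 0`. -/
noncomputable def digitTerm (b : ℕ) (x : ℝ≥0∞) (k : ℕ) : ℝ≥0∞ := if k = 0 then 0 else x ^ mu1 b k

/-- The sum of `x ^ μ_1(k)` over all `k > 0`. -/
noncomputable def digitTotal (b : ℕ) (x : ℝ≥0∞) : ℝ≥0∞ := ∑' k, digitTerm b x k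

variable {b : ℕ} [Fact (1 < b)]

lemma sum_Ico_digitTerm (x : ℝ≥0∞) (n : ℕ) :
    ∑ k ∈ Finset.Ico (b ^ n) (b ^ (n + 1)), digitTerm b x k =
      ((b - 1 : ℕ) : ℝ≥0∞) * x * (b * x) ^ n := by
  have one_lt : 1 < b := Fact.out
  have digitTerm_eq : ∀ k ∈ Finset.Ico (b ^ n) (b ^ (n + 1)), digitTerm b x k = x ^ (n + 1) :=
    fun k hk => by
    have hk0 : k ≠ 0 := ((Nat.pow_pos (zero_lt_one.trans one_lt)).trans_le
      (Finset.mem_Ico.1 hk).1).ne'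
    rw [digitTerm, if_neg hk0, mu1_of_ne_zero hk0,
      (Nat.log_eq_iff (Or.inr ⟨one_lt, hk0⟩)).2 (Finset.mem_Ico.1 hk)]
  rw [Finset.sum_congr rfl digitTerm_eq, Finset.sum_const, Nat.card_Ico, nsmul_eq_mul, pow_succ b,
    ← Nat.mul_sub_one, Nat.cast_mul, Nat.cast_pow]
  ring

lemma sum_range_digitTerm (x : ℝ≥0∞) (n : ℕ) :
    ∑ k ∈ Finset.range (b ^ n), digitTerm b x k =
      ∑ i ∈ Finset.range n, ((b - 1 : ℕ) : ℝ≥0∞) * x * (b * x) ^ i := by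
  induction n with
  | zero => simp [digitTerm]
  | succ n ih =>
    rw [Finset.sum_range_succ, ← ih, ← sum_Ico_digitTerm, Finset.sum_range_add_sum_Ico _
      (Nat.pow_le_pow_right (zero_lt_one.trans Fact.out) n.le_succ)]

lemma digitTotal_eq (b : ℕ) [Fact (1 < b)] (x : ℝ≥0∞) :
    digitTotal b x = ((b - 1 : ℕ) : ℝ≥0∞) * x * (1 - b * x)⁻¹ := by
  have partial_sums := (ENNReal.tendsto_nat_tsum (digitTerm b x)).comp
    (tendsto_pow_atTop_atTop_of_one_lt (Fact.out : 1 < b))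
  simp only [Function.comp_def, sum_range_digitTerm] at partial_sums
  rw [digitTotal, tendsto_nhds_unique partial_sums (ENNReal.tendsto_nat_tsum _),
    ENNReal.tsum_mul_left, ENNReal.tsum_geometric]

lemma digitTerm_base_pow_mul (x : ℝ≥0∞) (m k : ℕ) :
    digitTerm b x (b ^ m * k) = x ^ m * digitTerm b x k := by
  have one_lt : 1 < b := Fact.out
  have base_pow_ne_zero : b ^ m ≠ 0 := pow_ne_zero m (zero_lt_one.trans one_lt).ne'
  rcases eq_or_ne k 0 with rfl | hk
  · simp [digitTerm]
  · rw [digitTerm, digitTerm, if_neg (mul_ne_zero base_pow_ne_zero hk), if_neg hk, ← pow_add, mu1,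
      Nat.digits_base_pow_mul one_lt (Nat.pos_of_ne_zero hk), List.length_append,
      List.length_replicate, mu1]

end DigitSums

section TruncPoly

variable {b : ℕ}

lemma coeff_truncPoly (m k a : ℕ) :
    (truncPoly b m k).coeff a = if a < m then natDigit b k a else 0 := by
  simp only [truncPoly, finsetSum_coeff, coeff_C_mul_X_pow, Finset.sum_ite_eq, Finset.mem_range]
  rfl

lemma degree_truncPoly_lt (m k : ℕ) : (truncPoly b m k).degree < m :=
  (degree_lt_iff_coeff_zero _ _).2 fun a ha => by rw [coeff_truncPoly, if_neg (not_lt.2 ha)]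

lemma natDigit_eq_zero_iff {k a : ℕ} : natDigit b k a = 0 ↔ k / b ^ a % b = 0 := by
  rw [natDigit, ZMod.natCast_eq_zero_iff, Nat.dvd_mod_iff dvd_rfl, Nat.dvd_iff_mod_eq_zero]

lemma pow_dvd_of_natDigit_eq_zero {m k : ℕ} (h : ∀ a < m, natDigit b k a = 0) : b ^ m ∣ k := by
  refine Nat.dvd_of_mod_eq_zero ?_
  induction m with
  | zero => simp [Nat.mod_one]
  | succ m ih =>
    rw [Nat.mod_pow_succ, ih fun a ha => h a (ha.trans m.lt_succ_self),
      natDigit_eq_zero_iff.1 (h m m.lt_succ_self), mul_zero, add_zero]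

lemma pow_dvd_of_truncPoly_eq_zero {m k : ℕ} (h : truncPoly b m k = 0) : b ^ m ∣ k :=
  pow_dvd_of_natDigit_eq_zero fun a ha => by
    simpa only [h, coeff_zero, if_pos ha] using (coeff_truncPoly (b := b) m k a).symm

open Classical in
lemma tsum_digitTerm_truncPoly_le [Fact (1 < b)] (x : ℝ≥0∞) (m : ℕ) :
    ∑' k, (if truncPoly b m k = 0 then digitTerm b x k else 0) ≤ x ^ m * digitTotal b x := by
  have support_subset : Function.support
      (fun k => if truncPoly b m k = 0 then digitTerm b x k else 0) ⊆
        Set.range (b ^ m * · : ℕ → ℕ) := fun k hk => by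
    obtain ⟨q, rfl⟩ := pow_dvd_of_truncPoly_eq_zero (not_imp_comm.1 (if_neg ·) hk)
    exact ⟨q, rfl⟩
  rw [← (mul_right_injective₀ (pow_ne_zero m (zero_lt_one.trans Fact.out).ne')).tsum_eq
    support_subset, digitTotal, ← ENNReal.tsum_mul_left]
  refine ENNReal.tsum_le_tsum fun q => ?_
  rw [← digitTerm_base_pow_mul]
  split_ifs
  exacts [le_rfl, zero_le]

open Classical in
lemma mul_tsum_digitTerm_truncPoly_le [Fact (1 < b)] {x : ℝ≥0∞} (hx : b * x ≤ 1) (m : ℕ) :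
    ((b ^ m - 1 : ℕ) : ℝ≥0∞) * ∑' k, (if truncPoly b m k = 0 then digitTerm b x k else 0) ≤
      digitTotal b x := by
  have card_mul_le : ((b ^ m - 1 : ℕ) : ℝ≥0∞) * x ^ m ≤ 1 :=
    calc ((b ^ m - 1 : ℕ) : ℝ≥0∞) * x ^ m ≤ ((b ^ m : ℕ) : ℝ≥0∞) * x ^ m := by
          gcongr
          exact Nat.sub_le _ _
      _ = (b * x) ^ m := by rw [Nat.cast_pow, mul_pow]
      _ ≤ 1 := pow_le_one' hx m
  calc _ ≤ ((b ^ m - 1 : ℕ) : ℝ≥0∞) * (x ^ m * digitTotal b x) := by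
        gcongr
        exact tsum_digitTerm_truncPoly_le x m
    _ ≤ digitTotal b x := by
        rw [← mul_assoc]
        exact mul_le_of_le_one_left' card_mul_le

end TruncPoly

section PolySet

/-! ### The set of candidates for a component -/

variable {b : ℕ}

lemma polySet_eq_sdiff (m : ℕ) : polySet b m = (degreeLT (ZMod b) m : Set (ZMod b)[X]) \ {0} := by
  ext p
  simp only [polySet, Set.mem_ofPred_eq, Set.mem_sdiff, SetLike.mem_coe, mem_degreeLT,
    Set.mem_singleton_iff, and_comm]

lemma finite_polySet (b m : ℕ) [NeZero b] : (polySet b m).Finite := by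
  have : Finite (degreeLT (ZMod b) m) := .of_equiv _ (degreeLTEquiv (ZMod b) m).toEquiv.symm
  rw [polySet_eq_sdiff]
  exact (Set.toFinite (degreeLT (ZMod b) m : Set (ZMod b)[X])).sdiff

lemma card_polySet (b m : ℕ) [NeZero b] : (finite_polySet b m).toFinset.card = b ^ m - 1 := by
  have ncard_degreeLT : (degreeLT (ZMod b) m : Set (ZMod b)[X]).ncard = b ^ m := by
    rw [← Nat.card_coe_set_eq]
    refine (Nat.card_congr (degreeLTEquiv (ZMod b) m).toEquiv).trans ?_
    rw [Nat.card_fun, Nat.card_zmod, Nat.card_fin]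
  rw [← Set.ncard_eq_toFinset_card _ (finite_polySet b m), polySet_eq_sdiff,
    Set.ncard_sdiff_singleton_of_mem (zero_mem _), ncard_degreeLT]

lemma card_solutions_le_one {m : ℕ} [Fact b.Prime] {P t : (ZMod b)[X]} (hP : Irreducible P)
    (hPm : P.natDegree = m) (ht : t ≠ 0) (htm : t.degree < m) (r : (ZMod b)[X])
    [DecidablePred fun p => P ∣ t * p + r] :
    ((finite_polySet b m).toFinset.filter fun p => P ∣ t * p + r).card ≤ 1 := by
  have degree_eq : P.degree = m := by rw [degree_eq_natDegree hP.ne_zero, hPm]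
  refine Finset.card_le_one.2 fun p hp p' hp' => ?_
  rw [Finset.mem_filter, Set.Finite.mem_toFinset] at hp hp'
  have dvd_mul_sub : P ∣ t * (p - p') := by
    simpa only [add_sub_add_right_eq_sub, ← mul_sub] using dvd_sub hp.2 hp'.2
  rcases hP.prime.dvd_or_dvd dvd_mul_sub with dvd | dvd
  · exact absurd (eq_zero_of_dvd_of_degree_lt dvd (degree_eq ▸ htm)) ht
  · refine sub_eq_zero.1 (eq_zero_of_dvd_of_degree_lt dvd ?_)
    rw [degree_eq]
    exact (degree_sub_le _ _).trans_lt (max_lt hp.1.2 hp'.1.2)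

end PolySet

section DualSum

/-! ### Averages over the candidates for a component -/

/-- The sum of `x ^ (∑ j, μ_1(ℓ_j))` over the points `ℓ` of the dual net; the search criterion is
made of these sums for `x = b ^ (-α)`, and their powers are bounded by those for other `x`. -/
noncomputable def dualSum (b m : ℕ) {d : ℕ} (x : ℝ≥0∞) (P : (ZMod b)[X])
    (g : Fin d → (ZMod b)[X]) (v : Finset (Fin d)) : ℝ≥0∞ :=
  ∑' l : dualNet b m P g v, x ^ ∑ j, mu1 b (l.1 j)

variable {b d : ℕ} {P : (ZMod b)[X]} {g g' : Fin d → (ZMod b)[X]} {v : Finset (Fin d)} {j : Fin d}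

lemma dualNet_congr (m : ℕ) (h : ∀ i ∈ v, g i = g' i) : dualNet b m P g v = dualNet b m P g' v := by
  have sum_eq : ∀ l : v → ℕ, ∑ j, truncPoly b m (l j) * g j = ∑ j, truncPoly b m (l j) * g' j :=
    fun l => Finset.sum_congr rfl fun j _ => by rw [h j j.2]
  simp only [dualNet, sum_eq]

lemma dualSum_rpow_le (m : ℕ) (x : ℝ≥0∞) (P : (ZMod b)[X]) (g : Fin d → (ZMod b)[X])
    (v : Finset (Fin d)) {p : ℝ} (hp : 0 < p) (hp1 : p ≤ 1) :
    dualSum b m x P g v ^ p ≤ dualSum b m (x ^ p) P g v := by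
  refine (rpow_tsum_le_tsum_rpow _ hp hp1).trans_eq (tsum_congr fun l => ?_)
  rw [← ENNReal.rpow_natCast, ← ENNReal.rpow_natCast, ← ENNReal.rpow_mul, ← ENNReal.rpow_mul,
    mul_comm]

open Classical in
lemma dualSum_eq_tsum_ite (m : ℕ) (x : ℝ≥0∞) (P : (ZMod b)[X]) (g : Fin d → (ZMod b)[X])
    (v : Finset (Fin d)) :
    dualSum b m x P g v = ∑' l : v → ℕ,
      if P ∣ ∑ i, truncPoly b m (l i) * g i then ∏ i, digitTerm b x (l i) else 0 := by
  rw [dualSum, tsum_subtype (dualNet b m P g v) fun l => x ^ ∑ j, mu1 b (l j)]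
  refine tsum_congr fun l => ?_
  by_cases hl : ∀ i, 0 < l i
  · rw [Set.indicator_apply, ← Finset.prod_pow_eq_pow_sum]
    refine if_congr (and_iff_right hl) (Finset.prod_congr rfl fun i _ => ?_) rfl
    rw [digitTerm, if_neg (hl i).ne']
  · obtain ⟨i, hi⟩ := not_forall.1 hl
    have prod_eq_zero : ∏ i, digitTerm b x (l i) = 0 :=
      Finset.prod_eq_zero (Finset.mem_univ i) (if_pos (Nat.eq_zero_of_not_pos hi))
    rw [Set.indicator_of_notMem fun h => hl h.1, prod_eq_zero, ite_self]

lemma sum_mul_update_eq (t : v → (ZMod b)[X]) (g : Fin d → (ZMod b)[X]) (hj : j ∈ v)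
    (p : (ZMod b)[X]) :
    ∑ i, t i * Function.update g j p i =
      t ⟨j, hj⟩ * p + ∑ i ∈ Finset.univ.erase ⟨j, hj⟩, t i * g i := by
  rw [← Finset.add_sum_erase _ _ (Finset.mem_univ (⟨j, hj⟩ : v)), Function.update_self]
  refine congrArg _ (Finset.sum_congr rfl fun i hi => ?_)
  rw [Function.update_of_ne fun h => Finset.ne_of_mem_erase hi (Subtype.ext h)]

open Classical in
lemma card_solutions_le {m : ℕ} [Fact b.Prime] (hP : Irreducible P) (hPm : P.natDegree = m)
    {t : (ZMod b)[X]} (ht : t.degree < m) (r : (ZMod b)[X]) :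
    (((finite_polySet b m).toFinset.filter fun p => P ∣ t * p + r).card : ℝ≥0∞) ≤
      1 + ((b ^ m - 1 : ℕ) : ℝ≥0∞) * (if t = 0 then 1 else 0) := by
  split_ifs with h
  · rw [mul_one, ← card_polySet]
    exact (Nat.cast_le.2 (Finset.card_filter_le _ _)).trans le_add_self
  · rw [mul_zero, add_zero]
    exact_mod_cast card_solutions_le_one hP hPm h ht r

open Classical in
/-- For a fixed `ℓ`, at most one candidate for the component `j` puts `ℓ` into the dual net,
unless `tr_m(ℓ_j) = 0`, when possibly all of them do. -/
lemma sum_dualSum_update_le_tsum {m : ℕ} [Fact b.Prime] (x : ℝ≥0∞) (hP : Irreducible P)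
    (hPm : P.natDegree = m) (g : Fin d → (ZMod b)[X]) (hj : j ∈ v) :
    ∑ p ∈ (finite_polySet b m).toFinset, dualSum b m x P (Function.update g j p) v ≤
      ∑' l : v → ℕ, (1 + ((b ^ m - 1 : ℕ) : ℝ≥0∞) *
        if truncPoly b m (l ⟨j, hj⟩) = 0 then 1 else 0) * ∏ i, digitTerm b x (l i) := by
  simp only [dualSum_eq_tsum_ite]
  rw [← Summable.tsum_finsetSum fun _ _ => ENNReal.summable]
  refine ENNReal.tsum_le_tsum fun l => ?_
  simp only [sum_mul_update_eq (fun i => truncPoly b m (l i)) g hj]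
  rw [← Finset.sum_filter, Finset.sum_const, nsmul_eq_mul]
  gcongr
  exact card_solutions_le hP hPm (degree_truncPoly_lt m _) _

open Classical in
lemma sum_dualSum_update_le {m : ℕ} [Fact b.Prime] {x : ℝ≥0∞} (hx : b * x ≤ 1)
    (hP : Irreducible P) (hPm : P.natDegree = m) (g : Fin d → (ZMod b)[X]) (hj : j ∈ v) :
    ∑ p ∈ (finite_polySet b m).toFinset, dualSum b m x P (Function.update g j p) v ≤
      2 * digitTotal b x ^ v.card := by
  let c : ℕ → ℝ≥0∞ := fun k => 1 + ((b ^ m - 1 : ℕ) : ℝ≥0∞) * if truncPoly b m k = 0 then 1 else 0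
  have factor_le : ∑' k, c k * digitTerm b x k ≤ 2 * digitTotal b x := by
    simp only [c, add_mul, one_mul, mul_assoc, ite_mul, zero_mul]
    rw [ENNReal.tsum_add, ENNReal.tsum_mul_left, two_mul]
    exact add_le_add le_rfl (mul_tsum_digitTerm_truncPoly_le hx m)
  calc _ ≤ ∑' l : v → ℕ, c (l ⟨j, hj⟩) * ∏ i, digitTerm b x (l i) :=
        sum_dualSum_update_le_tsum x hP hPm g hj
    _ ≤ (∑' k, c k * digitTerm b x k) * digitTotal b x ^ (Fintype.card v - 1) :=
        tsum_mul_prod_le (⟨j, hj⟩ : v) c _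
    _ ≤ 2 * digitTotal b x * digitTotal b x ^ (v.card - 1) := by
        rw [Fintype.card_coe]
        gcongr
    _ = 2 * digitTotal b x ^ v.card := by
        rw [mul_assoc, mul_pow_sub_one (Finset.card_pos.2 ⟨j, hj⟩).ne']

lemma mul_dualSum_singleton_le {m : ℕ} [Fact b.Prime] {x : ℝ≥0∞} (hx : b * x ≤ 1)
    (hP : Irreducible P) (hPm : P.natDegree = m) (hg : g j = 1) :
    ((b ^ m - 1 : ℕ) : ℝ≥0∞) * dualSum b m x P g {j} ≤ digitTotal b x := by
  classical
  refine le_trans ?_ (mul_tsum_digitTerm_truncPoly_le hx m)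
  gcongr
  rw [dualSum_eq_tsum_ite, ← (Equiv.funUnique ({j} : Finset (Fin d)) ℕ).symm.tsum_eq]
  refine ENNReal.tsum_le_tsum fun k => ?_
  rw [Fintype.sum_unique, Fintype.prod_unique]
  split_ifs with dvd ne
  · exact le_rfl
  · refine absurd (eq_zero_of_dvd_of_degree_lt (p := P) ?_ ?_) ne
    · simpa [hg] using dvd
    · rw [degree_eq_natDegree hP.ne_zero, hPm]
      exact degree_truncPoly_lt m _
  · exact zero_le
  · exact zero_le

end DualSum

section CriterionTerms

/-! ### The terms of the search criterion -/

/-- The term of the search criterion that belongs to a set of components. -/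
noncomputable def criterionTerm (b m : ℕ) {s α : ℕ} (γ : Finset (Fin s) → ℝ≥0) (P : (ZMod b)[X])
    (g : Fin (s * α) → (ZMod b)[X]) (v : Finset (Fin (s * α))) : ℝ≥0∞ :=
  ENNReal.ofReal (cbcWeight b γ v) * dualSum b m ((b : ℝ≥0∞) ^ α)⁻¹ P g v

/-- Up to a factor 2, this bounds the sum of the powers `criterionTerm ^ lam` over all choices of
one of the components in `v`. -/
noncomputable def termBound (b : ℕ) {s α : ℕ} (γ : Finset (Fin s) → ℝ≥0) (lam : ℝ)
    (v : Finset (Fin (s * α))) : ℝ≥0∞ :=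
  ENNReal.ofReal (cbcWeight b γ v) ^ lam * digitTotal b (((b : ℝ≥0∞) ^ α)⁻¹ ^ lam) ^ v.card

/-- The nonempty sets among the first `d` components. -/
def initialSets (n d : ℕ) : Finset (Finset (Fin n)) :=
  Finset.univ.filter fun v => v.Nonempty ∧ ∀ j ∈ v, j.val < d

/-- The sets of components with largest element `j`. -/
def setsEndingAt {n : ℕ} (j : Fin n) : Finset (Finset (Fin n)) :=
  Finset.univ.filter fun v => j ∈ v ∧ ∀ i ∈ v, i ≤ j

lemma mem_initialSets {n d : ℕ} {v : Finset (Fin n)} :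
    v ∈ initialSets n d ↔ v.Nonempty ∧ ∀ j ∈ v, j.val < d := by
  rw [initialSets, Finset.mem_filter_univ]

lemma mem_setsEndingAt {n : ℕ} {j : Fin n} {v : Finset (Fin n)} :
    v ∈ setsEndingAt j ↔ j ∈ v ∧ ∀ i ∈ v, i ≤ j := by
  rw [setsEndingAt, Finset.mem_filter_univ]

lemma initialSets_zero (n : ℕ) : initialSets n 0 = ∅ :=
  Finset.eq_empty_of_forall_notMem fun _ hv =>
    let ⟨⟨j, hj⟩, h⟩ := mem_initialSets.1 hv
    Nat.not_lt_zero _ (h j hj)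

lemma sum_initialSets_succ {n : ℕ} (j : Fin n) (f : Finset (Fin n) → ℝ≥0∞) :
    ∑ v ∈ initialSets n (j.val + 1), f v =
      ∑ v ∈ initialSets n j.val, f v + ∑ v ∈ setsEndingAt j, f v := by
  have disjoint : Disjoint (initialSets n j.val) (setsEndingAt j) :=
    Finset.disjoint_left.2 fun v hv hv' =>
      lt_irrefl _ ((mem_initialSets.1 hv).2 j (mem_setsEndingAt.1 hv').1)
  rw [← Finset.sum_union disjoint]
  refine Finset.sum_congr (Finset.ext fun v => ?_) fun _ _ => rfl
  simp only [Finset.mem_union, mem_initialSets, mem_setsEndingAt, Nat.lt_succ_iff]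
  refine ⟨fun ⟨nonempty, le⟩ => ?_, ?_⟩
  · by_cases hj : j ∈ v
    · exact .inr ⟨hj, le⟩
    · exact .inl ⟨nonempty, fun i hi => (le i hi).lt_of_ne fun h => hj (Fin.ext h ▸ hi)⟩
  · rintro (⟨nonempty, lt⟩ | ⟨hj, le⟩)
    · exact ⟨nonempty, fun i hi => (lt i hi).le⟩
    · exact ⟨⟨j, hj⟩, le⟩

lemma setsEndingAt_of_val_eq_zero {n : ℕ} {j : Fin n} (hj : j.val = 0) :
    setsEndingAt j = {{j}} := by
  ext v
  rw [mem_setsEndingAt, Finset.mem_singleton, Finset.eq_singleton_iff_unique_mem]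
  refine and_congr_right fun _ => forall₂_congr fun i _ => ?_
  rw [Fin.le_def, Fin.ext_iff, hj, Nat.le_zero]

variable {b m s α : ℕ} {γ : Finset (Fin s) → ℝ≥0} {P : (ZMod b)[X]}
  {g g' : Fin (s * α) → (ZMod b)[X]}

lemma criterion_eq (b m : ℕ) (γ : Finset (Fin s) → ℝ≥0) (P : (ZMod b)[X]) (d : ℕ)
    (g : Fin (s * α) → (ZMod b)[X]) :
    criterion b m γ P d g = ∑ v ∈ initialSets (s * α) d, criterionTerm b m γ P g v := by
  simp only [criterion, criterionTerm, dualSum, pow_mul, ENNReal.inv_pow]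
  rfl

lemma criterion_succ (b m : ℕ) (γ : Finset (Fin s) → ℝ≥0) (P : (ZMod b)[X]) (j : Fin (s * α))
    (g : Fin (s * α) → (ZMod b)[X]) :
    criterion b m γ P (j.val + 1) g =
      criterion b m γ P j.val g + ∑ v ∈ setsEndingAt j, criterionTerm b m γ P g v := by
  rw [criterion_eq, criterion_eq, sum_initialSets_succ]

lemma criterion_congr {d : ℕ} (h : ∀ i : Fin (s * α), i.val < d → g i = g' i) :
    criterion b m γ P d g = criterion b m γ P d g' := by
  rw [criterion_eq, criterion_eq]
  refine Finset.sum_congr rfl fun v hv => ?_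
  rw [criterionTerm, criterionTerm, dualSum, dualSum,
    dualNet_congr m fun i hi => h i ((mem_initialSets.1 hv).2 i hi)]

lemma criterion_update {d : ℕ} {j : Fin (s * α)} (hj : d ≤ j.val) (p : (ZMod b)[X]) :
    criterion b m γ P d (Function.update g j p) = criterion b m γ P d g :=
  criterion_congr fun _ hi => Function.update_of_ne (fun h => (h ▸ hi).not_ge hj) _ _

lemma sum_criterionTerm_rpow_le {lam : ℝ} (h0 : 0 < lam) (h1 : lam ≤ 1)
    (g : Fin (s * α) → (ZMod b)[X]) (T : Finset (Finset (Fin (s * α)))) :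
    (∑ v ∈ T, criterionTerm b m γ P g v) ^ lam ≤
      ∑ v ∈ T, ENNReal.ofReal (cbcWeight b γ v) ^ lam *
        dualSum b m (((b : ℝ≥0∞) ^ α)⁻¹ ^ lam) P g v := by
  refine (rpow_sum_le_sum_rpow T _ h0 h1).trans (Finset.sum_le_sum fun v _ => ?_)
  rw [criterionTerm, ENNReal.mul_rpow_of_nonneg _ _ h0.le]
  gcongr
  exact dualSum_rpow_le m _ P g v h0 h1

end CriterionTerms

section Averaging

/-! ### The criterion along the construction -/

lemma base_mul_rpow_lt_one {b : ℕ} [Fact (1 < b)] {α : ℕ} {lam : ℝ} (hlam : 1 < α * lam) :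
    (b : ℝ≥0∞) * ((b : ℝ≥0∞) ^ α)⁻¹ ^ lam < 1 := by
  have base_ne_zero : (b : ℝ≥0∞) ≠ 0 := Nat.cast_ne_zero.2 (zero_lt_one.trans Fact.out).ne'
  have one_lt : 1 < (b : ℝ≥0∞) := Nat.one_lt_cast.2 Fact.out
  rw [← ENNReal.rpow_natCast, ← ENNReal.rpow_neg, ← ENNReal.rpow_mul]
  nth_rewrite 1 [← ENNReal.rpow_one (b : ℝ≥0∞)]
  rw [← ENNReal.rpow_add _ _ base_ne_zero (ENNReal.natCast_ne_top b)]
  exact ENNReal.rpow_lt_one_of_one_lt_of_neg one_lt (by linarith)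

lemma digitTotal_ne_top {b : ℕ} [Fact (1 < b)] {x : ℝ≥0∞} (hx : b * x < 1) :
    digitTotal b x ≠ ∞ := by
  have x_ne_top : x ≠ ∞ := by
    rintro rfl
    rw [ENNReal.mul_top (Nat.cast_ne_zero.2 (zero_lt_one.trans Fact.out).ne')] at hx
    exact not_top_lt hx
  rw [digitTotal_eq]
  exact ENNReal.mul_ne_top (ENNReal.mul_ne_top (ENNReal.natCast_ne_top _) x_ne_top)
    (ENNReal.inv_ne_top.2 (tsub_pos_of_lt hx).ne')

lemma termBound_ne_top {b : ℕ} [Fact (1 < b)] {s α : ℕ} (γ : Finset (Fin s) → ℝ≥0) {lam : ℝ}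
    (h0 : 0 ≤ lam) (hlam : 1 < α * lam) (v : Finset (Fin (s * α))) : termBound b γ lam v ≠ ∞ :=
  ENNReal.mul_ne_top (ENNReal.rpow_ne_top_of_nonneg h0 ENNReal.ofReal_ne_top)
    (ENNReal.pow_ne_top (digitTotal_ne_top (base_mul_rpow_lt_one hlam)))

variable {b m s α : ℕ} [Fact b.Prime] {γ : Finset (Fin s) → ℝ≥0} {P : (ZMod b)[X]}
  {g : Fin (s * α) → (ZMod b)[X]} {j : Fin (s * α)} {lam : ℝ}

lemma sum_rpow_criterionTerm_update_le (hP : Irreducible P) (hPm : P.natDegree = m) (h0 : 0 < lam)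
    (h1 : lam ≤ 1) (hlam : 1 < α * lam) (γ : Finset (Fin s) → ℝ≥0)
    (g : Fin (s * α) → (ZMod b)[X]) (j : Fin (s * α)) :
    ∑ p ∈ (finite_polySet b m).toFinset,
        (∑ v ∈ setsEndingAt j, criterionTerm b m γ P (Function.update g j p) v) ^ lam ≤
      2 * ∑ v ∈ setsEndingAt j, termBound b γ lam v :=
  calc _ ≤ ∑ p ∈ (finite_polySet b m).toFinset, ∑ v ∈ setsEndingAt j,
          ENNReal.ofReal (cbcWeight b γ v) ^ lam *
            dualSum b m (((b : ℝ≥0∞) ^ α)⁻¹ ^ lam) P (Function.update g j p) v :=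
        Finset.sum_le_sum fun _ _ => sum_criterionTerm_rpow_le h0 h1 _ _
    _ = ∑ v ∈ setsEndingAt j, ENNReal.ofReal (cbcWeight b γ v) ^ lam *
          ∑ p ∈ (finite_polySet b m).toFinset,
            dualSum b m (((b : ℝ≥0∞) ^ α)⁻¹ ^ lam) P (Function.update g j p) v := by
        rw [Finset.sum_comm]
        simp only [Finset.mul_sum]
    _ ≤ ∑ v ∈ setsEndingAt j, ENNReal.ofReal (cbcWeight b γ v) ^ lam *
          (2 * digitTotal b (((b : ℝ≥0∞) ^ α)⁻¹ ^ lam) ^ v.card) :=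
        Finset.sum_le_sum fun v hv => mul_le_mul_right (sum_dualSum_update_le
          (base_mul_rpow_lt_one hlam).le hP hPm g (mem_setsEndingAt.1 hv).1) _
    _ = 2 * ∑ v ∈ setsEndingAt j, termBound b γ lam v := by
        simp only [termBound, Finset.mul_sum, mul_left_comm]

lemma mul_sum_criterionTerm_rpow_le_of_first (hP : Irreducible P) (hPm : P.natDegree = m)
    (h0 : 0 < lam) (h1 : lam ≤ 1) (hlam : 1 < α * lam) (hj : j.val = 0) (hg : g j = 1) :
    ((b ^ m - 1 : ℕ) : ℝ≥0∞) * (∑ v ∈ setsEndingAt j, criterionTerm b m γ P g v) ^ lam ≤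
      ∑ v ∈ setsEndingAt j, termBound b γ lam v := by
  calc _ ≤ ((b ^ m - 1 : ℕ) : ℝ≥0∞) * (ENNReal.ofReal (cbcWeight b γ {j}) ^ lam *
          dualSum b m (((b : ℝ≥0∞) ^ α)⁻¹ ^ lam) P g {j}) := by
        gcongr
        simpa only [setsEndingAt_of_val_eq_zero hj, Finset.sum_singleton] using
          sum_criterionTerm_rpow_le (γ := γ) (m := m) (P := P) h0 h1 g (setsEndingAt j)
    _ ≤ ENNReal.ofReal (cbcWeight b γ {j}) ^ lam * digitTotal b (((b : ℝ≥0∞) ^ α)⁻¹ ^ lam) := by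
        rw [mul_left_comm]
        gcongr
        exact mul_dualSum_singleton_le (base_mul_rpow_lt_one hlam).le hP hPm hg
    _ = ∑ v ∈ setsEndingAt j, termBound b γ lam v := by
        rw [setsEndingAt_of_val_eq_zero hj, Finset.sum_singleton, termBound, Finset.card_singleton,
          pow_one]

lemma IsCBC.sum_criterionTerm_le_update (hg : IsCBC b m γ P g) (hj : 0 < j.val)
    (hfin : criterion b m γ P j.val g ≠ ∞) {p : (ZMod b)[X]} (hp : p ∈ polySet b m) :
    ∑ v ∈ setsEndingAt j, criterionTerm b m γ P g v ≤
      ∑ v ∈ setsEndingAt j, criterionTerm b m γ P (Function.update g j p) v := by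
  have criterion_le := hg.minimal j hj p hp
  rw [criterion_succ, criterion_succ, criterion_update le_rfl] at criterion_le
  exact (ENNReal.add_le_add_iff_left hfin).1 criterion_le

/-- A minimum is at most the average over all candidates. -/
lemma IsCBC.mul_sum_criterionTerm_rpow_le (hg : IsCBC b m γ P g) (hP : Irreducible P)
    (hPm : P.natDegree = m) (h0 : 0 < lam) (h1 : lam ≤ 1) (hlam : 1 < α * lam)
    (hfin : criterion b m γ P j.val g ≠ ∞) :
    ((b ^ m - 1 : ℕ) : ℝ≥0∞) * (∑ v ∈ setsEndingAt j, criterionTerm b m γ P g v) ^ lam ≤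
      2 * ∑ v ∈ setsEndingAt j, termBound b γ lam v := by
  rcases Nat.eq_zero_or_pos j.val with hj | hj
  · refine (mul_sum_criterionTerm_rpow_le_of_first hP hPm h0 h1 hlam hj (hg.first j hj)).trans ?_
    rw [two_mul]
    exact le_self_add
  · refine le_trans ?_ (sum_rpow_criterionTerm_update_le hP hPm h0 h1 hlam γ g j)
    rw [← card_polySet, ← nsmul_eq_mul]
    exact Finset.card_nsmul_le_sum _ _ _ fun p hp => ENNReal.rpow_le_rpow
      (hg.sum_criterionTerm_le_update hj hfin ((Set.Finite.mem_toFinset _).1 hp)) h0.le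

lemma ne_top_of_mul_rpow_le {N x B : ℝ≥0∞} (hN : N ≠ 0) (h0 : 0 < lam) (hB : B ≠ ∞)
    (h : N * x ^ lam ≤ B) : x ≠ ∞ := by
  rintro rfl
  rw [ENNReal.top_rpow_of_pos h0, ENNReal.mul_top hN] at h
  exact hB (top_le_iff.1 h)

lemma IsCBC.mul_criterion_rpow_le (hg : IsCBC b m γ P g) (hm : m ≠ 0) (hP : Irreducible P)
    (hPm : P.natDegree = m) (h0 : 0 < lam) (h1 : lam ≤ 1) (hlam : 1 < α * lam) {d : ℕ}
    (hd : d ≤ s * α) :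
    ((b ^ m - 1 : ℕ) : ℝ≥0∞) * criterion b m γ P d g ^ lam ≤
      2 * ∑ v ∈ initialSets (s * α) d, termBound b γ lam v := by
  induction d with
  | zero =>
    rw [criterion_eq, initialSets_zero, Finset.sum_empty, Finset.sum_empty,
      ENNReal.zero_rpow_of_pos h0, mul_zero, mul_zero]
  | succ d ih =>
    let j : Fin (s * α) := ⟨d, hd⟩
    have ih := ih (Nat.le_of_succ_le hd)
    have card_ne_zero : ((b ^ m - 1 : ℕ) : ℝ≥0∞) ≠ 0 :=
      Nat.cast_ne_zero.2 (Nat.sub_pos_of_lt (Nat.one_lt_pow hm (Nat.Prime.one_lt Fact.out))).ne'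
    have criterion_ne_top : criterion b m γ P j.val g ≠ ∞ :=
      ne_top_of_mul_rpow_le card_ne_zero h0 (ENNReal.mul_ne_top (by finiteness)
        (ENNReal.sum_ne_top.2 fun v _ => termBound_ne_top γ h0.le hlam v)) ih
    calc _ ≤ ((b ^ m - 1 : ℕ) : ℝ≥0∞) * (criterion b m γ P j.val g ^ lam +
          (∑ v ∈ setsEndingAt j, criterionTerm b m γ P g v) ^ lam) := by
          rw [criterion_succ b m γ P j]
          gcongr
          exact ENNReal.rpow_add_le_add_rpow _ _ h0.le h1
      _ ≤ 2 * ∑ v ∈ initialSets (s * α) d, termBound b γ lam v +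
          2 * ∑ v ∈ setsEndingAt j, termBound b γ lam v := by
          rw [mul_add]
          exact add_le_add ih
            (hg.mul_sum_criterionTerm_rpow_le hP hPm h0 h1 hlam criterion_ne_top)
      _ = 2 * ∑ v ∈ initialSets (s * α) (d + 1), termBound b γ lam v := by
          rw [← mul_add, ← sum_initialSets_succ j]

end Averaging

section Existence

/-! ### Existence of the construction -/

variable {b m s α : ℕ} [Fact b.Prime]

lemma one_mem_polySet (b : ℕ) [Fact b.Prime] (hm : m ≠ 0) : 1 ∈ polySet b m :=
  ⟨one_ne_zero, by rw [degree_one]; exact_mod_cast Nat.pos_of_ne_zero hm⟩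

lemma exists_criterion_update_minimal (hm : m ≠ 0) (γ : Finset (Fin s) → ℝ≥0) (P : (ZMod b)[X])
    (j : Fin (s * α)) (g : Fin (s * α) → (ZMod b)[X]) :
    ∃ p ∈ polySet b m, ∀ r ∈ polySet b m,
      criterion b m γ P (j.val + 1) (Function.update g j p) ≤
        criterion b m γ P (j.val + 1) (Function.update g j r) :=
  Set.exists_min_image _ _ (finite_polySet b m) ⟨1, one_mem_polySet b hm⟩

theorem exists_isCBC (hm : m ≠ 0) (γ : Finset (Fin s) → ℝ≥0) (P : (ZMod b)[X]) :
    ∃ g : Fin (s * α) → (ZMod b)[X], IsCBC b m γ P g := by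
  have exists_prefix : ∀ d ≤ s * α, ∃ g : Fin (s * α) → (ZMod b)[X],
      (∀ j, g j ∈ polySet b m) ∧ (∀ j : Fin (s * α), j.val = 0 → g j = 1) ∧
      ∀ j : Fin (s * α), 0 < j.val → j.val < d → ∀ p ∈ polySet b m,
        criterion b m γ P (j.val + 1) g ≤
          criterion b m γ P (j.val + 1) (Function.update g j p) := by
    intro d
    induction d with
    | zero => exact fun _ => ⟨fun _ => 1, fun _ => one_mem_polySet b hm, fun _ _ => rfl, by omega⟩
    | succ d ih =>
      intro hd
      obtain ⟨g, mem, first, minimal⟩ := ih (by omega)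
      rcases Nat.eq_zero_or_pos d with rfl | d_pos
      · exact ⟨g, mem, first, by omega⟩
      let k : Fin (s * α) := ⟨d, hd⟩
      obtain ⟨p, hp, hmin⟩ := exists_criterion_update_minimal hm γ P k g
      refine ⟨Function.update g k p,
        Function.forall_update_iff g (fun _ q => q ∈ polySet b m) |>.2 ⟨hp, fun j _ => mem j⟩,
        fun j hj => ?_, fun j hj hjd r hr => ?_⟩
      · rw [Function.update_of_ne (Fin.ne_of_lt (hj.trans_lt d_pos : j < k))]
        exact first j hj
      · rcases (Nat.lt_succ_iff.1 hjd).eq_or_lt with eq | lt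
        · obtain rfl : j = k := Fin.ext eq
          rw [Function.update_idem]
          exact hmin r hr
        · rw [Function.update_comm (Fin.ne_of_gt lt), criterion_update (Nat.succ_le_of_lt lt),
            criterion_update (Nat.succ_le_of_lt lt)]
          exact minimal j hj lt r hr
  obtain ⟨g, mem, first, minimal⟩ := exists_prefix (s * α) le_rfl
  exact ⟨g, mem, first, fun j hj => minimal j hj j.2⟩

theorem exists_isModulus (b : ℕ) [Fact b.Prime] (hm : m ≠ 0) :
    ∃ P : (ZMod b)[X], IsModulus b m P := by
  obtain ⟨θ, hθ⟩ := Field.exists_primitive_element (ZMod b) (GaloisField b m)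
  have isIntegral : IsIntegral (ZMod b) θ := Algebra.IsIntegral.isIntegral θ
  refine ⟨minpoly (ZMod b) θ, minpoly.irreducible isIntegral, ?_⟩
  rw [← IntermediateField.adjoin.finrank isIntegral, hθ, IntermediateField.finrank_top',
    GaloisField.finrank b hm]

end Existence

section BlockSums

/-! ### Sums over sets of components with given blocks -/

variable {s α : ℕ}

/-- The part of a set of components in the `j`-th block. -/
def blockPart (v : Finset (Fin (s * α))) (j : Fin s) : Finset (Fin α) :=
  Finset.univ.filter fun i => finProdFinEquiv (j, i) ∈ v

lemma mem_blockPart {v : Finset (Fin (s * α))} {j : Fin s} {i : Fin α} :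
    i ∈ blockPart v j ↔ finProdFinEquiv (j, i) ∈ v := by
  rw [blockPart, Finset.mem_filter_univ]

lemma mem_blocks_iff {v : Finset (Fin (s * α))} {j : Fin s} :
    j ∈ blocks v ↔ (blockPart v j).Nonempty := by
  rw [blocks, Finset.mem_image]
  constructor
  · rintro ⟨p, hp, rfl⟩
    exact ⟨p.modNat, mem_blockPart.2 ((finProdFinEquiv.apply_symm_apply p).symm ▸ hp)⟩
  · rintro ⟨i, hi⟩
    exact ⟨_, mem_blockPart.1 hi, congrArg Prod.fst (finProdFinEquiv.symm_apply_apply (j, i))⟩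

/-- A set of components is given by its parts in the blocks. -/
def blockPartEquiv (s α : ℕ) : Finset (Fin (s * α)) ≃ (Fin s → Finset (Fin α)) where
  toFun := blockPart
  invFun f := Finset.univ.filter fun p => p.modNat ∈ f p.divNat
  left_inv v := by
    ext p
    rw [Finset.mem_filter_univ, mem_blockPart]
    exact iff_of_eq (congrArg (· ∈ v) (finProdFinEquiv.apply_symm_apply p))
  right_inv f := by
    ext j i
    rw [mem_blockPart, Finset.mem_filter_univ]
    exact iff_of_eq (congrArg (fun p : Fin s × Fin α => p.2 ∈ f p.1)
      (finProdFinEquiv.symm_apply_apply (j, i)))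

lemma sum_card_blockPart (v : Finset (Fin (s * α))) : ∑ j, (blockPart v j).card = v.card := by
  simp_rw [blockPart, Finset.card_filter]
  rw [← Fintype.sum_prod_type', Equiv.sum_comp finProdFinEquiv (fun p => if p ∈ v then 1 else 0),
    ← Finset.card_filter, Finset.filter_univ_mem]

variable {R : Type*} [CommRing R]

lemma sum_erase_empty_pow_card (x : R) :
    ∑ A ∈ (Finset.univ : Finset (Finset (Fin α))).erase ∅, x ^ A.card = (1 + x) ^ α - 1 := by
  have sum_univ : ∑ A : Finset (Fin α), x ^ A.card = (1 + x) ^ α := by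
    simpa [add_comm] using Fintype.sum_pow_mul_eq_add_pow (Fin α) x 1
  rw [eq_sub_iff_add_eq, ← sum_univ, ← Finset.sum_erase_add _ _ (Finset.mem_univ ∅),
    Finset.card_empty, pow_zero]

lemma sum_pow_card_of_blocks_eq (x : R) (u : Finset (Fin s)) :
    ∑ v : Finset (Fin (s * α)) with blocks v = u, x ^ v.card = ((1 + x) ^ α - 1) ^ u.card := by
  let parts : Fin s → Finset (Finset (Fin α)) := fun j =>
    if j ∈ u then Finset.univ.erase ∅ else {∅}
  have mem_parts : ∀ v : Finset (Fin (s * α)),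
      blocks v = u ↔ blockPart v ∈ Fintype.piFinset parts := fun v => by
    rw [Fintype.mem_piFinset, Finset.ext_iff]
    refine forall_congr' fun j => ?_
    by_cases hj : j ∈ u <;> simp [parts, hj, mem_blocks_iff, Finset.nonempty_iff_ne_empty]
  calc ∑ v : Finset (Fin (s * α)) with blocks v = u, x ^ v.card
      = ∑ f ∈ Fintype.piFinset parts, ∏ j, x ^ (f j).card :=
        Finset.sum_equiv (blockPartEquiv s α)
          (fun v => by rw [Finset.mem_filter_univ, mem_parts]; rfl)
          fun v _ => by rw [Finset.prod_pow_eq_pow_sum, ← sum_card_blockPart v]; rfl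
    _ = ∏ j, ∑ A ∈ parts j, x ^ A.card := (Finset.prod_univ_sum parts fun _ A => x ^ A.card).symm
    _ = ∏ j, if j ∈ u then (1 + x) ^ α - 1 else 1 := by
        refine Finset.prod_congr rfl fun j _ => ?_
        by_cases hj : j ∈ u
        · simp only [parts, if_pos hj, sum_erase_empty_pow_card]
        · simp only [parts, if_neg hj, Finset.sum_singleton, Finset.card_empty, pow_zero]
    _ = ((1 + x) ^ α - 1) ^ u.card := by
        rw [Finset.prod_ite_mem, Finset.univ_inter, Finset.prod_const]

lemma sum_initialSets_eq_sum_blocks {M : Type*} [AddCommMonoid M] (f : Finset (Fin (s * α)) → M) :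
    ∑ v ∈ initialSets (s * α) (s * α), f v =
      ∑ u : Finset (Fin s) with u.Nonempty, ∑ v with blocks v = u, f v := by
  have initialSets_eq : initialSets (s * α) (s * α) = Finset.univ.filter Finset.Nonempty := by
    ext v
    rw [mem_initialSets, Finset.mem_filter_univ, and_iff_left fun j _ => j.2]
  have mapsTo : ∀ v ∈ initialSets (s * α) (s * α),
      blocks v ∈ Finset.univ.filter fun u : Finset (Fin s) => u.Nonempty := fun v hv =>
    Finset.mem_filter_univ _ |>.2 (Finset.image_nonempty.2 (mem_initialSets.1 hv).1)
  rw [← Finset.sum_fiberwise_of_maps_to mapsTo]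
  refine Finset.sum_congr rfl fun u hu => Finset.sum_congr ?_ fun _ _ => rfl
  rw [initialSets_eq, Finset.filter_filter]
  refine Finset.filter_congr fun v _ => and_iff_right_of_imp ?_
  rintro rfl
  exact Finset.image_nonempty.1 ((Finset.mem_filter_univ _).1 hu)

end BlockSums

section WeightedBound

/-! ### The bound in terms of the weights -/

variable {b s α : ℕ} [Fact (1 < b)] {lam : ℝ}

lemma base_lt_rpow (b : ℕ) [Fact (1 < b)] {t : ℝ} (ht : 1 < t) : (b : ℝ) < (b : ℝ) ^ t := by
  simpa only [Real.rpow_one] using Real.rpow_lt_rpow_of_exponent_lt (one_lt_base b) ht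

lemma digitTotal_inv_pow_rpow (hlam : 1 < α * lam) :
    digitTotal b (((b : ℝ≥0∞) ^ α)⁻¹ ^ lam) =
      ENNReal.ofReal (((b : ℝ) - 1) / ((b : ℝ) ^ ((α : ℝ) * lam) - b)) := by
  have base_lt := base_lt_rpow b hlam
  have base_pos := base_pos b
  set B : ℝ := (b : ℝ) ^ ((α : ℝ) * lam) with hB
  have B_pos : 0 < B := base_pos.trans base_lt
  have decay_eq : ((b : ℝ≥0∞) ^ α)⁻¹ ^ lam = ENNReal.ofReal B⁻¹ := by
    rw [ENNReal.inv_rpow, ENNReal.ofReal_inv_of_pos B_pos, hB, Real.rpow_mul base_pos.le,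
      Real.rpow_natCast, ← ENNReal.ofReal_rpow_of_pos (pow_pos base_pos α),
      ENNReal.ofReal_pow base_pos.le, ENNReal.ofReal_natCast]
  have ratio_lt_one : (b : ℝ) * B⁻¹ < 1 := by
    rwa [← div_eq_mul_inv, div_lt_one B_pos]
  have card_eq : ((b - 1 : ℕ) : ℝ≥0∞) = ENNReal.ofReal (b - 1) := by
    rw [← Nat.cast_pred (Nat.cast_pos.1 base_pos), ENNReal.ofReal_natCast]
  rw [digitTotal_eq, decay_eq, card_eq, ← ENNReal.ofReal_natCast b, ← ENNReal.ofReal_one,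
    ← ENNReal.ofReal_mul base_pos.le, ← ENNReal.ofReal_sub _ (by positivity),
    ← ENNReal.ofReal_inv_of_pos (sub_pos.2 ratio_lt_one),
    ← ENNReal.ofReal_mul (sub_pos.2 (one_lt_base b)).le,
    ← ENNReal.ofReal_mul (by have := sub_pos.2 (one_lt_base b); positivity)]
  congr 1
  have := (sub_pos.2 base_lt).ne'
  field_simp

lemma cbcWeight_rpow (hα : 1 < α) (γ : Finset (Fin s) → ℝ≥0) (v : Finset (Fin (s * α)))
    (lam : ℝ) :
    cbcWeight b γ v ^ lam = (γ (blocks v) : ℝ) ^ lam *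
      ((constC α b * (b : ℝ) ^ (α * (α - 1) / 2)) ^ lam) ^ (blocks v).card := by
  have constC_nonneg : 0 ≤ constC α b := (constC_pos b hα).le
  rw [cbcWeight, pow_mul, mul_right_comm, ← mul_pow, mul_comm,
    Real.mul_rpow (by positivity) (by positivity), Real.rpow_pow_comm (by positivity)]

lemma termBound_eq_ofReal (hα : 1 < α) (γ : Finset (Fin s) → ℝ≥0) (h0 : 0 ≤ lam)
    (hlam : 1 < α * lam) (v : Finset (Fin (s * α))) :
    termBound b γ lam v = ENNReal.ofReal (cbcWeight b γ v ^ lam *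
      (((b : ℝ) - 1) / ((b : ℝ) ^ ((α : ℝ) * lam) - b)) ^ v.card) := by
  have ratio_nonneg : 0 ≤ ((b : ℝ) - 1) / ((b : ℝ) ^ ((α : ℝ) * lam) - b) :=
    div_nonneg (sub_pos.2 (one_lt_base b)).le (sub_pos.2 (base_lt_rpow b hlam)).le
  rw [termBound, digitTotal_inv_pow_rpow hlam, ENNReal.ofReal_mul
    (Real.rpow_nonneg (cbcWeight_nonneg hα γ v) _), ENNReal.ofReal_pow ratio_nonneg,
    ENNReal.ofReal_rpow_of_nonneg (cbcWeight_nonneg hα γ v) h0]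

lemma rho_nonneg (hα : 1 < α) (hlam : 1 < α * lam) : 0 ≤ rho α b lam := by
  have ratio_nonneg : 0 ≤ ((b : ℝ) - 1) / ((b : ℝ) ^ ((α : ℝ) * lam) - b) :=
    div_nonneg (sub_pos.2 (one_lt_base b)).le (sub_pos.2 (base_lt_rpow b hlam)).le
  have constC_pos := constC_pos b hα
  exact mul_nonneg (by positivity)
    (sub_nonneg.2 (one_le_pow₀ (le_add_of_nonneg_right ratio_nonneg)))

lemma sum_termBound (hα : 1 < α) (γ : Finset (Fin s) → ℝ≥0) (h0 : 0 ≤ lam) (hlam : 1 < α * lam) :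
    ∑ v ∈ initialSets (s * α) (s * α), termBound b γ lam v =
      ENNReal.ofReal
        (∑ u : Finset (Fin s) with u.Nonempty, (γ u : ℝ) ^ lam * rho α b lam ^ u.card) := by
  have rho_nonneg := rho_nonneg (b := b) hα hlam
  have ratio_nonneg : 0 ≤ ((b : ℝ) - 1) / ((b : ℝ) ^ ((α : ℝ) * lam) - b) :=
    div_nonneg (sub_pos.2 (one_lt_base b)).le (sub_pos.2 (base_lt_rpow b hlam)).le
  rw [sum_initialSets_eq_sum_blocks, ENNReal.ofReal_sum_of_nonneg fun u _ => by positivity]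
  refine Finset.sum_congr rfl fun u _ => ?_
  simp only [termBound_eq_ofReal hα γ h0 hlam]
  rw [← ENNReal.ofReal_sum_of_nonneg fun v _ => mul_nonneg
    (Real.rpow_nonneg (cbcWeight_nonneg hα γ v) _) (pow_nonneg ratio_nonneg _),
    rho, mul_pow, ← sum_pow_card_of_blocks_eq, Finset.mul_sum, Finset.mul_sum]
  refine congrArg _ (Finset.sum_congr rfl fun v hv => ?_)
  rw [cbcWeight_rpow hα, (Finset.mem_filter_univ _).1 hv, mul_assoc]

lemma toReal_le_of_mul_rpow_le {N B : ℝ} {x : ℝ≥0∞} (hN : 0 < N) (hB : 0 ≤ B) (h0 : 0 < lam)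
    (h : ENNReal.ofReal N * x ^ lam ≤ ENNReal.ofReal B) : x.toReal ≤ (B / N) ^ (1 / lam) := by
  have mul_le : N * x.toReal ^ lam ≤ B := by
    rw [ENNReal.toReal_rpow, ← ENNReal.toReal_ofReal hN.le, ← ENNReal.toReal_mul]
    exact ENNReal.toReal_le_of_le_ofReal hB h
  rwa [one_div, Real.le_rpow_inv_iff_of_pos ENNReal.toReal_nonneg (div_nonneg hB hN.le) h0,
    le_div_iff₀' hN]

end WeightedBound

theorem IsCBC.criterion_le {b m s α : ℕ} [Fact b.Prime] {γ : Finset (Fin s) → ℝ≥0} {P : (ZMod b)[X]}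
    {g : Fin (s * α) → (ZMod b)[X]} (hg : IsCBC b m γ P g) (hα : 1 < α) (hm : m ≠ 0)
    (hP : IsModulus b m P) {lam : ℝ} (h0 : 0 < lam) (h1 : lam ≤ 1) (hlam : 1 < α * lam) :
    criterion b m γ P (s * α) g ≠ ∞ ∧ (criterion b m γ P (s * α) g).toReal ≤
      (2 / ((b : ℝ) ^ m - 1) * ∑ u : Finset (Fin s) with u.Nonempty,
        (γ u : ℝ) ^ lam * rho α b lam ^ u.card) ^ (1 / lam) := by
  have rho_nonneg := rho_nonneg (b := b) hα hlam
  have one_lt : 1 < b ^ m := Nat.one_lt_pow hm (Nat.Prime.one_lt Fact.out)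
  have card_pos : (0 : ℝ) < (b : ℝ) ^ m - 1 := sub_pos.2 (by exact_mod_cast one_lt)
  have card_eq : ((b ^ m - 1 : ℕ) : ℝ≥0∞) = ENNReal.ofReal ((b : ℝ) ^ m - 1) := by
    rw [← Nat.cast_pow, ← Nat.cast_pred (zero_lt_one.trans one_lt), ENNReal.ofReal_natCast]
  have mul_rpow_le := hg.mul_criterion_rpow_le hm hP.1 hP.2 h0 h1 hlam le_rfl
  rw [sum_termBound hα γ h0.le hlam, card_eq, ← ENNReal.ofReal_ofNat 2,
    ← ENNReal.ofReal_mul zero_le_two] at mul_rpow_le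
  refine ⟨ne_top_of_mul_rpow_le (ENNReal.ofReal_pos.2 card_pos).ne' h0 ENNReal.ofReal_ne_top
    mul_rpow_le, ?_⟩
  rw [div_mul_eq_mul_div]
  exact toReal_le_of_mul_rpow_le card_pos (by positivity) h0 mul_rpow_le

end IPL

theorem mainTheorem5 (α s m b : ℕ) [Fact b.Prime] (hα : 1 < α) (hs : 1 ≤ s) (hm : 1 ≤ m)
    (q : ℝ≥0∞) (hq : 1 ≤ q) (γ : Finset (Fin s) → ℝ≥0) :
    (∃ P : (ZMod b)[X], IPL.IsModulus b m P) ∧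
    ∀ P : (ZMod b)[X], IPL.IsModulus b m P →
      (∃ g : Fin (s * α) → (ZMod b)[X], IPL.IsCBC b m γ P g) ∧
      ∀ g : Fin (s * α) → (ZMod b)[X], IPL.IsCBC b m γ P g →
        ∀ lam : ℝ, 1 / (α : ℝ) < lam → lam ≤ 1 →
        ∀ F : (Fin s → ℝ) → ℝ, IPL.MemSobolev α γ q ∞ F →
          |1 / (b : ℝ) ^ m * ∑ n ∈ Finset.range (b ^ m), F (IPL.interlacedPoint b m α P g n)
              - ∫ y in IPL.cube s, F y| ≤
            (2 / ((b : ℝ) ^ m - 1) *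
                ∑ u : Finset (Fin s) with u.Nonempty,
                  (γ u : ℝ) ^ lam * IPL.rho α b lam ^ u.card) ^ (1 / lam) *
              (IPL.sobolevENorm α γ q ∞ F).toReal := by
  have : NeZero α := ⟨by omega⟩
  have hm0 : m ≠ 0 := by omega
  refine ⟨IPL.exists_isModulus b hm0, fun P hP => ⟨IPL.exists_isCBC hm0 γ P, ?_⟩⟩
  intro g hg lam hlam hlam1 F hF
  have α_pos : (0 : ℝ) < α := by exact_mod_cast zero_lt_one.trans hα
  have lam_pos : 0 < lam := (one_div_pos.2 α_pos).trans hlam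
  have one_lt_mul : 1 < α * lam := (div_lt_iff₀' α_pos).1 hlam
  obtain ⟨criterion_ne_top, criterion_le⟩ :=
    hg.criterion_le hα hm0 hP lam_pos hlam1 one_lt_mul
  exact (hF.error_le_criterion hα hq hP.1.ne_zero hP.2 criterion_ne_top).trans
    (mul_le_mul_of_nonneg_right criterion_le ENNReal.toReal_nonneg)
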